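/- Let $M$ be a compact smooth manifold of real dimension $2n$ with a smooth almost complex structure $J$. A Hermitian metric on $(M,J)$ is a smooth Riemannian metric $g$ for which $J$ is an isometry. Its fundamental form is $\omega(X,Y)=g(JX,Y)$, and $g$ is called almost Kähler if $d\omega=0$. Write $A^{p,q}_J$ for the space of smooth complex $(p,q)$-forms on $(M,J)$. For a Hermitian metric $g$ let $*$ be the complex linear Hodge operator (with volume form $\omega^n/n!$), $d^*=-*d*$, $\Delta_d=dd^*+d^*d$, and set $$\mathcal H^{p,q}_d(g)=\{\alpha\in A^{p,q}_J : \Delta_d\alpha=0\},\qquad h^{p,q}_d(g)=\dim_{\mathbb C}\mathcal H^{p,q}_d(g).$$ Let $g$ be an almost Kähler metric on $(M,J)$. Then for every $0\le p\le n$: 1. $\mathcal H^{p,0}_d(g)=A^{p,0}_J\cap\ker d$. 2. In particular, $\mathcal H^{p,0}_d(g)$ does not depend on the choice of the almost Kähler metric: $\mathcal H^{p,0}_d(g')=\mathcal H^{p,0}_d(g)$ for every almost Kähler metric $g'$ on $(M,J)$. 3. $h^{p,0}_d(g)$ is the maximum of the values $h^{p,0}_d(g')$ over all Hermitian metrics $g'$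 on $(M,J)$. -/

import Mathlib

open scoped Manifold ContDiff

noncomputable section

namespace AlmostHermitian

/-! ### Linear algebra on one real vector space -/

section LinearAlgebra

variable {V : Type*}

theorem append_update {k l : ℕ} (w : Fin k → V) (v : Fin l → V) (j : Fin l) (x : V) :
    Fin.append w (Function.update v j x) =
      Function.update (Fin.append w v) (Fin.natAdd k j) x := by
  ext a
  refine Fin.addCases (fun a => ?_) (fun a => ?_) a
  · rw [Fin.append_left, Function.update_of_ne, Fin.append_left]
    intro h; have := congrArg Fin.val h; simp at this; omega
  · rw [Fin.append_right]
    by_cases h : a = j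
    · subst h; simp
    · rw [Function.update_of_ne h, Function.update_of_ne, Fin.append_right]
      intro h'; apply h; ext; have := congrArg Fin.val h'; simpa using this

variable [AddCommGroup V] [Module ℝ V] [TopologicalSpace V]

theorem prod_pair_update (n : ℕ) (b : V [⋀^Fin 2]→L[ℝ] ℝ) (v : Fin (2 * n) → V)
    (j : Fin (2 * n)) : ∃ L : V →ₗ[ℝ] ℝ, ∀ z, (∏ i : Fin n,
      b ![Function.update v j z ⟨2 * i, by omega⟩,
        Function.update v j z ⟨2 * i + 1, by omega⟩]) = L z := by
  have hj : (j : ℕ) / 2 < n := by omega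
  have key : ∀ z : V, ∀ i ∈ Finset.univ.erase (⟨j / 2, hj⟩ : Fin n),
      b ![Function.update v j z ⟨2 * i, by omega⟩,
        Function.update v j z ⟨2 * i + 1, by omega⟩] =
      b ![v ⟨2 * i, by omega⟩, v ⟨2 * i + 1, by omega⟩] := by
    intro z i hi
    have hne : (i : ℕ) ≠ j / 2 := fun h => (Finset.mem_erase.1 hi).1 (Fin.ext h)
    have h0 : (⟨2 * i, by omega⟩ : Fin (2 * n)) ≠ j := by
      intro h; have := congrArg Fin.val h; simp only at this; omega
    have h1 : (⟨2 * i + 1, by omega⟩ : Fin (2 * n)) ≠ j := by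
      intro h; have := congrArg Fin.val h; simp only at this; omega
    rw [Function.update_of_ne h0, Function.update_of_ne h1]
  have hu0 : ∀ w z : V, ![z, w] = Function.update ![0, w] 0 z := by
    intro w z; ext i; fin_cases i <;> simp
  have hu1 : ∀ w z : V, ![w, z] = Function.update ![w, 0] 1 z := by
    intro w z; ext i; fin_cases i <;> simp
  rcases Nat.even_or_odd' (j : ℕ) with ⟨c, hc | hc⟩
  · have e0 : (⟨2 * (j / 2 : ℕ), by omega⟩ : Fin (2 * n)) = j := by
      ext; simp only; omega
    have e1 : (⟨2 * (j / 2 : ℕ) + 1, by omega⟩ : Fin (2 * n)) ≠ j := by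
      intro h; have := congrArg Fin.val h; simp only at this; omega
    refine ⟨(∏ i ∈ Finset.univ.erase (⟨j / 2, hj⟩ : Fin n),
      b ![v ⟨2 * i, by omega⟩, v ⟨2 * i + 1, by omega⟩]) •
        b.toMultilinearMap.toLinearMap ![0, v ⟨2 * (j / 2 : ℕ) + 1, by omega⟩] 0, fun z => ?_⟩
    rw [← Finset.prod_erase_mul _ _ (Finset.mem_univ (⟨j / 2, hj⟩ : Fin n)),
      Finset.prod_congr rfl (key z), e0, Function.update_self, Function.update_of_ne e1, hu0]
    rfl
  · have e0 : (⟨2 * (j / 2 : ℕ), by omega⟩ : Fin (2 * n)) ≠ j := by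
      intro h; have := congrArg Fin.val h; simp only at this; omega
    have e1 : (⟨2 * (j / 2 : ℕ) + 1, by omega⟩ : Fin (2 * n)) = j := by
      ext; simp only; omega
    refine ⟨(∏ i ∈ Finset.univ.erase (⟨j / 2, hj⟩ : Fin n),
      b ![v ⟨2 * i, by omega⟩, v ⟨2 * i + 1, by omega⟩]) •
        b.toMultilinearMap.toLinearMap ![v ⟨2 * (j / 2 : ℕ), by omega⟩, 0] 1, fun z => ?_⟩
    rw [← Finset.prod_erase_mul _ _ (Finset.mem_univ (⟨j / 2, hj⟩ : Fin n)),
      Finset.prod_congr rfl (key z), e1, Function.update_self, Function.update_of_ne e0, hu1]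
    rfl

/-- The multilinear map `v ↦ ∏ i < n, b (v_{2i}, v_{2i+1})` attached to a `2`-form `b`. -/
def pairProduct (n : ℕ) (b : V [⋀^Fin 2]→L[ℝ] ℝ) :
    ContinuousMultilinearMap ℝ (fun _ : Fin (2 * n) => V) ℝ where
  toFun v := ∏ i : Fin n, b ![v ⟨2 * i, by omega⟩, v ⟨2 * i + 1, by omega⟩]
  map_update_add' := by
    intro inst v j x y
    obtain rfl : inst = instDecidableEqFin _ := Subsingleton.elim _ _
    obtain ⟨L, hL⟩ := prod_pair_update n b v j
    rw [hL, hL, hL, map_add]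
  map_update_smul' := by
    intro inst v j c x
    obtain rfl : inst = instDecidableEqFin _ := Subsingleton.elim _ _
    obtain ⟨L, hL⟩ := prod_pair_update n b v j
    rw [hL, hL, map_smul]
  cont := by
    refine continuous_finsetProd _ fun i _ => b.cont.comp ?_
    refine continuous_pi fun a => ?_
    fin_cases a
    · exact continuous_apply _
    · exact continuous_apply _

variable [IsTopologicalAddGroup V] [ContinuousSMul ℝ V]

/-- The `2n`-form `b ^ n / n!` (wedge power) attached to a `2`-form `b`:
`(b ^ n / n!)(v) = (1 / (2 ^ n n!)) ∑ σ, sign σ ∏ i < n, b (v_{σ (2i)}) (v_{σ (2i+1)})`. -/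
def wedgePowDivFactorial (n : ℕ) (b : V [⋀^Fin 2]→L[ℝ] ℝ) : V [⋀^Fin (2 * n)]→L[ℝ] ℝ :=
  (1 / ((2 : ℝ) ^ n * (n.factorial : ℝ))) • (pairProduct n b).alternatization

/-- Insertion of `k` vectors `w` in the first `k` slots of an `m`-form, where `k + l = m`:
the `l`-form `v ↦ τ (w_1, …, w_k, v_1, …, v_l)`. -/
def insertFirst {k l m : ℕ} (h : k + l = m) (τ : V [⋀^Fin m]→L[ℝ] ℝ) (w : Fin k → V) :
    V [⋀^Fin l]→L[ℝ] ℝ where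
  toFun v := τ fun a => Fin.append w v (Fin.cast h.symm a)
  map_update_add' := by
    intro inst v j x y
    obtain rfl : inst = instDecidableEqFin _ := Subsingleton.elim _ _
    subst h
    simp only [Fin.cast_eq_self, append_update]
    exact τ.map_update_add _ _ _ _
  map_update_smul' := by
    intro inst v j c x
    obtain rfl : inst = instDecidableEqFin _ := Subsingleton.elim _ _
    subst h
    simp only [Fin.cast_eq_self, append_update]
    exact τ.map_update_smul _ _ _ _
  map_eq_zero_of_eq' := by
    intro v i j hv hij
    subst h
    refine τ.map_eq_zero_of_eq _ (i := Fin.natAdd k i) (j := Fin.natAdd k j) ?_ ?_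
    · simpa using hv
    · intro h; apply hij; ext; have := congrArg Fin.val h; simpa using this
  cont := by
    subst h
    refine τ.cont.comp (continuous_pi fun a => ?_)
    refine Fin.addCases (fun a => ?_) (fun a => ?_) a
    · simpa using continuous_const
    · simpa using continuous_apply a

/-- The complex linear Hodge star `⋆ : Λᵏ ⊗ ℂ → Λˡ ⊗ ℂ`, `k + l = m`, of an inner product `g`
and a volume form `vol` on an `m`-dimensional space with basis `e`:
`(⋆β)(v) = (1 / k!) ∑ i j, (∏ a, g^{i_a j_a}) β(e_{i_1}, …, e_{i_k}) vol(e_{j_1}, …, e_{j_k}, v)`,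
where `g^{ij}` is the inverse of the Gram matrix of `e`. The result is independent of `e` and
satisfies `α ∧ ⋆β = g(α, β) vol`. -/
def hodgeStar {k l m : ℕ} (h : k + l = m) (g : V →L[ℝ] V →L[ℝ] ℝ) (vol : V [⋀^Fin m]→L[ℝ] ℝ)
    (e : Fin m → V) (β : V [⋀^Fin k]→L[ℝ] ℂ) : V [⋀^Fin l]→L[ℝ] ℂ :=
  (1 / (k.factorial : ℝ)) • ∑ i : Fin k → Fin m, ∑ j : Fin k → Fin m,
    (∏ a, (Matrix.of fun s t => g (e s) (e t))⁻¹ (i a) (j a)) •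
      (ContinuousLinearMap.toSpanSingleton ℝ (β (e ∘ i))).compContinuousAlternatingMap
        (insertFirst h vol (e ∘ j))

/-- The space `Λ^{p,q}` of `ℂ`-valued alternating forms of type `(p,q)` with respect to `J`: the
complex span of the wedge products `θ₁ ∧ ⋯ ∧ θ_{p+q}`, i.e. `v ↦ det (θ_i (v_j))`, of `p` covectors
of type `(1,0)` (that is `θ ∘ J = i θ`) and `q` covectors of type `(0,1)` (that is
`θ ∘ J = - i θ`). -/
def typeForms (J : V →L[ℝ] V) (p q : ℕ) : Submodule ℂ (V [⋀^Fin (p + q)]→L[ℝ] ℂ) :=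
  Submodule.span ℂ {β | ∃ θ : Fin (p + q) → V →L[ℝ] ℂ,
    (∀ i : Fin (p + q), (i : ℕ) < p → ∀ v, θ i (J v) = Complex.I * θ i v) ∧
    (∀ i : Fin (p + q), p ≤ (i : ℕ) → ∀ v, θ i (J v) = -Complex.I * θ i v) ∧
    ∀ v, β v = Matrix.det (Matrix.of fun i j => θ i (v j))}

end LinearAlgebra

/-! ### Manifolds -/

variable {n : ℕ} {M : Type*} [TopologicalSpace M]
  [ChartedSpace (EuclideanSpace ℝ (Fin (2 * n))) M]

variable (n M) in
/-- Differential `k`-forms with values in `F` (not necessarily smooth) on a `2n`-manifold `M`. -/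
abbrev Form (F : Type*) [NormedAddCommGroup F] [NormedSpace ℝ F] (k : ℕ) : Type _ :=
  ∀ x : M, TangentSpace (𝓡 (2 * n)) x [⋀^Fin k]→L[ℝ] F

section Calculus

variable {F : Type*} [NormedAddCommGroup F] [NormedSpace ℝ F] {k : ℕ}

/-- The expression of `α` in the chart at `x₀`: the pull-back of `α` by the inverse chart. -/
def chartForm (α : Form n M F k) (x₀ : M) (y : EuclideanSpace ℝ (Fin (2 * n))) :
    EuclideanSpace ℝ (Fin (2 * n)) [⋀^Fin k]→L[ℝ] F :=
  (α ((extChartAt (𝓡 (2 * n)) x₀).symm y)).compContinuousLinearMap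
    (mfderiv 𝓘(ℝ, EuclideanSpace ℝ (Fin (2 * n))) (𝓡 (2 * n)) (extChartAt (𝓡 (2 * n)) x₀).symm y)

/-- A form is smooth if all its chart expressions are. -/
def IsSmoothForm (α : Form n M F k) : Prop :=
  ∀ x₀ : M, ContDiffOn ℝ ∞ (chartForm α x₀) (extChartAt (𝓡 (2 * n)) x₀).target

/-- The exterior derivative on `M`, computed at `x` in the chart at `x`. -/
def extD (α : Form n M F k) : Form n M F (k + 1) := fun x =>
  (extDeriv (chartForm α x) (extChartAt (𝓡 (2 * n)) x x)).compContinuousLinearMap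
    (mfderiv (𝓡 (2 * n)) 𝓘(ℝ, EuclideanSpace ℝ (Fin (2 * n))) (extChartAt (𝓡 (2 * n)) x) x)

end Calculus

variable [IsManifold (𝓡 (2 * n)) ∞ M]

variable (n M) in
/-- A smooth almost complex structure on a `2n`-manifold. -/
structure AlmostComplexStructure where
  /-- The endomorphism of each tangent space. -/
  toFun (x : M) : TangentSpace (𝓡 (2 * n)) x →L[ℝ] TangentSpace (𝓡 (2 * n)) x
  sq_eq_neg (x : M) (v : TangentSpace (𝓡 (2 * n)) x) : toFun x (toFun x v) = -v
  smooth : ContMDiff (𝓡 (2 * n))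
    ((𝓡 (2 * n)).prod
      𝓘(ℝ, EuclideanSpace ℝ (Fin (2 * n)) →L[ℝ] EuclideanSpace ℝ (Fin (2 * n)))) ∞
    fun x => Bundle.TotalSpace.mk'
      (EuclideanSpace ℝ (Fin (2 * n)) →L[ℝ] EuclideanSpace ℝ (Fin (2 * n)))
      (E := fun x : M => TangentSpace (𝓡 (2 * n)) x →L[ℝ] TangentSpace (𝓡 (2 * n)) x) x (toFun x)

/-- A Hermitian metric on `(M, J)`: a smooth Riemannian metric for which `J` is an isometry. -/
structure HermitianMetric (J : AlmostComplexStructure n M) extends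
    Bundle.ContMDiffRiemannianMetric (𝓡 (2 * n)) ∞ (EuclideanSpace ℝ (Fin (2 * n)))
      (fun x : M => TangentSpace (𝓡 (2 * n)) x) where
  isometry (x : M) (v w : TangentSpace (𝓡 (2 * n)) x) :
    inner x (J.toFun x v) (J.toFun x w) = inner x v w

namespace HermitianMetric

variable {J : AlmostComplexStructure n M} (g : HermitianMetric J)

/-- The fundamental form `ω(X, Y) = g(JX, Y)`. -/
def fundamentalForm : Form n M ℝ 2 := fun x =>
  { toFun := fun v => g.inner x (J.toFun x (v 0)) (v 1)
    map_update_add' := by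
      intro inst v i a b
      obtain rfl : inst = instDecidableEqFin _ := Subsingleton.elim _ _
      fin_cases i <;> simp
    map_update_smul' := by
      intro inst v i c a
      obtain rfl : inst = instDecidableEqFin _ := Subsingleton.elim _ _
      fin_cases i <;> simp
    map_eq_zero_of_eq' := by
      intro v i j hv hij
      have h01 : v 0 = v 1 := by
        fin_cases i <;> fin_cases j <;> simp_all
      have h1 := g.isometry x (v 1) (J.toFun x (v 1))
      have h2 := g.symm x (v 1) (J.toFun x (v 1))
      rw [J.sq_eq_neg, map_neg] at h1
      rw [h01]
      linarith
    cont := by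
      have key : ∀ B : EuclideanSpace ℝ (Fin (2 * n)) →L[ℝ] EuclideanSpace ℝ (Fin (2 * n)) →L[ℝ] ℝ,
          Continuous fun v : Fin 2 → EuclideanSpace ℝ (Fin (2 * n)) => B (v 0) (v 1) :=
        fun B => (B.continuous.comp (continuous_apply 0)).clm_apply (continuous_apply 1)
      exact key ((g.inner x).comp (J.toFun x)) }

/-- The metric is almost Kähler if its fundamental form is closed. -/
def IsAlmostKahler : Prop := extD g.fundamentalForm = 0

/-- The complex linear Hodge star of `(M, J, g)`, with volume form `ωⁿ / n!`. -/
def star {k l : ℕ} (h : k + l = 2 * n) (β : Form n M ℂ k) : Form n M ℂ l := fun x =>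
  hodgeStar h (g.inner x) (wedgePowDivFactorial n (g.fundamentalForm x))
    (fun i => (EuclideanSpace.single i (1 : ℝ) : EuclideanSpace ℝ (Fin (2 * n)))) (β x)

/-- The codifferential `d* = - ⋆ d ⋆` on `(k+1)`-forms (which vanish if `k + 1 > 2n`). -/
def codiff {k : ℕ} (β : Form n M ℂ (k + 1)) : Form n M ℂ k :=
  if h : k + 1 ≤ 2 * n then
    -g.star (l := k) (by omega) (extD (g.star (l := 2 * n - (k + 1)) (by omega) β))
  else 0

/-- The Laplacian `Δ_d = d d* + d* d` (with `d* = 0` on `0`-forms). -/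
def laplacian : {k : ℕ} → Form n M ℂ k → Form n M ℂ k
  | 0, α => g.codiff (extD α)
  | _ + 1, α => extD (g.codiff α) + g.codiff (extD α)

end HermitianMetric

/-- The space `A^{p,q}_J` of smooth `(p,q)`-forms. -/
def smoothForms (J : AlmostComplexStructure n M) (p q : ℕ) : Set (Form n M ℂ (p + q)) :=
  {α | IsSmoothForm α ∧ ∀ x, α x ∈ typeForms (J.toFun x) p q}

/-- The space `A^{p,q}_J ∩ ker d` of `d`-closed `(p,q)`-forms. -/
def closedForms (J : AlmostComplexStructure n M) (p q : ℕ) : Set (Form n M ℂ (p + q)) :=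
  {α | α ∈ smoothForms J p q ∧ extD α = 0}

/-- The space `ℋ^{p,q}_d` of `d`-harmonic `(p,q)`-forms of the metric `g`. -/
def harmonicForms {J : AlmostComplexStructure n M} (g : HermitianMetric J) (p q : ℕ) :
    Set (Form n M ℂ (p + q)) :=
  {α | α ∈ smoothForms J p q ∧ g.laplacian α = 0}

/-- The number `h^{p,q}_d`, the complex dimension of `ℋ^{p,q}_d` (as `Δ_d` is linear on smooth
forms, `ℋ^{p,q}_d` is its own linear span). -/
def hodgeNumber {J : AlmostComplexStructure n M} (g : HermitianMetric J) (p q : ℕ) : Cardinal :=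
  Module.rank ℂ (Submodule.span ℂ (harmonicForms g p q))

end AlmostHermitian

end

noncomputable section

namespace AlmostHermitian

/-! ### Signed sums over permutations -/

section Permutations

open Equiv

/-! Two facts carry the theorem. On a compact manifold, a smooth harmonic form of any Hermitian
metric is closed (`extD_eq_zero_of_laplacian_eq_zero`): pairing `Δ_d α` with `α` and integrating by
parts gives positive multiples of `‖d*α‖²` and `‖dα‖²`, whose sum is zero. For an almost Kähler
metric, a closed `(p,0)`-form is also coclosed (`extD_star_eq_zero`): pointwise `⋆α` is a constant
multiple of `α ∧ ω^(n-p)`, which is closed as soon as `α` and `ω` are. So the harmonic `(p,0)`-forms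
of an almost Kähler metric are all the closed ones, a space that does not see the metric, while any
other Hermitian metric has at most these. Monotonicity of the rank then gives the maximum; neither
Hodge decomposition nor finiteness of dimension is used.

The formula for `⋆` on `(p,0)`-forms (`hodgeStar_of_det`) is a Pfaffian computation. On `θ₁ ∧ ⋯ ∧
θ_p` the star inserts the vectors dual to the `θ_a` into `ωⁿ/n!`. Its value at `v` is, up to a
constant, the determinant of the matrix `B` whose rows are the coordinates of the `θ_a` and of the
`v_j` in a unitary frame (`sum_insertFirst_mul_prod`). With `Ω` the standard symplectic matrix, `det
B` times the Pfaffian of `Ω` is the Pfaffian of `B Ω Bᵀ` (`sum_pfaffianTerm_congruence`). The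
entries of `B Ω Bᵀ` are `0` between two `θ`s, because they are of type `(1,0)`, then `-i θ_a(v_j)`,
and `ω(v_i, v_j)`. A Pfaffian with such an isotropic block only pairs each `θ` with some `v`
(`sum_pfaffianTerm_of_isotropic`), and the resulting sum is `α ∧ ω^(n-p)` up to a constant.

Wedge products appear as signed sums over all permutations, without factorial normalization. The
Leibniz rule for `α ∧ ω^(n-p)` and the theorem of Stokes both come from the permutation identity
`sum_sign_smul_insert`. Positive constants are carried along and not evaluated, and `ωⁿ/n!` on a
unitary frame is only needed to be nonzero. Integrals are taken chart by chart against the absolute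
value of the volume density, so no orientation is chosen. -/

theorem sum_sign_smul_insert {ι V F : Type*} [Fintype ι] [DecidableEq ι] [AddCommGroup F] {k : ℕ}
    (e : Fin (k + 1) ↪ ι) (D : V → (Fin k → V) → (ι → V) → F)
    (hD : ∀ a b w w', (∀ x ∉ Set.range e, w x = w' x) → D a b w = D a b w') (v : ι → V) :
    (k + 1) • ∑ σ : Perm ι, Perm.sign σ •
      D (v (σ (e 0))) (fun j => v (σ (e j.succ))) (v ∘ σ) =
    ∑ σ : Perm ι, Perm.sign σ • ∑ i : Fin (k + 1), (-1 : ℤˣ) ^ (i : ℕ) •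
      D (v (σ (e i))) (fun j => v (σ (e (i.succAbove j)))) (v ∘ σ) := by
  have key : ∀ i : Fin (k + 1), ∑ σ : Perm ι, Perm.sign σ •
      D (v (σ (e 0))) (fun j => v (σ (e j.succ))) (v ∘ σ) =
      ∑ σ : Perm ι, Perm.sign σ • (-1 : ℤˣ) ^ (i : ℕ) •
      D (v (σ (e i))) (fun j => v (σ (e (i.succAbove j)))) (v ∘ σ) := by
    intro i
    rw [← Equiv.sum_comp (Equiv.mulRight (Perm.viaFintypeEmbedding i.cycleRange.symm e))]
    refine Finset.sum_congr rfl fun σ _ => ?_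
    simp only [Equiv.coe_mulRight, Perm.coe_mul, Function.comp_apply,
      Perm.viaFintypeEmbedding_apply_image, Fin.cycleRange_symm_zero, Fin.cycleRange_symm_succ,
      Perm.sign_mul, Perm.viaFintypeEmbedding_sign, Perm.sign_symm, Fin.sign_cycleRange,
      mul_smul]
    congr 2
    refine hD _ _ _ _ fun x hx => ?_
    simp [Perm.viaFintypeEmbedding_apply_notMem_range _ _ hx]
  simp only [Finset.smul_sum]
  rw [Finset.sum_comm, ← Finset.sum_congr rfl (fun i _ => key i)]
  simp [Finset.smul_sum]

variable {R : Type*} [CommRing R] {n : ℕ}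

/-- The term of the Pfaffian sum attached to a permutation. -/
def pfaffianTerm (A : Fin (2 * n) → Fin (2 * n) → R) (σ : Perm (Fin (2 * n))) : R :=
  Perm.sign σ • ∏ i : Fin n, A (σ ⟨2 * i, by omega⟩) (σ ⟨2 * i + 1, by omega⟩)

/-- Exchanging the two entries of one pair changes both the sign of the permutation and, by
skewness, one factor of the product. -/
theorem pfaffianTerm_mul_flip (A : Fin (2 * n) → Fin (2 * n) → R) (hA : ∀ i j, A i j = -A j i)
    (σ : Perm (Fin (2 * n))) (a : Fin n) :
    pfaffianTerm A (σ * swap ⟨2 * a, by omega⟩ ⟨2 * a + 1, by omega⟩) = pfaffianTerm A σ := by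
  have h1 : Perm.sign (swap (⟨2 * a, by omega⟩ : Fin (2 * n)) ⟨2 * a + 1, by omega⟩) = -1 :=
    Perm.sign_swap (by simp [Fin.ext_iff])
  unfold pfaffianTerm
  rw [Perm.sign_mul, h1, ← Finset.mul_prod_erase _ _ (Finset.mem_univ a),
    ← Finset.mul_prod_erase _ _ (Finset.mem_univ a)]
  have h2 : ∀ i ∈ Finset.univ.erase a,
      A ((σ * swap (⟨2 * a, by omega⟩ : Fin (2 * n)) ⟨2 * a + 1, by omega⟩) ⟨2 * i, by omega⟩)
        ((σ * swap (⟨2 * a, by omega⟩ : Fin (2 * n)) ⟨2 * a + 1, by omega⟩) ⟨2 * i + 1, by omega⟩) =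
      A (σ ⟨2 * i, by omega⟩) (σ ⟨2 * i + 1, by omega⟩) := by
    intro i hi
    have hne : (i : ℕ) ≠ a := fun h => (Finset.mem_erase.1 hi).1 (Fin.ext h)
    rw [Perm.mul_apply, Perm.mul_apply, swap_apply_of_ne_of_ne, swap_apply_of_ne_of_ne] <;>
      simp only [ne_eq, Fin.mk.injEq] <;> omega
  rw [Finset.prod_congr rfl h2]
  simp only [Perm.mul_apply, swap_apply_left, swap_apply_right]
  rw [hA (σ ⟨2 * a + 1, by omega⟩)]
  simp

/-- Exchanging two whole pairs is an even permutation and merely reorders the factors; skewness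
plays no role. -/
theorem pfaffianTerm_mul_pairSwap (A : Fin (2 * n) → Fin (2 * n) → R)
    (σ : Perm (Fin (2 * n))) (a b : Fin n) :
    pfaffianTerm A (σ * (swap ⟨2 * a, by omega⟩ ⟨2 * b, by omega⟩ *
      swap ⟨2 * a + 1, by omega⟩ ⟨2 * b + 1, by omega⟩)) = pfaffianTerm A σ := by
  by_cases hab : a = b
  · subst hab; rw [swap_self, swap_self]; rfl
  have hab' : (a : ℕ) ≠ b := fun h => hab (Fin.ext h)
  have h1 : Perm.sign (swap (⟨2 * a, by omega⟩ : Fin (2 * n)) ⟨2 * b, by omega⟩) = -1 :=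
    Perm.sign_swap (by simp only [ne_eq, Fin.mk.injEq]; omega)
  have h2 : Perm.sign (swap (⟨2 * a + 1, by omega⟩ : Fin (2 * n)) ⟨2 * b + 1, by omega⟩) = -1 :=
    Perm.sign_swap (by simp only [ne_eq, Fin.mk.injEq]; omega)
  unfold pfaffianTerm
  rw [Perm.sign_mul, Perm.sign_mul, h1, h2, neg_mul_neg, one_mul, mul_one,
    ← Equiv.prod_comp (swap a b)]
  congr 1
  refine Finset.prod_congr rfl fun i _ => ?_
  have e0 : (swap (⟨2 * a, by omega⟩ : Fin (2 * n)) ⟨2 * b, by omega⟩ *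
      swap (⟨2 * a + 1, by omega⟩ : Fin (2 * n)) ⟨2 * b + 1, by omega⟩) ⟨2 * (swap a b i : Fin n), by omega⟩ =
      ⟨2 * i, by omega⟩ := by
    rw [Perm.mul_apply]
    have : swap (⟨2 * a + 1, by omega⟩ : Fin (2 * n)) ⟨2 * b + 1, by omega⟩
        ⟨2 * (swap a b i : Fin n), by omega⟩ = ⟨2 * (swap a b i : Fin n), by omega⟩ := by
      rw [swap_apply_of_ne_of_ne] <;> simp only [ne_eq, Fin.mk.injEq] <;> omega
    rw [this]
    by_cases hi : i = a
    · subst hi; simp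
    by_cases hi' : i = b
    · subst hi'; simp
    have hia : (i : ℕ) ≠ a := fun h => hi (Fin.ext h)
    have hib : (i : ℕ) ≠ b := fun h => hi' (Fin.ext h)
    simp only [swap_apply_of_ne_of_ne hi hi']
    rw [swap_apply_of_ne_of_ne] <;> simp only [ne_eq, Fin.mk.injEq] <;> omega
  have e1 : (swap (⟨2 * a, by omega⟩ : Fin (2 * n)) ⟨2 * b, by omega⟩ *
      swap (⟨2 * a + 1, by omega⟩ : Fin (2 * n)) ⟨2 * b + 1, by omega⟩) ⟨2 * (swap a b i : Fin n) + 1, by omega⟩ =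
      ⟨2 * i + 1, by omega⟩ := by
    rw [Perm.mul_apply]
    have : swap (⟨2 * a + 1, by omega⟩ : Fin (2 * n)) ⟨2 * b + 1, by omega⟩
        ⟨2 * (swap a b i : Fin n) + 1, by omega⟩ = ⟨2 * i + 1, by omega⟩ := by
      by_cases hi : i = a
      · subst hi; simp
      by_cases hi' : i = b
      · subst hi'; simp
      have hia : (i : ℕ) ≠ a := fun h => hi (Fin.ext h)
      have hib : (i : ℕ) ≠ b := fun h => hi' (Fin.ext h)
      simp only [swap_apply_of_ne_of_ne hi hi']
      rw [swap_apply_of_ne_of_ne] <;> simp only [ne_eq, Fin.mk.injEq] <;> omega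
    rw [this, swap_apply_of_ne_of_ne] <;> simp only [ne_eq, Fin.mk.injEq] <;> omega
  rw [Perm.mul_apply σ, Perm.mul_apply σ, e0, e1]

/-- A pair exchange, followed by a flip when `j` is odd, carries slot `2q` to any slot `j` not
before it. The earlier even slots stay put, so indices already placed there are not disturbed. -/
theorem exists_perm_pfaffianTerm (A : Fin (2 * n) → Fin (2 * n) → R)
    (hA : ∀ i j, A i j = -A j i) (q : Fin n) (j : Fin (2 * n)) (hj : 2 * (q : ℕ) ≤ j) :
    ∃ h : Perm (Fin (2 * n)), (∀ σ, pfaffianTerm A (σ * h) = pfaffianTerm A σ) ∧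
      h ⟨2 * q, by omega⟩ = j ∧ ∀ a : Fin n, a < q → h ⟨2 * a, by omega⟩ = ⟨2 * a, by omega⟩ := by
  have hb : (j : ℕ) / 2 < n := by omega
  set b : Fin n := ⟨j / 2, hb⟩
  have hs : ∀ a : Fin n, a < q → (swap (⟨2 * q, by omega⟩ : Fin (2 * n)) ⟨2 * b, by omega⟩ *
      swap (⟨2 * q + 1, by omega⟩ : Fin (2 * n)) ⟨2 * b + 1, by omega⟩) ⟨2 * a, by omega⟩ =
      ⟨2 * a, by omega⟩ := by
    intro a ha
    have ha' : (a : ℕ) < q := ha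
    have hb' : (b : ℕ) = j / 2 := rfl
    rw [Perm.mul_apply, swap_apply_of_ne_of_ne (a := (⟨2 * q + 1, by omega⟩ : Fin (2 * n))),
      swap_apply_of_ne_of_ne] <;> simp only [ne_eq, Fin.mk.injEq] <;> omega
  have hq : (swap (⟨2 * q, by omega⟩ : Fin (2 * n)) ⟨2 * b, by omega⟩ *
      swap (⟨2 * q + 1, by omega⟩ : Fin (2 * n)) ⟨2 * b + 1, by omega⟩) ⟨2 * q, by omega⟩ =
      ⟨2 * b, by omega⟩ := by
    rw [Perm.mul_apply, swap_apply_of_ne_of_ne (a := (⟨2 * q + 1, by omega⟩ : Fin (2 * n))),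
      swap_apply_left] <;> simp only [ne_eq, Fin.mk.injEq] <;> omega
  rcases Nat.even_or_odd' (j : ℕ) with ⟨c, hc | hc⟩
  · refine ⟨_, fun σ => pfaffianTerm_mul_pairSwap A σ q b, ?_, hs⟩
    rw [hq]; ext; simp only [b]; omega
  · refine ⟨swap ⟨2 * b, by omega⟩ ⟨2 * b + 1, by omega⟩ *
      (swap ⟨2 * q, by omega⟩ ⟨2 * b, by omega⟩ *
        swap ⟨2 * q + 1, by omega⟩ ⟨2 * b + 1, by omega⟩), fun σ => ?_, ?_, fun a ha => ?_⟩
    · rw [← mul_assoc, pfaffianTerm_mul_pairSwap, pfaffianTerm_mul_flip A hA]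
    · rw [Perm.mul_apply, hq, swap_apply_left]; ext; simp only [b]; omega
    · have ha' : (a : ℕ) < q := ha
      have hb' : (b : ℕ) = j / 2 := rfl
      rw [Perm.mul_apply, hs a ha, swap_apply_of_ne_of_ne] <;>
        simp only [ne_eq, Fin.mk.injEq] <;> omega

open Classical in
-- Sort the permutations by the slot `j` holding the index `q`. If `j ≥ 2q`, a symmetry of the terms
-- moves `q` to slot `2q`, and there are `2n - 2q` such slots. If `j < 2q` is even, the slot is
-- already occupied by a smaller index; if it is odd, `q` is paired with a smaller index and the
-- term vanishes by isotropy.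
theorem sum_pfaffianTerm_step (A : Fin (2 * n) → Fin (2 * n) → R)
    (hA : ∀ i j, A i j = -A j i) (q : Fin n)
    (hq : ∀ a : Fin n, a < q → A ⟨a, by omega⟩ ⟨q, by omega⟩ = 0) :
    ∑ σ with ∀ a : Fin n, (a : ℕ) < q → σ ⟨2 * a, by omega⟩ = ⟨a, by omega⟩, pfaffianTerm A σ =
    (2 * (n - q)) • ∑ σ with ∀ a : Fin n, (a : ℕ) < q + 1 → σ ⟨2 * a, by omega⟩ = ⟨a, by omega⟩,
      pfaffianTerm A σ := by
  set q' : Fin (2 * n) := ⟨q, by omega⟩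
  rw [← Finset.sum_fiberwise (s := Finset.univ.filter _) (g := fun σ : Perm (Fin (2 * n)) =>
    σ.symm q')]
  have key : ∀ j : Fin (2 * n), ∑ σ ∈ Finset.univ.filter (fun σ : Perm (Fin (2 * n)) =>
      ∀ a : Fin n, (a : ℕ) < q → σ ⟨2 * a, by omega⟩ = ⟨a, by omega⟩) with σ.symm q' = j,
        pfaffianTerm A σ =
      if 2 * (q : ℕ) ≤ j then ∑ σ with ∀ a : Fin n, (a : ℕ) < q + 1 →
        σ ⟨2 * a, by omega⟩ = ⟨a, by omega⟩, pfaffianTerm A σ else 0 := by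
    intro j
    split_ifs with hj
    · obtain ⟨h, h1, h2, h3⟩ := exists_perm_pfaffianTerm A hA q j hj
      refine Finset.sum_equiv (Equiv.mulRight h) (fun σ => ?_) fun σ _ => (h1 σ).symm
      simp only [Finset.mem_filter, Finset.mem_univ, true_and, Equiv.coe_mulRight,
        Perm.mul_apply]
      constructor
      · rintro ⟨h4, h5⟩ a ha
        rcases Nat.lt_succ_iff_lt_or_eq.1 ha with ha | ha
        · rw [h3 a ha]; exact h4 a ha
        · obtain rfl : a = q := Fin.ext ha
          rw [h2, ← h5]; simp [q']
      · intro h4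
        refine ⟨fun a ha => ?_, ?_⟩
        · rw [← h4 a (by omega), h3 a ha]
        · rw [Equiv.symm_apply_eq, ← h2, h4 q (by omega)]
    · refine Finset.sum_eq_zero fun σ hσ => ?_
      simp only [Finset.mem_filter, Finset.mem_univ, true_and] at hσ
      obtain ⟨h4, h5⟩ := hσ
      rw [Equiv.symm_apply_eq] at h5
      have hlt : (j : ℕ) / 2 < q := by omega
      have h6 := h4 ⟨j / 2, by omega⟩ hlt
      rcases Nat.even_or_odd' (j : ℕ) with ⟨c, hc | hc⟩
      · have e0 : (⟨2 * (j / 2 : ℕ), by omega⟩ : Fin (2 * n)) = j := by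
          ext; simp only; omega
        simp only [e0, ← h5, q'] at h6
        have := congrArg Fin.val h6
        simp only at this
        omega
      · unfold pfaffianTerm
        rw [Finset.prod_eq_zero (Finset.mem_univ (⟨j / 2, by omega⟩ : Fin n)), smul_zero]
        have e1 : (⟨2 * (j / 2 : ℕ) + 1, by omega⟩ : Fin (2 * n)) = j := by
          ext; simp only; omega
        simp only [h6, e1, ← h5]
        exact hq ⟨j / 2, by omega⟩ hlt
  rw [Finset.sum_congr rfl fun j _ => key j, ← Finset.sum_filter, Finset.sum_const]
  congr 1
  have : (Finset.univ.filter fun j : Fin (2 * n) => 2 * (q : ℕ) ≤ j) =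
      Finset.Ici ⟨2 * q, by omega⟩ := by
    ext j; simp [Fin.le_def]
  rw [this, Fin.card_Ici]
  simp only; omega

open Classical in
theorem sum_pfaffianTerm_eq (A : Fin (2 * n) → Fin (2 * n) → R)
    (hA : ∀ i j, A i j = -A j i) {p : ℕ} (hp : p ≤ n)
    (h0 : ∀ a b : Fin (2 * n), (a : ℕ) < p → (b : ℕ) < p → A a b = 0) :
    ∑ σ, pfaffianTerm A σ = (∏ q ∈ Finset.range p, (2 * (n - q))) •
      ∑ σ with ∀ a : Fin n, (a : ℕ) < p → σ ⟨2 * a, by omega⟩ = ⟨a, by omega⟩,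
        pfaffianTerm A σ := by
  suffices h : ∀ q ≤ p, ∑ σ, pfaffianTerm A σ = (∏ q ∈ Finset.range q, (2 * (n - q))) •
      ∑ σ with ∀ a : Fin n, (a : ℕ) < q → σ ⟨2 * a, by omega⟩ = ⟨a, by omega⟩,
        pfaffianTerm A σ from h p le_rfl
  intro q hq
  induction q with
  | zero => simp
  | succ q ih =>
    rw [ih (by omega), sum_pfaffianTerm_step A hA ⟨q, by omega⟩
      (fun a ha => h0 _ _ (by have : (a : ℕ) < q := ha; simp only; omega) (by simp only; omega)),
      Finset.prod_range_succ, mul_smul (∏ q ∈ Finset.range q, (2 * (n - q)))]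

/-- The permutation of positions that lists the even places `0, 2, …, 2p - 2` first, then the odd
places `1, 3, …, 2p - 1`, then all others. -/
def evenFirst (n p : ℕ) (hp : p ≤ n) : Perm (Fin (2 * n)) :=
  Equiv.ofBijective (fun x => ⟨if (x : ℕ) < p then 2 * x else if (x : ℕ) < 2 * p then
      2 * (x - p) + 1 else x, by split_ifs <;> omega⟩)
    (Finite.injective_iff_bijective.1 (by
      intro x y hxy
      have := congrArg Fin.val hxy
      simp only at this
      ext
      split_ifs at this <;> omega))

theorem evenFirst_val (p : ℕ) (hp : p ≤ n) (x : Fin (2 * n)) : (evenFirst n p hp x : ℕ) =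
    if (x : ℕ) < p then 2 * (x : ℕ) else if (x : ℕ) < 2 * p then 2 * (x - p) + 1 else x := rfl

/-- A permutation of the last `l` of `m = p + l` places. -/
def permLast {p l m : ℕ} (h : p + l = m) (τ : Perm (Fin l)) : Perm (Fin m) :=
  τ.viaFintypeEmbedding ⟨fun j => Fin.cast h (Fin.natAdd p j), fun i j hij => by
    have := congrArg Fin.val hij; ext; simpa using this⟩

theorem permLast_natAdd {p l m : ℕ} (h : p + l = m) (τ : Perm (Fin l)) (j : Fin l) :
    permLast h τ (Fin.cast h (Fin.natAdd p j)) = Fin.cast h (Fin.natAdd p (τ j)) :=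
  Perm.viaFintypeEmbedding_apply_image _ ⟨fun j => Fin.cast h (Fin.natAdd p j), _⟩ j

theorem permLast_castAdd {p l m : ℕ} (h : p + l = m) (τ : Perm (Fin l)) (j : Fin p) :
    permLast h τ (Fin.cast h (Fin.castAdd l j)) = Fin.cast h (Fin.castAdd l j) := by
  refine Perm.viaFintypeEmbedding_apply_notMem_range _ _ ?_
  rintro ⟨x, hx⟩
  have : p + (x : ℕ) = j := congrArg Fin.val hx
  omega

theorem sign_permLast {p l m : ℕ} (h : p + l = m) (τ : Perm (Fin l)) :
    Perm.sign (permLast h τ) = Perm.sign τ := Perm.viaFintypeEmbedding_sign _ _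

theorem exists_permLast_eq {p l m : ℕ} (h : p + l = m) (ρ : Perm (Fin m))
    (hρ : ∀ j : Fin p, ρ (Fin.cast h (Fin.castAdd l j)) = Fin.cast h (Fin.castAdd l j)) :
    ∃ τ, permLast h τ = ρ := by
  have hge : ∀ j : Fin l, p ≤ (ρ (Fin.cast h (Fin.natAdd p j)) : ℕ) := by
    intro j
    by_contra! hlt
    have h1 := hρ ⟨_, hlt⟩
    have h2 : Fin.cast h (Fin.castAdd l ⟨_, hlt⟩) = ρ (Fin.cast h (Fin.natAdd p j)) := by
      ext; simp
    have h4 := congrArg Fin.val (h2.symm.trans (ρ.injective (h1.trans h2)))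
    simp only [Fin.val_cast, Fin.val_natAdd] at h4
    have h5 := congrArg Fin.val (ρ.injective (h1.trans h2))
    simp only [h2, Fin.val_cast, Fin.val_natAdd] at h5
    omega
  refine ⟨Equiv.ofBijective (fun j => ⟨ρ (Fin.cast h (Fin.natAdd p j)) - p, by
    have := hge j; omega⟩) (Finite.injective_iff_bijective.1 ?_), ?_⟩
  · intro i j hij
    have h1 := congrArg Fin.val hij
    have := hge i
    have := hge j
    simp only at h1
    have h2 : ρ (Fin.cast h (Fin.natAdd p i)) = ρ (Fin.cast h (Fin.natAdd p j)) := by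
      ext; omega
    have h3 := congrArg Fin.val (ρ.injective h2)
    ext; simpa using h3
  · ext x
    by_cases hx : (x : ℕ) < p
    · have hx' : x = Fin.cast h (Fin.castAdd l ⟨x, hx⟩) := by ext; simp
      rw [hx', permLast_castAdd, hρ]
    · obtain ⟨j, rfl⟩ : ∃ j : Fin l, Fin.cast h (Fin.natAdd p j) = x :=
        ⟨⟨x - p, by omega⟩, by ext; simp; omega⟩
      rw [permLast_natAdd]
      have := hge j
      simp
      omega

theorem permLast_injective {p l m : ℕ} (h : p + l = m) :
    Function.Injective (permLast h) := by
  intro σ τ hst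
  ext j
  have := congrArg Fin.val (congrArg (fun f => f (Fin.cast h (Fin.natAdd p j))) hst)
  simpa [permLast_natAdd] using this

/-- If the first `p` indices are isotropic, the Pfaffian sum of `A` only involves products that
pair each of them with one of the other indices. -/
theorem sum_pfaffianTerm_of_isotropic (A : Fin (2 * n) → Fin (2 * n) → R)
    (hA : ∀ i j, A i j = -A j i) {p l : ℕ} (hp : p ≤ n) (hl : p + l = 2 * n)
    (h0 : ∀ a b : Fin (2 * n), (a : ℕ) < p → (b : ℕ) < p → A a b = 0) :
    ∑ σ, pfaffianTerm A σ = (∏ q ∈ Finset.range p, (2 * (n - q))) •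
      Perm.sign (evenFirst n p hp) • ∑ τ : Perm (Fin l), Perm.sign τ •
        ((∏ a : Fin p, A ⟨a, by omega⟩ (Fin.cast hl (Fin.natAdd p (τ ⟨a, by omega⟩)))) *
        ∏ i : Fin (n - p), A (Fin.cast hl (Fin.natAdd p (τ ⟨p + 2 * i, by omega⟩)))
          (Fin.cast hl (Fin.natAdd p (τ ⟨p + 2 * i + 1, by omega⟩)))) := by
  classical
  rw [sum_pfaffianTerm_eq A hA hp h0]
  congr 1
  rw [Finset.smul_sum]
  symm
  set π := evenFirst n p hp with hπ
  have hπ1 : ∀ a (ha : a < p), π.symm ⟨2 * a, by omega⟩ = ⟨a, by omega⟩ := by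
    intro a ha
    rw [Equiv.symm_apply_eq]; ext; rw [hπ, evenFirst_val]; simp [ha]
  have hπ2 : ∀ a (ha : a < p), π.symm ⟨2 * a + 1, by omega⟩ = ⟨p + a, by omega⟩ := by
    intro a ha
    rw [Equiv.symm_apply_eq]; ext; rw [hπ, evenFirst_val]
    rw [if_neg (by simp only; omega), if_pos (by simp only; omega)]
    simp
  have hπ3 : ∀ a (ha : a < 2 * n), 2 * p ≤ a → π.symm ⟨a, ha⟩ = ⟨a, ha⟩ := by
    intro a ha hpa
    rw [Equiv.symm_apply_eq]; ext; rw [hπ, evenFirst_val]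
    rw [if_neg (by simp only; omega), if_neg (by simp only; omega)]
  have hc : ∀ a (ha : a < p), (⟨a, by omega⟩ : Fin (2 * n)) = Fin.cast hl (Fin.castAdd l ⟨a, ha⟩) :=
    fun a ha => rfl
  have hd : ∀ a (ha : p + a < 2 * n), (⟨p + a, ha⟩ : Fin (2 * n)) =
      Fin.cast hl (Fin.natAdd p ⟨a, by omega⟩) :=
    fun a ha => rfl
  -- The inverse of `π` sends slot `2a` to `a` and slot `2a + 1` to `p + a`. So `permLast hl τ *
  -- π.symm` puts index `a` in slot `2a` and gives it as partner the `τ a`-th of the remaining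
  -- indices; every admissible permutation arises once.
  refine Finset.sum_bij (fun τ _ => permLast hl τ * π.symm) ?_ ?_ ?_ ?_
  · intro τ _
    simp only [Finset.mem_filter, Finset.mem_univ, true_and]
    intro a ha
    rw [Perm.mul_apply, hπ1 _ ha, hc _ ha, permLast_castAdd]
  · intro σ _ τ _ hst
    exact permLast_injective hl (mul_right_cancel hst)
  · intro σ hσ
    simp only [Finset.mem_filter, Finset.mem_univ, true_and] at hσ
    obtain ⟨τ, hτ⟩ := exists_permLast_eq hl (σ * π) (by
      intro j
      rw [Perm.mul_apply, ← hc _ j.2]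
      nth_rw 1 [← hπ1 j j.2]
      rw [Equiv.apply_symm_apply]
      exact hσ ⟨j, by omega⟩ j.2)
    refine ⟨τ, Finset.mem_univ _, ?_⟩
    rw [hτ]
    ext x
    simp
  · intro τ _
    unfold pfaffianTerm
    have hs : Perm.sign (permLast hl τ * π.symm) = Perm.sign π * Perm.sign τ := by
      rw [Perm.sign_mul, sign_permLast, Perm.sign_symm, mul_comm]
    rw [hs, mul_smul]
    congr 2
    obtain ⟨r, rfl⟩ : ∃ r, n = p + r := ⟨n - p, by omega⟩
    rw [Fin.prod_univ_add]
    congr 1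
    · refine Finset.prod_congr rfl fun a _ => ?_
      simp only [Perm.mul_apply, Fin.val_castAdd]
      rw [hπ1 _ a.2, hπ2 _ a.2, hc _ a.2, permLast_castAdd, hd, permLast_natAdd]
    · have hr : p + r - p = r := by omega
      rw [← (finCongr hr).prod_comp]
      refine Finset.prod_congr rfl fun i _ => ?_
      have hi := i.2
      simp only [Perm.mul_apply, Fin.val_natAdd, finCongr_apply, Fin.val_cast]
      rw [hπ3 _ _ (by omega), hπ3 _ _ (by omega)]
      have h1 : (⟨2 * (p + (i : ℕ)), by omega⟩ : Fin (2 * (p + r))) =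
        Fin.cast hl (Fin.natAdd p ⟨p + 2 * i, by omega⟩) := by ext; simp; omega
      have h2 : (⟨2 * (p + (i : ℕ)) + 1, by omega⟩ : Fin (2 * (p + r))) =
        Fin.cast hl (Fin.natAdd p ⟨p + 2 * i + 1, by omega⟩) := by ext; simp; omega
      rw [h1, h2, permLast_natAdd, permLast_natAdd]

end Permutations

/-! ### The Hodge star in an orthonormal frame -/

section HodgeStar

open Equiv

theorem append_eq_sumElim {V : Type*} {k l m : ℕ} (h : k + l = m) (w : Fin k → V) (v : Fin l → V) (a : Fin m) :
    Fin.append w v (Fin.cast h.symm a) =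
      Sum.elim w v (((finCongr h.symm).trans finSumFinEquiv.symm) a) := by
  subst h
  refine Fin.addCases (fun a => ?_) (fun a => ?_) a <;> simp

variable {V : Type*} [AddCommGroup V] [Module ℝ V] [TopologicalSpace V]

/-- The form `τ`, as a multilinear map in its first `k` slots. -/
def curryFirst {k l m : ℕ} (h : k + l = m) (τ : V [⋀^Fin m]→L[ℝ] ℝ) (v : Fin l → V) :
    MultilinearMap ℝ (fun _ : Fin k => V) ℝ :=
  ({ toFun := fun F => F v, map_add' := fun _ _ => rfl, map_smul' := fun _ _ => rfl } :
    MultilinearMap ℝ (fun _ : Fin l => V) ℝ →ₗ[ℝ] ℝ).compMultilinearMap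
    (((τ.toAlternatingMap.toMultilinearMap).domDomCongr
      ((finCongr h.symm).trans finSumFinEquiv.symm)).currySum)

theorem curryFirst_apply {k l m : ℕ} (h : k + l = m) (τ : V [⋀^Fin m]→L[ℝ] ℝ) (v : Fin l → V)
    (w : Fin k → V) : curryFirst h τ v w = insertFirst h τ w v := by
  change τ _ = τ _
  congr 1
  ext a
  rw [append_eq_sumElim h]
  rfl

/-- The family `u` is orthonormal for the bilinear form `g`. -/
def IsOrthonormalFrame {m : ℕ} (g : V →L[ℝ] V →L[ℝ] ℝ) (u : Fin m → V) : Prop :=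
  ∀ a b, g (u a) (u b) = if a = b then 1 else 0

theorem IsOrthonormalFrame.linearIndependent {m : ℕ} {g : V →L[ℝ] V →L[ℝ] ℝ} {u : Fin m → V}
    (hu : IsOrthonormalFrame g u) : LinearIndependent ℝ u := by
  rw [Fintype.linearIndependent_iff]
  intro c hc i
  have h := congrArg (fun x => g x (u i)) hc
  simpa [hu _ _] using h

/-- An orthonormal family of the right length is a basis. -/
def IsOrthonormalFrame.basis [FiniteDimensional ℝ V] {m : ℕ} {g : V →L[ℝ] V →L[ℝ] ℝ} {u : Fin m → V}
    (hu : IsOrthonormalFrame g u) (hm : Module.finrank ℝ V = m) : Module.Basis (Fin m) ℝ V :=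
  basisOfLinearIndependentOfCardEqFinrank' u hu.linearIndependent (by simp [hm])

theorem IsOrthonormalFrame.coe_basis [FiniteDimensional ℝ V] {m : ℕ} {g : V →L[ℝ] V →L[ℝ] ℝ} {u : Fin m → V}
    (hu : IsOrthonormalFrame g u) (hm : Module.finrank ℝ V = m) : ⇑(hu.basis hm) = u :=
  coe_basisOfLinearIndependentOfCardEqFinrank' ..

/-- The matrix of coordinates of an orthonormal frame gives the inverse of the Gram matrix. -/
theorem transpose_mul_gram {m : ℕ} {g : V →L[ℝ] V →L[ℝ] ℝ} {u : Fin m → V}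
    (hu : IsOrthonormalFrame g u) (e : Module.Basis (Fin m) ℝ V) :
    (Matrix.of fun a s => e.repr (u a) s).transpose * (Matrix.of fun a s => e.repr (u a) s) *
      (Matrix.of fun s t => g (e s) (e t)) = 1 := by
  set C : Matrix (Fin m) (Fin m) ℝ := Matrix.of fun a s => e.repr (u a) s
  set G : Matrix (Fin m) (Fin m) ℝ := Matrix.of fun s t => g (e s) (e t)
  -- This is orthonormality of `u` expanded in the basis `e`; for square matrices the factor `Cᵀ`
  -- may then be moved to the other side.
  have h1 : C * G * C.transpose = 1 := by
    ext a b
    rw [Matrix.one_apply, ← hu a b]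
    conv_rhs => rw [← e.sum_repr (u a), ← e.sum_repr (u b)]
    simp only [Matrix.mul_apply, Matrix.transpose_apply, C, G, Matrix.of_apply, map_sum, map_smul,
      _root_.sum_apply, _root_.smul_apply, smul_eq_mul]
    refine Finset.sum_congr rfl fun t _ => ?_
    rw [Finset.sum_mul, Finset.mul_sum]
    exact Finset.sum_congr rfl fun s _ => by ring
  rw [mul_assoc]
  exact mul_eq_one_comm.1 h1

theorem inv_gram {m : ℕ} {g : V →L[ℝ] V →L[ℝ] ℝ} {u : Fin m → V}
    (hu : IsOrthonormalFrame g u) (e : Module.Basis (Fin m) ℝ V) (s t : Fin m) :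
    (Matrix.of fun s t => g (e s) (e t))⁻¹ s t = ∑ a, e.repr (u a) s * e.repr (u a) t := by
  rw [Matrix.inv_eq_left_inv (transpose_mul_gram hu e)]
  simp [Matrix.mul_apply]

theorem gram_det_ne_zero {m : ℕ} {g : V →L[ℝ] V →L[ℝ] ℝ} {u : Fin m → V}
    (hu : IsOrthonormalFrame g u) (e : Module.Basis (Fin m) ℝ V) :
    (Matrix.of fun s t => g (e s) (e t)).det ≠ 0 :=
  Matrix.det_ne_zero_of_left_inverse (transpose_mul_gram hu e)

/-- The inverse Gram matrix is `Cᵀ C`, with `C` the coordinates of the frame. Contracting with it in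
the basis `e` is therefore, by multilinearity, a plain sum over the frame. -/
theorem sum_inv_gram_smul {m k : ℕ} {g : V →L[ℝ] V →L[ℝ] ℝ} {u : Fin m → V}
    (hu : IsOrthonormalFrame g u) (e : Module.Basis (Fin m) ℝ V)
    {F : Type*} [AddCommGroup F] [Module ℝ F]
    (f : MultilinearMap ℝ (fun _ : Fin k => V) F) (h : MultilinearMap ℝ (fun _ : Fin k => V) ℝ) :
    ∑ i : Fin k → Fin m, ∑ j : Fin k → Fin m,
      (∏ a, (Matrix.of fun s t => g (e s) (e t))⁻¹ (i a) (j a)) • h (e ∘ j) • f (e ∘ i) =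
    ∑ I : Fin k → Fin m, h (u ∘ I) • f (u ∘ I) := by
  have hexp : ∀ I : Fin k → Fin m, u ∘ I = fun a => ∑ s, e.repr (u (I a)) s • e s :=
    fun I => funext fun a => (e.sum_repr _).symm
  have hf : ∀ I : Fin k → Fin m, f (u ∘ I) =
      ∑ i : Fin k → Fin m, (∏ a, e.repr (u (I a)) (i a)) • f (e ∘ i) := by
    intro I
    rw [hexp, f.map_sum]
    exact Finset.sum_congr rfl fun i _ => f.map_smul_univ _ _
  have hh : ∀ I : Fin k → Fin m, h (u ∘ I) =
      ∑ i : Fin k → Fin m, (∏ a, e.repr (u (I a)) (i a)) • h (e ∘ i) := by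
    intro I
    rw [hexp, h.map_sum]
    exact Finset.sum_congr rfl fun i _ => h.map_smul_univ _ _
  have hG : ∀ i j : Fin k → Fin m, (∏ a, (Matrix.of fun s t => g (e s) (e t))⁻¹ (i a) (j a)) =
      ∑ I : Fin k → Fin m, (∏ a, e.repr (u (I a)) (i a)) * ∏ a, e.repr (u (I a)) (j a) := by
    intro i j
    simp only [inv_gram hu, Fintype.prod_sum, Finset.prod_mul_distrib]
  simp only [hG, hf, hh, Finset.sum_smul, Finset.smul_sum]
  rw [Finset.sum_comm_cycle]
  refine Finset.sum_congr rfl fun I _ => ?_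
  refine Finset.sum_congr rfl fun i _ => Finset.sum_congr rfl fun j _ => ?_
  simp only [smul_smul, smul_eq_mul]
  congr 1
  ring

theorem hodgeStar_apply {k l m : ℕ} (h : k + l = m) {g : V →L[ℝ] V →L[ℝ] ℝ} {u : Fin m → V}
    (hu : IsOrthonormalFrame g u) (vol : V [⋀^Fin m]→L[ℝ] ℝ) (e : Module.Basis (Fin m) ℝ V)
    (β : V [⋀^Fin k]→L[ℝ] ℂ) (v : Fin l → V) :
    hodgeStar h g vol e β v =
      (1 / (k.factorial : ℝ)) • ∑ I : Fin k → Fin m, insertFirst h vol (u ∘ I) v • β (u ∘ I) := by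
  have := sum_inv_gram_smul hu e β.toAlternatingMap.toMultilinearMap (curryFirst h vol v)
  simp only [curryFirst_apply] at this
  unfold hodgeStar
  rw [ContinuousAlternatingMap.smul_apply]
  congr 1
  refine Eq.trans ?_ this
  simp only [ContinuousAlternatingMap.sum_apply]
  rfl

/-- Both sides equal the same sum over the orthonormal frame. This independence is what makes the
star commute with passing to a chart. -/
theorem hodgeStar_basis {k l m : ℕ} (h : k + l = m) {g : V →L[ℝ] V →L[ℝ] ℝ} {u : Fin m → V}
    (hu : IsOrthonormalFrame g u) (vol : V [⋀^Fin m]→L[ℝ] ℝ) (e e' : Module.Basis (Fin m) ℝ V)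
    (β : V [⋀^Fin k]→L[ℝ] ℂ) : hodgeStar h g vol e β = hodgeStar h g vol e' β := by
  ext v
  rw [hodgeStar_apply h hu, hodgeStar_apply h hu]

theorem hodgeStar_zero {k l m : ℕ} (h : k + l = m) (g : V →L[ℝ] V →L[ℝ] ℝ)
    (vol : V [⋀^Fin m]→L[ℝ] ℝ) (e : Fin m → V) :
    hodgeStar h g vol e (0 : V [⋀^Fin k]→L[ℝ] ℂ) = 0 := by
  ext v
  simp [hodgeStar, ContinuousAlternatingMap.sum_apply]

theorem map_comp_perm {F : Type*} [AddCommGroup F] [Module ℝ F] [TopologicalSpace F] {k : ℕ}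
    (β : V [⋀^Fin k]→L[ℝ] F) (w : Fin k → V) (ρ : Perm (Fin k)) :
    β (w ∘ ρ) = Perm.sign ρ • β w :=
  β.toAlternatingMap.map_perm w ρ

/-- A permutation of the first `k` of `m = k + l` places. -/
def permFirst {k l m : ℕ} (h : k + l = m) (ρ : Perm (Fin k)) : Perm (Fin m) :=
  ρ.viaFintypeEmbedding ⟨fun j => Fin.cast h (Fin.castAdd l j), fun i j hij => by
    have := congrArg Fin.val hij; ext; simpa using this⟩

theorem permFirst_castAdd {k l m : ℕ} (h : k + l = m) (ρ : Perm (Fin k)) (j : Fin k) :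
    permFirst h ρ (Fin.cast h (Fin.castAdd l j)) = Fin.cast h (Fin.castAdd l (ρ j)) :=
  Perm.viaFintypeEmbedding_apply_image _ ⟨fun j => Fin.cast h (Fin.castAdd l j), _⟩ j

theorem permFirst_natAdd {k l m : ℕ} (h : k + l = m) (ρ : Perm (Fin k)) (j : Fin l) :
    permFirst h ρ (Fin.cast h (Fin.natAdd k j)) = Fin.cast h (Fin.natAdd k j) := by
  refine Perm.viaFintypeEmbedding_apply_notMem_range _ _ ?_
  rintro ⟨x, hx⟩
  have : (x : ℕ) = k + j := congrArg Fin.val hx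
  omega

theorem sign_permFirst {k l m : ℕ} (h : k + l = m) (ρ : Perm (Fin k)) :
    Perm.sign (permFirst h ρ) = Perm.sign ρ := Perm.viaFintypeEmbedding_sign _ _

/-- The first `k` of `m = k + l` places. -/
abbrev fstIdx {k l m : ℕ} (h : k + l = m) (i : Fin k) : Fin m := Fin.cast h (Fin.castAdd l i)

/-- The last `l` of `m = k + l` places. -/
abbrev sndIdx {k l m : ℕ} (h : k + l = m) (j : Fin l) : Fin m := Fin.cast h (Fin.natAdd k j)

theorem insertFirst_apply {k l m : ℕ} (h : k + l = m) (τ : V [⋀^Fin m]→L[ℝ] ℝ) (w : Fin m → V) :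
    insertFirst h τ (w ∘ fstIdx h) (w ∘ sndIdx h) = τ w := by
  change τ _ = τ _
  subst h
  congr 1
  ext a
  refine Fin.addCases (fun a => ?_) (fun a => ?_) a <;> simp

/-- A repeated index in `J` kills `β`, and an index among the last `l` places repeats a vector in
`τ`. What survives are the `k!` rearrangements of the first `k` places, and they contribute equally
because the signs from `τ` and `β` cancel. -/
theorem sum_insertFirst_smul {k l m : ℕ} (h : k + l = m) (τ : V [⋀^Fin m]→L[ℝ] ℝ)
    (β : V [⋀^Fin k]→L[ℝ] ℂ) (w : Fin m → V) :
    ∑ J : Fin k → Fin m, insertFirst h τ (w ∘ J) (w ∘ sndIdx h) • β (w ∘ J) =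
      (k.factorial : ℝ) • τ w • β (w ∘ fstIdx h) := by
  have key := Fintype.sum_of_injective (fun ρ : Perm (Fin k) => fstIdx h ∘ ρ)
    (fun ρ ρ' hρ => by
      ext i
      have := congrArg Fin.val (congrFun hρ i)
      simpa using this)
    (fun _ => τ w • β (w ∘ fstIdx h))
    (fun J => insertFirst h τ (w ∘ J) (w ∘ sndIdx h) • β (w ∘ J)) ?_ ?_
  · rw [← key, Finset.sum_const, Finset.card_univ, Fintype.card_perm, Fintype.card_fin,
      Nat.cast_smul_eq_nsmul]
  · intro J hJ
    by_cases hinj : Function.Injective J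
    · have hx : ∃ i j, J i = sndIdx h j := by
        by_contra! hne
        apply hJ
        have hlt : ∀ i, (J i : ℕ) < k := by
          intro i
          by_contra! hge
          exact hne i ⟨J i - k, by omega⟩ (by ext; simp; omega)
        refine ⟨Equiv.ofBijective (fun i => ⟨J i, hlt i⟩) (Finite.injective_iff_bijective.1 ?_), ?_⟩
        · intro i j hij
          exact hinj (Fin.ext (by simpa using hij))
        · ext i; simp
      obtain ⟨i, j, hij⟩ := hx
      suffices hz : insertFirst h τ (w ∘ J) (w ∘ sndIdx h) = 0 by rw [hz, zero_smul]
      refine τ.map_eq_zero_of_eq _ (i := fstIdx h i) (j := sndIdx h j) ?_ ?_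
      · simp [fstIdx, sndIdx, hij]
      · intro h'; have := congrArg Fin.val h'; simp at this; omega
    · rw [Function.Injective] at hinj
      push Not at hinj
      obtain ⟨i, j, hij, hne⟩ := hinj
      rw [β.map_eq_zero_of_eq (w ∘ J) (i := i) (j := j) (by simp [hij]) hne, smul_zero]
  · intro ρ
    have h1 : w ∘ fstIdx h ∘ ρ = (w ∘ permFirst h ρ) ∘ fstIdx h := by
      ext i; simp [fstIdx, permFirst_castAdd]
    have h2 : w ∘ sndIdx h = (w ∘ permFirst h ρ) ∘ sndIdx h := by
      ext i; simp [sndIdx, permFirst_natAdd]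
    have h3 : insertFirst h τ (w ∘ fstIdx h ∘ ρ) (w ∘ sndIdx h) = Perm.sign ρ • τ w := by
      rw [h1, h2, insertFirst_apply, map_comp_perm, sign_permFirst]
    rw [h3, ← Function.comp_assoc, map_comp_perm]
    rcases Int.units_eq_one_or (Perm.sign ρ) with hs | hs <;> simp [hs]

theorem hodgeStar_apply_perm {k l m : ℕ} (h : k + l = m) {g : V →L[ℝ] V →L[ℝ] ℝ} {u : Fin m → V}
    (hu : IsOrthonormalFrame g u) (vol : V [⋀^Fin m]→L[ℝ] ℝ) (e : Module.Basis (Fin m) ℝ V)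
    (β : V [⋀^Fin k]→L[ℝ] ℂ) (σ : Perm (Fin m)) :
    hodgeStar h g vol e β (u ∘ σ ∘ sndIdx h) =
      Perm.sign σ • vol u • β (u ∘ σ ∘ fstIdx h) := by
  rw [hodgeStar_apply h hu]
  have hr : ∑ I : Fin k → Fin m, insertFirst h vol (u ∘ I) (u ∘ σ ∘ sndIdx h) • β (u ∘ I) =
      ∑ J : Fin k → Fin m, insertFirst h vol ((u ∘ σ) ∘ J) ((u ∘ σ) ∘ sndIdx h) •
        β ((u ∘ σ) ∘ J) :=
    (Fintype.sum_equiv (Equiv.arrowCongr (Equiv.refl _) σ) _ _ fun J => rfl).symm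
  rw [hr, sum_insertFirst_smul, smul_smul, one_div, inv_mul_cancel₀ (by positivity), one_smul,
    map_comp_perm]
  simp [Function.comp_assoc]

/-- The top-degree pairing `∑ σ, sign σ ⟪a(v_{σ 1}, …), b(…, v_{σ m})⟫`, a multiple of the real
part of `a ∧ conj b`. -/
def pairing {k l m : ℕ} (h : k + l = m) (a : V [⋀^Fin k]→L[ℝ] ℂ) (b : V [⋀^Fin l]→L[ℝ] ℂ) :
    V [⋀^Fin m]→ₗ[ℝ] ℝ :=
  MultilinearMap.alternatization (((TensorProduct.lift (innerₗ ℂ)).compMultilinearMap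
    (a.toAlternatingMap.toMultilinearMap.domCoprod
      b.toAlternatingMap.toMultilinearMap)).domDomCongr
        (finSumFinEquiv.trans (finCongr h)))

theorem pairing_apply {k l m : ℕ} (h : k + l = m) (a : V [⋀^Fin k]→L[ℝ] ℂ)
    (b : V [⋀^Fin l]→L[ℝ] ℂ) (v : Fin m → V) : pairing h a b v =
      ∑ σ : Perm (Fin m), Perm.sign σ •
        inner ℝ (a (v ∘ σ ∘ fstIdx h)) (b (v ∘ σ ∘ sndIdx h)) := by
  rw [pairing, MultilinearMap.alternatization_apply]
  rfl

/-- Forms of top degree are proportional to one another. -/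
theorem pairing_mul_comm [FiniteDimensional ℝ V] {k l m : ℕ} (h : k + l = m) (a : V [⋀^Fin k]→L[ℝ] ℂ)
    (b : V [⋀^Fin l]→L[ℝ] ℂ) {g : V →L[ℝ] V →L[ℝ] ℝ} {u : Fin m → V}
    (hu : IsOrthonormalFrame g u) (hm : Module.finrank ℝ V = m) (vol : V [⋀^Fin m]→L[ℝ] ℝ)
    (v : Fin m → V) : pairing h a b v * vol u = pairing h a b u * vol v := by
  have h1 := AlternatingMap.eq_smul_basis_det (hu.basis hm) (pairing h a b)
  have h2 := AlternatingMap.eq_smul_basis_det (hu.basis hm) vol.toAlternatingMap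
  have h3 : vol v = vol.toAlternatingMap v := rfl
  rw [h3, h2, h1]
  simp only [AlternatingMap.smul_apply, hu.coe_basis, smul_eq_mul,
    ContinuousAlternatingMap.coe_toAlternatingMap]
  have h4 : (hu.basis hm).det u = 1 := by
    have := Module.Basis.det_self (hu.basis hm)
    rwa [hu.coe_basis hm] at this
  rw [h4]; ring

/-- The sign in the pairing meets the same sign from the star, so what remains is an unnormalized
pointwise inner product of `a` and `b`, the source of all positivity below. -/
theorem pairing_hodgeStar {k l m : ℕ} (h : k + l = m) (a b : V [⋀^Fin k]→L[ℝ] ℂ)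
    {g : V →L[ℝ] V →L[ℝ] ℝ} {u : Fin m → V} (hu : IsOrthonormalFrame g u)
    (vol : V [⋀^Fin m]→L[ℝ] ℝ) (e : Module.Basis (Fin m) ℝ V) :
    pairing h a (hodgeStar h g vol e b) u =
      vol u * ∑ σ : Perm (Fin m), inner ℝ (a (u ∘ σ ∘ fstIdx h)) (b (u ∘ σ ∘ fstIdx h)) := by
  rw [pairing_apply, Finset.mul_sum]
  refine Finset.sum_congr rfl fun σ _ => ?_
  rw [hodgeStar_apply_perm h hu]
  rcases Int.units_eq_one_or (Perm.sign σ) with hs | hs <;>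
    simp [hs] <;> ring

/-- Moves the first `k` places behind the last `l`. -/
def rotateIdx {k l m : ℕ} (h : k + l = m) (h' : l + k = m) : Perm (Fin m) :=
  (finCongr h.symm).trans (finSumFinEquiv.symm.trans
    ((Equiv.sumComm _ _).trans (finSumFinEquiv.trans (finCongr h'))))

theorem rotateIdx_fst {k l m : ℕ} (h : k + l = m) (h' : l + k = m) (i : Fin k) :
    rotateIdx h h' (fstIdx h i) = sndIdx h' i := by
  simp [rotateIdx, fstIdx, sndIdx]

theorem rotateIdx_snd {k l m : ℕ} (h : k + l = m) (h' : l + k = m) (i : Fin l) :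
    rotateIdx h h' (sndIdx h i) = fstIdx h' i := by
  simp [rotateIdx, fstIdx, sndIdx]

/-- This is `⋆⋆ = ±1` in weak form. The sign is that of exchanging the two blocks of places; the
factor `vol u ^ 2` stays because `vol` is not assumed to be `±1` on the frame. -/
theorem pairing_hodgeStar_hodgeStar {k l m : ℕ} (h : k + l = m) (h' : l + k = m)
    (a : V [⋀^Fin k]→L[ℝ] ℂ) (z : V [⋀^Fin l]→L[ℝ] ℂ)
    {g : V →L[ℝ] V →L[ℝ] ℝ} {u : Fin m → V} (hu : IsOrthonormalFrame g u)
    (vol : V [⋀^Fin m]→L[ℝ] ℝ) (e e' : Module.Basis (Fin m) ℝ V) :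
    pairing h a (hodgeStar h g vol e (hodgeStar h' g vol e' z)) u =
      vol u ^ 2 * (Perm.sign (rotateIdx h h') : ℤ) * pairing h a z u := by
  rw [pairing_hodgeStar h _ _ hu, pairing_apply, Finset.mul_sum, Finset.mul_sum]
  refine Finset.sum_congr rfl fun σ _ => ?_
  have h1 : u ∘ σ ∘ fstIdx h = u ∘ (σ * (rotateIdx h h')⁻¹) ∘ sndIdx h' := by
    ext i
    simp [← rotateIdx_fst h h']
  have h2 : u ∘ σ ∘ sndIdx h = u ∘ (σ * (rotateIdx h h')⁻¹) ∘ fstIdx h' := by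
    ext i
    simp [← rotateIdx_snd h h']
  rw [h2]
  conv_lhs => rw [h1, hodgeStar_apply_perm h' hu, ← h1]
  rw [Perm.sign_mul, Perm.sign_inv]
  rcases Int.units_eq_one_or (Perm.sign σ) with hs | hs <;>
  rcases Int.units_eq_one_or (Perm.sign (rotateIdx h h')) with hr | hr <;>
    simp [hs, hr] <;> ring

theorem sign_rotateIdx {k l m : ℕ} (h : k + l = m) (h' : l + k = m) :
    Perm.sign (rotateIdx h h') = (-1) ^ (k * l) := by
  obtain _ | m := m
  · obtain rfl : k = 0 := by omega
    obtain rfl : l = 0 := by omega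
    rw [Subsingleton.elim (rotateIdx h h') 1]; rfl
  have hpow : ∀ (j : ℕ) (x : Fin (m + 1)), (((finRotate (m + 1)) ^ j) x : ℕ) =
      (x + j) % (m + 1) := by
    intro j x
    induction j with
    | zero => simp [Nat.mod_eq_of_lt x.2]
    | succ j ih =>
      rw [pow_succ', Perm.mul_apply, finRotate_apply, Fin.val_add, ih, Fin.val_one',
        ← Nat.add_mod, add_assoc]
  -- The block exchange is the `l`-th power of the full cycle, of sign `(-1)^(m l)`, where the
  -- number of places is now `m + 1 = k + l`. Then `m l = k l + l (l - 1)` and the last term is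
  -- even.
  have hrot : rotateIdx h h' = (finRotate (m + 1)) ^ l := by
    ext x
    rw [hpow]
    by_cases hx : (x : ℕ) < k
    · have hx' : x = fstIdx h ⟨x, hx⟩ := by ext; simp [fstIdx]
      rw [Nat.mod_eq_of_lt (by omega), hx', rotateIdx_fst]
      simp [sndIdx, fstIdx, add_comm]
    · have hx' : x = sndIdx h ⟨x - k, by omega⟩ := by ext; simp [sndIdx]; omega
      rw [hx', rotateIdx_snd, ← hx', Nat.mod_eq_sub_mod (by omega), Nat.mod_eq_of_lt (by omega)]
      simp [fstIdx]; omega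
  rw [hrot, map_pow, sign_finRotate, ← pow_mul]
  have h2 : Even (l * (l - 1)) := Nat.even_mul_pred_self l
  have h3 : m * l + 0 = k * l + l * (l - 1) ∨ l = 0 := by
    rcases Nat.eq_zero_or_pos l with h0 | h0
    · exact Or.inr h0
    · left
      obtain ⟨l, rfl⟩ : ∃ l', l = l' + 1 := ⟨l - 1, by omega⟩
      obtain rfl : m = k + l := by omega
      simp; ring
  rcases h3 with h3 | h3
  · rw [add_zero] at h3
    rw [Nat.add_sub_cancel, h3, pow_add, h2.neg_one_pow, mul_one]
  · simp [h3]

end HodgeStar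

/-! ### Unitary frames and the volume form -/

section UnitaryFrames

open Equiv

/-- The matrix of the standard symplectic form. -/
def stdSymplectic (R : Type*) [CommRing R] (n : ℕ) (s t : Fin (2 * n)) : R :=
  if (s : ℕ) % 2 = 0 ∧ (t : ℕ) = s + 1 then 1 else if (t : ℕ) % 2 = 0 ∧ (s : ℕ) = t + 1 then -1 else 0

theorem stdSymplectic_neg (R : Type*) [CommRing R] (n : ℕ) (s t : Fin (2 * n)) :
    stdSymplectic R n s t = -stdSymplectic R n t s := by
  unfold stdSymplectic
  split_ifs <;> first | omega | simp

/-- The Pfaffian sum of the standard symplectic matrix. -/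
def stdPfaffian (R : Type*) [CommRing R] (n : ℕ) : R := ∑ σ, pfaffianTerm (stdSymplectic R n) σ

theorem sum_pfaffianTerm_perm {R : Type*} [CommRing R] {n : ℕ} (A : Fin (2 * n) → Fin (2 * n) → R)
    (π : Perm (Fin (2 * n))) : ∑ σ, pfaffianTerm (fun s t => A (π s) (π t)) σ =
      Perm.sign π • ∑ σ, pfaffianTerm A σ := by
  rw [Finset.smul_sum]
  refine Fintype.sum_equiv (Equiv.mulLeft π) _ _ fun σ => ?_
  simp only [pfaffianTerm, Equiv.coe_mulLeft, Perm.sign_mul, Perm.mul_apply, smul_smul]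
  rw [← mul_assoc, Int.units_mul_self, one_mul]

/-- List the even indices first. They span an isotropic block, so the isotropic expansion with `p =
l = n` applies, and only the identity permutation matches each even index with its odd partner. -/
theorem stdPfaffian_ne_zero (n : ℕ) : stdPfaffian ℝ n ≠ 0 := by
  classical
  have h1 := sum_pfaffianTerm_perm (stdSymplectic ℝ n) (evenFirst n n le_rfl)
  have hev : ∀ a : Fin (2 * n), (a : ℕ) < n → (evenFirst n n le_rfl a : ℕ) = 2 * a := by
    intro a ha; rw [evenFirst_val, if_pos ha]
  have hod : ∀ a : Fin (2 * n), n ≤ (a : ℕ) → (evenFirst n n le_rfl a : ℕ) = 2 * (a - n) + 1 := by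
    intro a ha; rw [evenFirst_val, if_neg (by omega), if_pos (by omega)]
  rw [sum_pfaffianTerm_of_isotropic _ (fun s t => stdSymplectic_neg ℝ n _ _) le_rfl
    (l := n) (by omega)] at h1
  · have h2 : ∑ τ : Perm (Fin n), Perm.sign τ •
        ((∏ a : Fin n, stdSymplectic ℝ n (evenFirst n n le_rfl ⟨a, by omega⟩) (evenFirst n n le_rfl
          (Fin.cast (by omega) (Fin.natAdd n (τ ⟨a, by omega⟩))))) *
        ∏ i : Fin (n - n), stdSymplectic ℝ n
          (evenFirst n n le_rfl (Fin.cast (by omega) (Fin.natAdd n (τ ⟨n + 2 * i, by omega⟩))))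
          (evenFirst n n le_rfl
            (Fin.cast (by omega) (Fin.natAdd n (τ ⟨n + 2 * i + 1, by omega⟩))))) = (1 : ℝ) := by
      have hemp : IsEmpty (Fin (n - n)) := by rw [Nat.sub_self]; infer_instance
      rw [Finset.sum_eq_single (1 : Perm (Fin n))]
      · simp only [Perm.sign_one, one_smul, Finset.univ_eq_empty, Finset.prod_empty, mul_one,
          Perm.coe_one, id]
        refine Finset.prod_eq_one fun a _ => ?_
        rw [stdSymplectic, if_pos]
        rw [hev _ a.2, hod _ (by simp)]
        simp
      · intro τ _ hτ
        obtain ⟨a, ha⟩ : ∃ a, τ a ≠ a := by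
          by_contra! h; exact hτ (Equiv.ext h)
        rw [Finset.prod_eq_zero (Finset.mem_univ a), zero_mul, smul_zero]
        have hne : (τ a : ℕ) ≠ a := fun h => ha (Fin.ext h)
        have hl := hev ⟨a, by omega⟩ a.2
        have hr := hod (Fin.cast (by omega) (Fin.natAdd n (τ ⟨a, by omega⟩))) (by simp)
        simp only [Fin.eta, Fin.val_cast, Fin.val_natAdd, Nat.add_sub_cancel_left] at hl hr
        rw [stdSymplectic, if_neg, if_neg] <;> simp only [Fin.eta, hl, hr] <;> omega
      · simp
    rw [h2] at h1
    intro h0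
    rw [stdPfaffian] at h0
    rw [h0, smul_zero, nsmul_eq_mul] at h1
    have h3 : ((∏ q ∈ Finset.range n, (2 * (n - q)) : ℕ) : ℝ) ≠ 0 := by
      rw [Nat.cast_ne_zero, Finset.prod_ne_zero_iff]
      intro q hq
      have := Finset.mem_range.1 hq
      omega
    rcases mul_eq_zero.1 h1 with h | h
    · exact h3 h
    · rcases Int.units_eq_one_or (Perm.sign (evenFirst n n le_rfl)) with hs | hs <;>
        simp [hs] at h
  · intro a b ha hb
    rw [stdSymplectic, if_neg, if_neg] <;> rw [hev a ha, hev b hb] <;> omega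

variable {V : Type*} [AddCommGroup V] [Module ℝ V] [TopologicalSpace V]

/-- The family `u` is orthonormal for `g`, and `J u_{2a} = u_{2a+1}`. -/
structure IsUnitaryFrame {n : ℕ} (g : V →L[ℝ] V →L[ℝ] ℝ) (J : V →L[ℝ] V) (u : Fin (2 * n) → V) :
    Prop where
  orthonormal : IsOrthonormalFrame g u
  map_even : ∀ a : Fin n, J (u ⟨2 * a, by omega⟩) = u ⟨2 * a + 1, by omega⟩

/-- `g` is an inner product for which the complex structure `J` is an isometry. -/
structure IsHermitian (g : V →L[ℝ] V →L[ℝ] ℝ) (J : V →L[ℝ] V) : Prop where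
  symm : ∀ v w, g v w = g w v
  pos : ∀ v, v ≠ 0 → 0 < g v v
  isometry : ∀ v w, g (J v) (J w) = g v w
  sq_eq_neg : ∀ v, J (J v) = -v

theorem IsHermitian.skew {g : V →L[ℝ] V →L[ℝ] ℝ} {J : V →L[ℝ] V} (h : IsHermitian g J) (v w : V) :
    g (J v) w = -g v (J w) := by
  rw [← h.isometry v, h.sq_eq_neg, map_neg, neg_neg]

theorem IsHermitian.self_map {g : V →L[ℝ] V →L[ℝ] ℝ} {J : V →L[ℝ] V} (h : IsHermitian g J) (v : V) :
    g v (J v) = 0 := by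
  have h1 := h.skew v v
  rw [h.symm] at h1
  linarith

theorem IsUnitaryFrame.fundamental {n : ℕ} {g : V →L[ℝ] V →L[ℝ] ℝ} {J : V →L[ℝ] V}
    {u : Fin (2 * n) → V} (hu : IsUnitaryFrame g J u) (h : IsHermitian g J) (s t : Fin (2 * n)) :
    g (J (u s)) (u t) = stdSymplectic ℝ n s t := by
  unfold stdSymplectic
  rcases Nat.even_or_odd' (s : ℕ) with ⟨c, hc | hc⟩
  · have hs : s = ⟨2 * (⟨c, by omega⟩ : Fin n), by simp only; omega⟩ := by ext; simp [hc]
    rw [hs, hu.map_even, hu.orthonormal]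
    simp only [Fin.ext_iff]
    split_ifs <;> first | omega | simp
  · have hs : s = ⟨2 * (⟨c, by omega⟩ : Fin n) + 1, by simp only; omega⟩ := by ext; simp [hc]
    rw [hs, ← hu.map_even, h.sq_eq_neg, map_neg, _root_.neg_apply, hu.orthonormal]
    simp only [Fin.ext_iff]
    split_ifs <;> first | omega | simp

theorem exists_unitary_partial [FiniteDimensional ℝ V] {n : ℕ} {g : V →L[ℝ] V →L[ℝ] ℝ}
    {J : V →L[ℝ] V} (h : IsHermitian g J) (hn : Module.finrank ℝ V = 2 * n) (k : ℕ) (hk : k ≤ n) :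
    ∃ x : Fin k → V, (∀ i j, g (x i) (x j) = if i = j then 1 else 0) ∧
      ∀ i j, g (x i) (J (x j)) = 0 := by
  induction k with
  | zero => exact ⟨fun i => i.elim0, fun i => i.elim0, fun i => i.elim0⟩
  | succ k ih =>
    obtain ⟨x, hx1, hx2⟩ := ih (by omega)
    -- Orthogonality to all `x i` and `J (x i)` is `2k < 2n` linear conditions, so it has a nonzero
    -- solution `v`, which is normalized and adjoined.
    let f : V →ₗ[ℝ] (Fin k ⊕ Fin k → ℝ) :=
      LinearMap.pi (Sum.elim (fun i => (g (x i)).toLinearMap) fun i => (g (J (x i))).toLinearMap)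
    have hf : f.ker ≠ ⊥ := by
      refine LinearMap.ker_ne_bot_of_finrank_lt ?_
      simp [hn]; omega
    obtain ⟨v, hv, hv0⟩ := Submodule.exists_mem_ne_zero_of_ne_bot hf
    have h1 : ∀ i, g (x i) v = 0 := fun i => congrFun (LinearMap.mem_ker.1 hv) (Sum.inl i)
    have h2 : ∀ i, g (J (x i)) v = 0 := fun i => congrFun (LinearMap.mem_ker.1 hv) (Sum.inr i)
    have hpos := h.pos v hv0
    set r := (Real.sqrt (g v v))⁻¹
    have hr : r * (r * g v v) = 1 := by
      rw [← mul_assoc, ← mul_inv, Real.mul_self_sqrt hpos.le, inv_mul_cancel₀ hpos.ne']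
    refine ⟨Fin.snoc x (r • v), fun i j => ?_, fun i j => ?_⟩
    · refine Fin.lastCases ?_ (fun i => ?_) i <;> refine Fin.lastCases ?_ (fun j => ?_) j
      · simp [hr]
      · simp [h.symm v, h1, Fin.ext_iff]; omega
      · simp [h1, Fin.ext_iff]; omega
      · simp [hx1]
    · refine Fin.lastCases ?_ (fun i => ?_) i <;> refine Fin.lastCases ?_ (fun j => ?_) j
      · simp [h.self_map]
      · simp [h.symm v, h2]
      · have : g (x i) (J v) = 0 := by
          have := h.skew (x i) v
          rw [h2] at this; linarith
        simp [this]
      · simp [hx2]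

theorem exists_isUnitaryFrame [FiniteDimensional ℝ V] {n : ℕ} {g : V →L[ℝ] V →L[ℝ] ℝ}
    {J : V →L[ℝ] V} (h : IsHermitian g J) (hn : Module.finrank ℝ V = 2 * n) :
    ∃ u : Fin (2 * n) → V, IsUnitaryFrame g J u := by
  obtain ⟨x, hx1, hx2⟩ := exists_unitary_partial h hn n le_rfl
  refine ⟨fun s => if (s : ℕ) % 2 = 0 then x ⟨s / 2, by omega⟩ else J (x ⟨s / 2, by omega⟩), ?_, ?_⟩
  · intro a b
    simp only [Fin.ext_iff]
    have hx3 : ∀ i j, g (J (x i)) (x j) = 0 := fun i j => by rw [h.symm, hx2]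
    split_ifs <;> simp [h.isometry, hx1, hx2, hx3] <;> omega
  · intro a
    have h1 : (2 * (a : ℕ) + 1) / 2 = a := by omega
    simp [h1]

theorem wedgePowDivFactorial_apply {n : ℕ} (b : V [⋀^Fin 2]→L[ℝ] ℝ) (v : Fin (2 * n) → V) :
    wedgePowDivFactorial n b v =
      (1 / ((2 : ℝ) ^ n * (n.factorial : ℝ))) * ∑ σ, pfaffianTerm (fun s t => b ![v s, v t]) σ := by
  rw [wedgePowDivFactorial, ContinuousAlternatingMap.smul_apply,
    ContinuousMultilinearMap.alternatization_apply_apply]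
  rfl

/-- The value of `ωⁿ / n!` on unitary frames. -/
def unitVolume (n : ℕ) : ℝ := (1 / ((2 : ℝ) ^ n * (n.factorial : ℝ))) * stdPfaffian ℝ n

theorem unitVolume_ne_zero (n : ℕ) : unitVolume n ≠ 0 :=
  mul_ne_zero (by positivity) (stdPfaffian_ne_zero n)

theorem wedgePowDivFactorial_unitary {n : ℕ} {g : V →L[ℝ] V →L[ℝ] ℝ} {J : V →L[ℝ] V}
    {u : Fin (2 * n) → V} (hu : IsUnitaryFrame g J u) (h : IsHermitian g J)
    (b : V [⋀^Fin 2]→L[ℝ] ℝ) (hb : ∀ v w, b ![v, w] = g (J v) w) :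
    wedgePowDivFactorial n b u = unitVolume n := by
  rw [wedgePowDivFactorial_apply, unitVolume]
  simp only [hb, hu.fundamental h]
  rfl

/-- Congruence multiplies Pfaffian sums by the determinant. -/
theorem sum_pfaffianTerm_congruence {R : Type*} [CommRing R] {n : ℕ}
    (B K : Matrix (Fin (2 * n)) (Fin (2 * n)) R) :
    ∑ σ, pfaffianTerm (fun x y => ∑ s, ∑ t, B x s * K s t * B y t) σ =
      B.det * ∑ σ, pfaffianTerm K σ := by
  classical
  let ei : Fin n → Fin (2 * n) := fun i => ⟨2 * i, by omega⟩
  let oi : Fin n → Fin (2 * n) := fun i => ⟨2 * i + 1, by omega⟩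
  have hsplit : ∀ f : Fin (2 * n) → R, ∏ x, f x = ∏ i, f (ei i) * f (oi i) := by
    intro f
    rw [← (finProdFinEquiv.trans (finCongr (mul_comm n 2))).prod_comp, Fintype.prod_prod_type]
    refine Finset.prod_congr rfl fun i _ => ?_
    rw [Fin.prod_univ_two]
    congr 2 <;> ext <;> simp [ei, oi, add_comm]
  -- Expanding the product chooses a column `q x` for every one of the `2n` slots, not just for
  -- every pair; the signed sum over `σ` can then be recognized as a determinant of chosen columns.
  have hexp : ∀ σ : Perm (Fin (2 * n)), ∏ i : Fin n, ∑ s, ∑ t,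
      B (σ (ei i)) s * K s t * B (σ (oi i)) t =
      ∑ q : Fin (2 * n) → Fin (2 * n), (∏ x, B (σ x) (q x)) * ∏ i, K (q (ei i)) (q (oi i)) := by
    intro σ
    simp only [← Fintype.sum_prod_type', Fintype.prod_sum]
    symm
    refine Fintype.sum_bijective (fun (q : Fin (2 * n) → Fin (2 * n)) i => (q (ei i), q (oi i)))
      ⟨fun q q' hq => ?_, fun f => ?_⟩ _ _ fun q => ?_
    · ext x
      have h1 := Prod.mk.inj (congrFun hq ⟨x / 2, by omega⟩)
      rcases Nat.even_or_odd' (x : ℕ) with ⟨c, hc | hc⟩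
      · have : ei ⟨x / 2, by omega⟩ = x := by ext; simp only [ei]; omega
        rw [← this, h1.1]
      · have : oi ⟨x / 2, by omega⟩ = x := by ext; simp only [oi]; omega
        rw [← this, h1.2]
    · refine ⟨fun x => if (x : ℕ) % 2 = 0 then (f ⟨x / 2, by omega⟩).1
        else (f ⟨x / 2, by omega⟩).2, ?_⟩
      ext i : 1
      have h1 : (2 * (i : ℕ) + 1) / 2 = i := by omega
      simp [ei, oi, h1]
    · rw [hsplit, ← Finset.prod_mul_distrib]
      exact Finset.prod_congr rfl fun i _ => by ring
  have hdet : ∀ q : Fin (2 * n) → Fin (2 * n), ∑ σ : Perm (Fin (2 * n)), Perm.sign σ •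
      ∏ x, B (σ x) (q x) = (B.submatrix id q).det := fun q => by
    rw [Matrix.det_apply]; rfl
  simp only [pfaffianTerm]
  change ∑ σ : Perm (Fin (2 * n)), Perm.sign σ • ∏ i : Fin n, ∑ s, ∑ t,
      B (σ (ei i)) s * K s t * B (σ (oi i)) t = _
  simp only [hexp, Finset.smul_sum]
  rw [Finset.sum_comm]
  have h1 : ∀ q : Fin (2 * n) → Fin (2 * n), ∑ σ : Perm (Fin (2 * n)), Perm.sign σ •
      ((∏ x, B (σ x) (q x)) * ∏ i, K (q (ei i)) (q (oi i))) =
      (B.submatrix id q).det * ∏ i, K (q (ei i)) (q (oi i)) := by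
    intro q
    rw [← hdet, Finset.sum_mul]
    simp [smul_mul_assoc]
  simp only [h1]
  rw [Finset.mul_sum]
  symm
  -- Choices with a repeated column have zero determinant; a bijective choice gives `det B` times
  -- its sign, which is the sign in the Pfaffian term of `K`.
  refine Fintype.sum_of_injective (fun π : Perm (Fin (2 * n)) => ⇑π) DFunLike.coe_injective _ _
    ?_ ?_
  · intro q hq
    have hinj : ¬ Function.Injective q := fun hi =>
      hq ⟨Equiv.ofBijective q (Finite.injective_iff_bijective.1 hi), rfl⟩
    rw [Function.Injective] at hinj
    push Not at hinj
    obtain ⟨i, j, hij, hne⟩ := hinj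
    rw [Matrix.det_zero_of_column_eq hne (fun k => by simp [hij]), zero_mul]
  · intro π
    rw [Matrix.det_permute']
    rcases Int.units_eq_one_or (Perm.sign π) with hs | hs <;> simp [hs, ei, oi]

end UnitaryFrames

/-! ### The Hodge star of forms of type `(p, 0)` -/

section StarOfType

open Equiv

variable {V : Type*} [AddCommGroup V] [Module ℝ V] [TopologicalSpace V]

/-- The value at `v` of (a multiple of) the form `α ∧ b ^ (n - p)`. -/
def wedgePairs {n p l : ℕ} (hp : p ≤ n) (hl : p + l = 2 * n) (α : V [⋀^Fin p]→L[ℝ] ℂ)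
    (b : V [⋀^Fin 2]→L[ℝ] ℝ) (v : Fin l → V) : ℂ :=
  ∑ τ : Perm (Fin l), Perm.sign τ •
    (α (fun a => v (τ ⟨a, by omega⟩)) *
      ∏ i : Fin (n - p), (b ![v (τ ⟨p + 2 * i, by omega⟩), v (τ ⟨p + 2 * i + 1, by omega⟩)] : ℂ))

theorem IsOrthonormalFrame.sum_smul [FiniteDimensional ℝ V] {m : ℕ} {g : V →L[ℝ] V →L[ℝ] ℝ}
    {u : Fin m → V} (hu : IsOrthonormalFrame g u) (hm : Module.finrank ℝ V = m) (w : V) :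
    ∑ s, g w (u s) • u s = w := by
  conv_rhs => rw [← (hu.basis hm).sum_repr w]
  rw [hu.coe_basis hm]
  refine Finset.sum_congr rfl fun s _ => ?_
  congr 1
  conv_lhs => rw [← (hu.basis hm).sum_repr w]
  simp [hu.coe_basis hm, hu _ _]

theorem IsOrthonormalFrame.sum_mul_apply [FiniteDimensional ℝ V] {m : ℕ}
    {g : V →L[ℝ] V →L[ℝ] ℝ} {u : Fin m → V} (hu : IsOrthonormalFrame g u)
    (hm : Module.finrank ℝ V = m) (ψ : V →L[ℝ] ℂ) (w : V) :
    ∑ s, (g w (u s) : ℂ) * ψ (u s) = ψ w := by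
  conv_rhs => rw [← hu.sum_smul hm w]
  simp

theorem IsOrthonormalFrame.map_eq_sum [FiniteDimensional ℝ V] {m : ℕ}
    {g : V →L[ℝ] V →L[ℝ] ℝ} {u : Fin m → V} (hu : IsOrthonormalFrame g u)
    (hm : Module.finrank ℝ V = m) (vol : V [⋀^Fin m]→L[ℝ] ℝ) (w : Fin m → V) :
    vol w = vol u * ∑ σ : Perm (Fin m), Perm.sign σ • ∏ x, g (w x) (u (σ x)) := by
  have h2 := AlternatingMap.eq_smul_basis_det (hu.basis hm) vol.toAlternatingMap
  have h3 : vol w = vol.toAlternatingMap w := rfl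
  rw [h3, h2]
  simp only [AlternatingMap.smul_apply, hu.coe_basis, smul_eq_mul,
    ContinuousAlternatingMap.coe_toAlternatingMap]
  congr 1
  rw [Module.Basis.det_apply, Matrix.det_apply]
  refine Finset.sum_congr rfl fun σ _ => ?_
  congr 1
  refine Finset.prod_congr rfl fun x _ => ?_
  rw [Module.Basis.toMatrix_apply]
  conv_rhs => rw [← (hu.basis hm).sum_repr (w x)]
  simp [hu.coe_basis hm, hu _ _]

theorem prod_fst_snd {k l m : ℕ} (h : k + l = m) {R : Type*} [CommMonoid R] (f : Fin m → R) :
    ∏ x, f x = (∏ a, f (fstIdx h a)) * ∏ j, f (sndIdx h j) := by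
  subst h
  rw [Fin.prod_univ_add]
  rfl

/-- The constant with `⋆α = starConst n p • (α ∧ b ^ (n - p))` for forms of type `(p, 0)`, in the
normalization of `wedgePairs`. -/
def starConst (n p : ℕ) (hp : p ≤ n) : ℂ :=
  (1 / ((2 : ℝ) ^ n * (n.factorial : ℝ)) : ℝ) * ((∏ q ∈ Finset.range p, (2 * (n - q)) : ℕ) *
    (((Perm.sign (evenFirst n p hp) : ℤ) : ℂ) * ((-Complex.I) ^ p * (1 / (p.factorial : ℂ)))))

variable {n p l : ℕ} {g : V →L[ℝ] V →L[ℝ] ℝ} {J : V →L[ℝ] V} {u : Fin (2 * n) → V}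

/-- All `p!` Leibniz terms of the determinant contribute equally: permuting `I` changes the
alternating factor by the very sign that the term carries. -/
theorem sum_det_smul (h : p + l = 2 * n) (vol : V [⋀^Fin (2 * n)]→L[ℝ] ℝ) (θ : Fin p → V →L[ℝ] ℂ)
    (v : Fin l → V) (u : Fin (2 * n) → V) :
    ∑ I : Fin p → Fin (2 * n), insertFirst h vol (u ∘ I) v •
      Matrix.det (Matrix.of fun i j => θ i (u (I j))) =
    (p.factorial : ℂ) * ∑ I : Fin p → Fin (2 * n), (insertFirst h vol (u ∘ I) v : ℂ) *
      ∏ a, θ a (u (I a)) := by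
  simp only [Matrix.det_apply, Matrix.of_apply, Finset.smul_sum]
  rw [Finset.sum_comm]
  have key : ∀ σ : Perm (Fin p), ∑ I : Fin p → Fin (2 * n), insertFirst h vol (u ∘ I) v •
      Perm.sign σ • ∏ i, θ (σ i) (u (I i)) =
      ∑ I : Fin p → Fin (2 * n), (insertFirst h vol (u ∘ I) v : ℂ) * ∏ a, θ a (u (I a)) := by
    intro σ
    symm
    refine Fintype.sum_equiv (Equiv.arrowCongr σ.symm (Equiv.refl _)) _ _ fun I => ?_
    have h1 : (Equiv.arrowCongr σ.symm (Equiv.refl _)) I = I ∘ σ := rfl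
    have h2 : insertFirst h vol (u ∘ I ∘ σ) v = Perm.sign σ • insertFirst h vol (u ∘ I) v := by
      set W : Fin (2 * n) → V := fun x => Fin.append (u ∘ I) v (Fin.cast h.symm x) with hW
      have h4 : insertFirst h vol (u ∘ I ∘ σ) v = vol (W ∘ permFirst h σ) := by
        have h5 : (W ∘ permFirst h σ) ∘ fstIdx h = u ∘ I ∘ σ := by
          ext a; simp [hW, permFirst_castAdd, fstIdx]
        have h6 : (W ∘ permFirst h σ) ∘ sndIdx h = v := by
          ext a; simp [hW, permFirst_natAdd, sndIdx]
        rw [← insertFirst_apply h, h5, h6]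
      rw [h4, map_comp_perm, sign_permFirst]
      rfl
    rw [h1, h2]
    have h5 : ∏ i, θ (σ i) (u ((I ∘ σ) i)) = ∏ a, θ a (u (I a)) :=
      Equiv.prod_comp σ fun a => θ a (u (I a))
    rw [h5]
    rcases Int.units_eq_one_or (Perm.sign σ) with hs | hs <;> simp [hs]
  rw [Finset.sum_congr rfl fun σ _ => key σ, Finset.sum_const, Finset.card_univ,
    Fintype.card_perm, Fintype.card_fin, nsmul_eq_mul]

/-- The coordinates, in the frame `u`, of the vectors dual to `θ` and of `v`. -/
def coordMatrix (h : p + l = 2 * n) (g : V →L[ℝ] V →L[ℝ] ℝ) (u : Fin (2 * n) → V)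
    (θ : Fin p → V →L[ℝ] ℂ) (v : Fin l → V) : Matrix (Fin (2 * n)) (Fin (2 * n)) ℂ :=
  fun x s => Fin.append (fun a => θ a (u s)) (fun j => (g (v j) (u s) : ℂ)) (Fin.cast h.symm x)

theorem coordMatrix_fst (h : p + l = 2 * n) (θ : Fin p → V →L[ℝ] ℂ) (v : Fin l → V) (a : Fin p)
    (s : Fin (2 * n)) : coordMatrix h g u θ v (fstIdx h a) s = θ a (u s) := by
  simp [coordMatrix, fstIdx]

theorem coordMatrix_snd (h : p + l = 2 * n) (θ : Fin p → V →L[ℝ] ℂ) (v : Fin l → V) (a : Fin l)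
    (s : Fin (2 * n)) : coordMatrix h g u θ v (sndIdx h a) s = g (v a) (u s) := by
  simp [coordMatrix, sndIdx]

/-- Expand `vol` as a determinant in the frame. In the first `p` rows the entries are Kronecker
deltas, and summing over `I` replaces them by the numbers `θ_a(u_s)`. This is insertion of the
vectors dual to the `θ_a`, which are complex, without complexifying `V`. -/
theorem sum_insertFirst_mul_prod [FiniteDimensional ℝ V] (hn : Module.finrank ℝ V = 2 * n)
    (h : p + l = 2 * n) (hu : IsOrthonormalFrame g u)
    (vol : V [⋀^Fin (2 * n)]→L[ℝ] ℝ) (θ : Fin p → V →L[ℝ] ℂ) (v : Fin l → V) :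
    ∑ I : Fin p → Fin (2 * n), (insertFirst h vol (u ∘ I) v : ℂ) * ∏ a, θ a (u (I a)) =
    (vol u : ℂ) * (coordMatrix h g u θ v).det := by
  have h1 : ∀ I : Fin p → Fin (2 * n), (insertFirst h vol (u ∘ I) v : ℂ) = vol u *
      ∑ σ : Perm (Fin (2 * n)), Perm.sign σ • ((∏ a, if I a = σ (fstIdx h a) then 1 else 0) *
        ∏ j, (g (v j) (u (σ (sndIdx h j))) : ℂ)) := by
    intro I
    have : insertFirst h vol (u ∘ I) v = vol fun x => Fin.append (u ∘ I) v (Fin.cast h.symm x) :=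
      rfl
    rw [this, hu.map_eq_sum hn vol]
    push_cast
    congr 1
    refine Finset.sum_congr rfl fun σ _ => ?_
    rw [prod_fst_snd h]
    have h2 : ∀ z : ℝ, ((Perm.sign σ • z : ℝ) : ℂ) = Perm.sign σ • (z : ℂ) := by
      intro z
      rcases Int.units_eq_one_or (Perm.sign σ) with hs | hs <;> simp [hs]
    rw [h2]
    push_cast
    congr 2
    · refine Finset.prod_congr rfl fun a _ => ?_
      simp only [fstIdx, Fin.cast_cast, Fin.cast_eq_self, Fin.append_left, Function.comp_apply,
        hu _ _]
      split_ifs <;> simp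
    · simp [sndIdx]
  simp only [h1, mul_assoc, ← Finset.mul_sum, Finset.sum_mul]
  rw [Finset.sum_comm, ← Matrix.det_transpose, Matrix.det_apply]
  congr 1
  refine Finset.sum_congr rfl fun σ _ => ?_
  rw [prod_fst_snd h]
  simp only [Matrix.transpose_apply, coordMatrix_fst, coordMatrix_snd]
  rw [Finset.sum_eq_single (fun a => σ (fstIdx h a))]
  · simp only [if_true, Finset.prod_const_one, one_mul, smul_mul_assoc]
    exact congrArg _ (mul_comm _ _)
  · intro I _ hI
    obtain ⟨a, ha⟩ : ∃ a, I a ≠ σ (fstIdx h a) := by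
      by_contra! h'; exact hI (funext h')
    rw [Finset.prod_eq_zero (Finset.mem_univ a) (by simp [ha])]
    simp
  · simp

/-- Each Leibniz term of the determinant is absorbed by permuting the first `p` arguments inside the
sum over `τ`. -/
theorem wedgePairs_det (hp : p ≤ n) (hl : p + l = 2 * n) (b : V [⋀^Fin 2]→L[ℝ] ℝ)
    (α : V [⋀^Fin p]→L[ℝ] ℂ) (θ : Fin p → V →L[ℝ] ℂ)
    (hα : ∀ v, α v = Matrix.det (Matrix.of fun i j => θ i (v j))) (v : Fin l → V) :
    wedgePairs hp hl α b v = (p.factorial : ℂ) * ∑ τ : Perm (Fin l), Perm.sign τ •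
      ((∏ a : Fin p, θ a (v (τ ⟨a, by omega⟩))) *
      ∏ i : Fin (n - p),
        (b ![v (τ ⟨p + 2 * i, by omega⟩), v (τ ⟨p + 2 * i + 1, by omega⟩)] : ℂ)) := by
  unfold wedgePairs
  simp only [hα, Matrix.det_apply, Matrix.of_apply, Finset.sum_mul, Finset.smul_sum]
  rw [Finset.sum_comm]
  have hpl : p + (l - p) = l := by omega
  have key : ∀ ρ : Perm (Fin p), ∑ τ : Perm (Fin l), Perm.sign τ •
      ((Perm.sign ρ • ∏ i, θ (ρ i) (v (τ ⟨i, by omega⟩))) *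
      ∏ i : Fin (n - p),
        (b ![v (τ ⟨p + 2 * i, by omega⟩), v (τ ⟨p + 2 * i + 1, by omega⟩)] : ℂ)) =
      ∑ τ : Perm (Fin l), Perm.sign τ •
      ((∏ a : Fin p, θ a (v (τ ⟨a, by omega⟩))) *
      ∏ i : Fin (n - p),
        (b ![v (τ ⟨p + 2 * i, by omega⟩), v (τ ⟨p + 2 * i + 1, by omega⟩)] : ℂ)) := by
    intro ρ
    symm
    refine Fintype.sum_equiv (Equiv.mulRight (permFirst hpl ρ)) _ _ fun τ => ?_
    have h1 : ∀ a : Fin p, (τ * permFirst hpl ρ) ⟨a, by omega⟩ = τ ⟨ρ a, by omega⟩ := by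
      intro a
      rw [Perm.mul_apply]
      exact congrArg τ (permFirst_castAdd hpl ρ a)
    have h2 : ∀ a (ha : p + a < l), (τ * permFirst hpl ρ) ⟨p + a, ha⟩ = τ ⟨p + a, ha⟩ := by
      intro a ha
      rw [Perm.mul_apply]
      exact congrArg τ (permFirst_natAdd hpl ρ ⟨a, by omega⟩)
    have h3 : ∏ i, θ (ρ i) (v (τ ⟨ρ i, by omega⟩)) = ∏ a, θ a (v (τ ⟨a, by omega⟩)) :=
      Equiv.prod_comp ρ fun a => θ a (v (τ ⟨a, by omega⟩))
    simp only [Equiv.coe_mulRight, h1, h2, add_assoc, h3, Perm.sign_mul, sign_permFirst]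
    rcases Int.units_eq_one_or (Perm.sign ρ) with hs | hs <;> simp [hs]
  rw [Finset.sum_congr rfl fun σ _ => key σ, Finset.sum_const, Finset.card_univ,
    Fintype.card_perm, Fintype.card_fin, nsmul_eq_mul]

theorem stdSymplectic_ofReal (s t : Fin (2 * n)) :
    stdSymplectic ℂ n s t = (stdSymplectic ℝ n s t : ℂ) := by
  unfold stdSymplectic
  split_ifs <;> simp

theorem stdPfaffian_ofReal : stdPfaffian ℂ n = (stdPfaffian ℝ n : ℂ) := by
  unfold stdPfaffian pfaffianTerm
  rw [Complex.ofReal_sum]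
  refine Finset.sum_congr rfl fun σ _ => ?_
  rcases Int.units_eq_one_or (Perm.sign σ) with hs | hs <;> simp [hs, stdSymplectic_ofReal]

/-- The star equals, up to known constants, the determinant of the coordinate matrix `B`, hence the
Pfaffian sum of `A = B Ω Bᵀ`. Type `(1,0)` determines the blocks of `A`, and the isotropic expansion
of that sum is the wedge expression. -/
theorem hodgeStar_of_det [FiniteDimensional ℝ V] (hn : Module.finrank ℝ V = 2 * n)
    (hg : IsHermitian g J) (hp : p ≤ n) (hl : p + l = 2 * n) (b : V [⋀^Fin 2]→L[ℝ] ℝ)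
    (hb : ∀ v w, b ![v, w] = g (J v) w) (e : Module.Basis (Fin (2 * n)) ℝ V)
    (α : V [⋀^Fin p]→L[ℝ] ℂ) (θ : Fin p → V →L[ℝ] ℂ) (hθ : ∀ i v, θ i (J v) = Complex.I * θ i v)
    (hα : ∀ v, α v = Matrix.det (Matrix.of fun i j => θ i (v j))) (v : Fin l → V) :
    hodgeStar hl g (wedgePowDivFactorial n b) e α v =
      starConst n p hp * wedgePairs hp hl α b v := by
  obtain ⟨u, hu⟩ := exists_isUnitaryFrame hg hn
  have huo := hu.orthonormal
  set B := coordMatrix hl g u θ v with hB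
  set A : Fin (2 * n) → Fin (2 * n) → ℂ := fun x y => ∑ s, ∑ t, B x s * stdSymplectic ℂ n s t * B y t
    with hA
  have hneg : ∀ x y, A x y = -A y x := by
    intro x y
    simp only [hA]
    rw [Finset.sum_comm, ← Finset.sum_neg_distrib]
    refine Finset.sum_congr rfl fun s _ => ?_
    rw [← Finset.sum_neg_distrib]
    refine Finset.sum_congr rfl fun t _ => ?_
    rw [stdSymplectic_neg]; ring
  have hred : ∀ (x y) (φ ψ : V →L[ℝ] ℂ), (∀ s, B x s = φ (u s)) → (∀ s, B y s = ψ (u s)) →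
      A x y = ∑ s, φ (u s) * ψ (J (u s)) := by
    intro x y φ ψ hx hy
    simp only [hA, hx, hy]
    refine Finset.sum_congr rfl fun s _ => ?_
    rw [← huo.sum_mul_apply hn ψ (J (u s)), Finset.mul_sum]
    refine Finset.sum_congr rfl fun t _ => ?_
    rw [stdSymplectic_ofReal, hu.fundamental hg]; ring
  have hθB : ∀ a s, B (fstIdx hl a) s = θ a (u s) := coordMatrix_fst hl θ v
  have hvB : ∀ j s, B (sndIdx hl j) s = (Complex.ofRealCLM.comp (g (v j))) (u s) :=
    coordMatrix_snd hl θ v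
  -- Since `θ ∘ J = i θ`, this block is `i ∑ θ_a(u_s) θ_a'(u_s)`, symmetric in `a` and `a'`; being
  -- skew as well, it vanishes.
  have h0 : ∀ a a' : Fin p, A (fstIdx hl a) (fstIdx hl a') = 0 := by
    intro a a'
    have h1 := hneg (fstIdx hl a) (fstIdx hl a')
    rw [hred _ _ _ _ (hθB a) (hθB a'), hred _ _ _ _ (hθB a') (hθB a)] at h1
    rw [hred _ _ _ _ (hθB a) (hθB a')]
    simp only [hθ] at h1 ⊢
    have h2 : ∑ s, θ a' (u s) * (Complex.I * θ a (u s)) =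
        ∑ s, θ a (u s) * (Complex.I * θ a' (u s)) :=
      Finset.sum_congr rfl fun s _ => by ring
    rw [h2] at h1
    exact self_eq_neg.1 h1
  have hskew : ∀ w s, g w (J (u s)) = -g (J w) (u s) := by
    intro w s
    rw [hg.skew, neg_neg]
  -- Moving `J` from the frame onto `v_j` costs a sign, and `θ_a` turns it into the factor `i`.
  have h1 : ∀ a j, A (fstIdx hl a) (sndIdx hl j) = -Complex.I * θ a (v j) := by
    intro a j
    rw [hred _ _ _ _ (hθB a) (hvB j), neg_mul, ← hθ, ← huo.sum_mul_apply hn (θ a),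
      ← Finset.sum_neg_distrib]
    refine Finset.sum_congr rfl fun s _ => ?_
    simp [hskew, mul_comm]
  have h2 : ∀ i j, A (sndIdx hl i) (sndIdx hl j) = b ![v i, v j] := by
    intro i j
    rw [hred _ _ _ _ (hvB i) (hvB j), hb, hg.skew, hg.symm]
    have h3 := huo.sum_mul_apply hn (Complex.ofRealCLM.comp (g (v i))) (J (v j))
    simp only [ContinuousLinearMap.comp_apply, Complex.ofRealCLM_apply] at h3 ⊢
    rw [hg.symm (J (v j)), Complex.ofReal_neg, ← h3, ← Finset.sum_neg_distrib]
    refine Finset.sum_congr rfl fun s _ => ?_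
    rw [hskew]; push_cast; ring
  have hpf := sum_pfaffianTerm_of_isotropic A hneg hp hl (by
    intro a a' ha ha'
    exact h0 ⟨a, ha⟩ ⟨a', ha'⟩)
  have hcong := sum_pfaffianTerm_congruence B (stdSymplectic ℂ n)
  rw [hodgeStar_apply hl huo]
  simp only [hα, Function.comp_apply]
  rw [sum_det_smul, sum_insertFirst_mul_prod hn hl huo, wedgePowDivFactorial_unitary hu hg b hb,
    wedgePairs_det hp hl b α θ hα]
  have hfac : (p.factorial : ℂ) ≠ 0 := Nat.cast_ne_zero.2 (Nat.factorial_ne_zero p)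
  change ∑ σ, pfaffianTerm A σ = B.det * stdPfaffian ℂ n at hcong
  -- The unknown number `stdPfaffian` occurs both in the volume of a unitary frame and in the
  -- congruence formula, so its value is not needed.
  have hdet : (unitVolume n : ℂ) * B.det = (1 / ((2 : ℝ) ^ n * (n.factorial : ℝ)) : ℝ) *
      ∑ σ, pfaffianTerm A σ := by
    rw [hcong, stdPfaffian_ofReal, unitVolume]; push_cast; ring
  rw [← hB, hdet, hpf, starConst, Complex.real_smul]
  have h3 : ∀ τ : Perm (Fin l),
      ((∏ a : Fin p, A ⟨a, by omega⟩ (Fin.cast hl (Fin.natAdd p (τ ⟨a, by omega⟩)))) *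
        ∏ i : Fin (n - p), A (Fin.cast hl (Fin.natAdd p (τ ⟨p + 2 * i, by omega⟩)))
          (Fin.cast hl (Fin.natAdd p (τ ⟨p + 2 * i + 1, by omega⟩)))) =
      (-Complex.I) ^ p * ((∏ a : Fin p, θ a (v (τ ⟨a, by omega⟩))) *
      ∏ i : Fin (n - p),
        (b ![v (τ ⟨p + 2 * i, by omega⟩), v (τ ⟨p + 2 * i + 1, by omega⟩)] : ℂ)) := by
    intro τ
    have h4 : ∀ (a : Fin p) j, A ⟨a, by omega⟩ (sndIdx hl j) = -Complex.I * θ a (v j) := h1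
    simp only [h2, h4, Finset.prod_mul_distrib, Finset.prod_const, Finset.card_univ,
      Fintype.card_fin]
    ring
  simp only [h3, ← mul_smul_comm, ← Finset.mul_sum, nsmul_eq_mul]
  rcases Int.units_eq_one_or (Perm.sign (evenFirst n p hp)) with hs | hs <;>
    simp only [hs, one_smul, Units.neg_smul, Units.val_one, Units.val_neg, Int.cast_one,
      Int.cast_neg] <;> push_cast <;> field_simp

theorem hodgeStar_of_mem_typeForms [FiniteDimensional ℝ V] (hn : Module.finrank ℝ V = 2 * n)
    (hg : IsHermitian g J) (hp : p ≤ n) (hl : p + l = 2 * n) (b : V [⋀^Fin 2]→L[ℝ] ℝ)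
    (hb : ∀ v w, b ![v, w] = g (J v) w) (e : Module.Basis (Fin (2 * n)) ℝ V)
    (α : V [⋀^Fin p]→L[ℝ] ℂ) (hα : α ∈ typeForms J p 0) (v : Fin l → V) :
    hodgeStar hl g (wedgePowDivFactorial n b) e α v =
      starConst n p hp * wedgePairs hp hl α b v := by
  obtain ⟨u, hu⟩ := exists_isUnitaryFrame hg hn
  have huo := hu.orthonormal
  induction hα using Submodule.span_induction with
  | mem x hx =>
    obtain ⟨θ, h1, -, h3⟩ := hx
    exact hodgeStar_of_det hn hg hp hl b hb e x θ (fun i w => h1 i i.2 w) h3 v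
  | zero => rw [hodgeStar_zero]; simp [wedgePairs]
  | add x y _ _ hx hy =>
    have h1 : wedgePairs hp hl (x + y) b v = wedgePairs hp hl x b v + wedgePairs hp hl y b v := by
      simp only [wedgePairs, ContinuousAlternatingMap.add_apply, add_mul, smul_add,
        Finset.sum_add_distrib]
    rw [h1, mul_add, ← hx, ← hy]
    simp only [hodgeStar_apply hl huo, ContinuousAlternatingMap.add_apply, smul_add,
        Finset.sum_add_distrib]
  | smul c x _ hx =>
    have h1 : wedgePairs hp hl (c • x) b v = c * wedgePairs hp hl x b v := by
      simp only [wedgePairs, ContinuousAlternatingMap.smul_apply, Finset.mul_sum, smul_eq_mul,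
        mul_assoc, mul_smul_comm]
    rw [h1, mul_left_comm, ← hx]
    simp only [hodgeStar_apply hl huo, ContinuousAlternatingMap.smul_apply, smul_eq_mul,
      Finset.mul_sum, mul_smul_comm]

end StarOfType

/-! ### Exterior derivatives and signed sums -/

section ExteriorCalculus

open Equiv Topology

variable {E : Type*} [NormedAddCommGroup E] [NormedSpace ℝ E]

theorem extDeriv_apply_eq_sum {F : Type*} [NormedAddCommGroup F] [NormedSpace ℝ F] {k : ℕ}
    (α : E → E [⋀^Fin k]→L[ℝ] F) (y : E) (v : Fin (k + 1) → E) :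
    extDeriv α y v = ∑ i : Fin (k + 1), (-1 : ℤˣ) ^ (i : ℕ) •
      fderiv ℝ α y (v i) (fun j => v (i.succAbove j)) := by
  rw [extDeriv, ContinuousAlternatingMap.alternatizeUncurryFin_apply]
  refine Finset.sum_congr rfl fun i _ => ?_
  rw [Units.smul_def]
  push_cast
  rfl

/-- An alternating form is recovered, up to `(l + 1)!`, from its own antisymmetrization. By
`sum_sign_smul_insert` for the identity embedding this is a multiple of an antisymmetrization of
`T`, so it suffices that the latter vanishes. -/
theorem alternating_eq_zero_of_sum {l : ℕ} (f : E [⋀^Fin (l + 1)]→L[ℝ] ℂ)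
    (T : E → (Fin l → E) → ℂ)
    (hf : ∀ v, f v = ∑ i : Fin (l + 1), (-1 : ℤˣ) ^ (i : ℕ) •
      ∑ τ : Perm (Fin l), Perm.sign τ • T (v i) (fun j => v (i.succAbove (τ j))))
    (hT : ∀ v : Fin (l + 1) → E, ∑ σ : Perm (Fin (l + 1)), Perm.sign σ •
      T (v (σ 0)) (fun j => v (σ j.succ)) = 0) : f = 0 := by
  ext v
  have h1 : ∑ σ : Perm (Fin (l + 1)), Perm.sign σ • f (v ∘ σ) =
      ((l + 1).factorial : ℂ) * f v := by
    simp only [map_comp_perm, smul_smul, Int.units_mul_self, one_smul, Finset.sum_const,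
      Finset.card_univ, Fintype.card_perm, Fintype.card_fin, nsmul_eq_mul]
  have h2 := sum_sign_smul_insert (Function.Embedding.refl (Fin (l + 1)))
    (fun x w (_ : Fin (l + 1) → E) =>
      ∑ τ : Perm (Fin l), Perm.sign τ • T x (fun j => w (τ j))) (fun _ _ _ _ _ => rfl) v
  simp only [Function.Embedding.refl_apply] at h2
  have h3 : ∀ σ : Perm (Fin (l + 1)), f (v ∘ σ) = ∑ i : Fin (l + 1), (-1 : ℤˣ) ^ (i : ℕ) •
      ∑ τ : Perm (Fin l), Perm.sign τ • T (v (σ i)) (fun j => v (σ (i.succAbove (τ j)))) :=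
    fun σ => hf _
  simp only [← h3] at h2
  rw [h1] at h2
  have h4 : ∑ σ : Perm (Fin (l + 1)), Perm.sign σ • ∑ τ : Perm (Fin l), Perm.sign τ •
      T (v (σ 0)) (fun j => v (σ (τ j).succ)) = 0 := by
    simp only [Finset.smul_sum]
    rw [Finset.sum_comm]
    refine Finset.sum_eq_zero fun τ _ => ?_
    rw [← hT v]
    have hl : 1 + l = l + 1 := add_comm _ _
    refine Fintype.sum_equiv (Equiv.mulRight (permLast hl τ)) _ _ fun σ => ?_
    have e0 : permLast hl τ 0 = 0 := permLast_castAdd hl τ 0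
    have e1 : ∀ j : Fin l, permLast hl τ j.succ = (τ j).succ := by
      intro j
      have h5 := permLast_natAdd hl τ j
      have h6 : ∀ i : Fin l, Fin.cast hl (Fin.natAdd 1 i) = i.succ := by
        intro i; ext; simp
      rwa [h6, h6] at h5
    simp only [Equiv.coe_mulRight, Perm.mul_apply, e0, e1, Perm.sign_mul, sign_permLast, smul_smul]
  rw [h4, smul_zero] at h2
  rcases mul_eq_zero.1 h2.symm with h5 | h5
  · exact absurd h5 (Nat.cast_ne_zero.2 (Nat.factorial_ne_zero _))
  · exact h5

/-- The Leibniz rule for `d(α ∧ b^(n-p))`: after full antisymmetrization, the direction of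
differentiation can be antisymmetrized with the arguments of the differentiated factor alone, and so
each term contains `dα` or `db`. -/
theorem extDeriv_wedgePairs_eq_zero {n p l : ℕ} (hp : p ≤ n) (hl : p + l = 2 * n)
    {α : E → E [⋀^Fin p]→L[ℝ] ℂ} {b : E → E [⋀^Fin 2]→L[ℝ] ℝ} {η : E → E [⋀^Fin l]→L[ℝ] ℂ}
    {y : E} {C : ℂ} (hα : DifferentiableAt ℝ α y) (hb : DifferentiableAt ℝ b y)
    (hη : DifferentiableAt ℝ η y) (hdα : extDeriv α y = 0) (hdb : extDeriv b y = 0)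
    (heq : ∀ᶠ z in 𝓝 y, ∀ v, η z v = C * wedgePairs hp hl (α z) (b z) v) :
    extDeriv η y = 0 := by
  set B : (Fin l → E) → Fin (n - p) → (Fin 2 → E) := fun w i =>
    ![w ⟨p + 2 * i, by omega⟩, w ⟨p + 2 * i + 1, by omega⟩] with hB
  set A : (Fin l → E) → (Fin p → E) := fun w a => w ⟨a, by omega⟩ with hA
  -- `T x w` is the derivative in direction `x` of one summand of `wedgePairs`, by the product rule.
  set T : E → (Fin l → E) → ℂ := fun x w => C *
    (fderiv ℝ α y x (A w) * ∏ i, (b y (B w i) : ℂ) + ∑ i, α y (A w) * ((fderiv ℝ b y x (B w i) : ℂ) *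
      ∏ j ∈ Finset.univ.erase i, (b y (B w j) : ℂ))) with hT
  have hderiv : ∀ (w : Fin l → E) (x : E), fderiv ℝ (fun z => η z w) y x =
      ∑ τ : Perm (Fin l), Perm.sign τ • T x (fun j => w (τ j)) := by
    intro w x
    have h1 : (fun z => η z w) =ᶠ[𝓝 y] fun z => C * ∑ τ : Perm (Fin l), Perm.sign τ •
        (α z (A (w ∘ τ)) * ∏ i, (b z (B (w ∘ τ) i) : ℂ)) := by
      filter_upwards [heq] with z hz
      exact hz w
    rw [h1.fderiv_eq]
    have hα' : ∀ v, HasFDerivAt (fun z => α z v)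
        ((ContinuousAlternatingMap.apply ℝ E ℂ v).comp (fderiv ℝ α y)) y := fun v =>
      (ContinuousAlternatingMap.apply ℝ E ℂ v).hasFDerivAt.comp y hα.hasFDerivAt
    have hb' : ∀ v, HasFDerivAt (fun z => (b z v : ℂ))
        (Complex.ofRealCLM.comp ((ContinuousAlternatingMap.apply ℝ E ℝ v).comp (fderiv ℝ b y))) y :=
      fun v => Complex.ofRealCLM.hasFDerivAt.comp y
        ((ContinuousAlternatingMap.apply ℝ E ℝ v).hasFDerivAt.comp y hb.hasFDerivAt)
    have hterm : ∀ τ : Perm (Fin l), HasFDerivAt (fun z => Perm.sign τ •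
        (α z (A (w ∘ τ)) * ∏ i, (b z (B (w ∘ τ) i) : ℂ))) _ y := fun τ =>
      ((hα' (A (w ∘ τ))).mul (HasFDerivAt.finsetProd (u := Finset.univ)
        fun i _ => hb' (B (w ∘ τ) i))).const_smul (Perm.sign τ : ℤ)
    rw [((HasFDerivAt.fun_sum (u := Finset.univ) fun τ _ => hterm τ).const_mul C).fderiv]
    simp only [_root_.smul_apply, _root_.sum_apply, smul_eq_mul,
      Finset.mul_sum, _root_.add_apply, ContinuousLinearMap.comp_apply,
      ContinuousAlternatingMap.apply_apply, Complex.ofRealCLM_apply]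
    refine Finset.sum_congr rfl fun τ _ => ?_
    rw [Units.smul_def, mul_smul_comm]
    congr 2
    rw [add_comm, mul_comm]
    refine congrArg₂ _ rfl (Finset.sum_congr rfl fun i _ => ?_)
    rw [mul_comm (∏ j ∈ _, _)]
    rfl
  refine alternating_eq_zero_of_sum _ T (fun v => ?_) fun v => ?_
  · rw [extDeriv_apply hη]
    refine Finset.sum_congr rfl fun i _ => ?_
    rw [hderiv, Units.smul_def]
    push_cast
    rfl
  · have hlin : ∀ σ : Perm (Fin (l + 1)), Perm.sign σ • T (v (σ 0)) (fun j => v (σ j.succ)) =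
        C * (Perm.sign σ • (fderiv ℝ α y (v (σ 0)) (A fun j => v (σ j.succ)) *
          ∏ i, (b y (B (fun j => v (σ j.succ)) i) : ℂ))) +
        ∑ i, C * (Perm.sign σ • (α y (A fun j => v (σ j.succ)) *
          ((fderiv ℝ b y (v (σ 0)) (B (fun j => v (σ j.succ)) i) : ℂ) *
          ∏ j ∈ Finset.univ.erase i, (b y (B (fun j => v (σ j.succ)) j) : ℂ)))) := by
      intro σ
      rcases Int.units_eq_one_or (Perm.sign σ) with hs | hs <;>
        simp [hT, hs, mul_add, Finset.mul_sum]
    simp only [hlin]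
    rw [Finset.sum_add_distrib, Finset.sum_comm, ← Finset.mul_sum]
    -- Slot `0` is the direction and the next `p` slots feed `α`; antisymmetrizing over these
    -- produces `dα`.
    have hz1 : ∑ σ : Perm (Fin (l + 1)), Perm.sign σ •
        (fderiv ℝ α y (v (σ 0)) (A fun j => v (σ j.succ)) *
          ∏ i, (b y (B (fun j => v (σ j.succ)) i) : ℂ)) = 0 := by
      have h1 := sum_sign_smul_insert (Fin.castLEEmb (show p + 1 ≤ l + 1 by omega))
        (fun x w (W : Fin (l + 1) → E) => fderiv ℝ α y x w *
          ∏ i, (b y (B (fun j => W j.succ) i) : ℂ)) (fun x w W W' hW => by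
            congr 1
            refine Finset.prod_congr rfl fun i _ => ?_
            congr 3
            simp only [hB]
            rw [hW, hW]
            all_goals
              rintro ⟨j, hj⟩
              have := congrArg Fin.val hj
              simp at this
              omega) v
      have h2 : ∀ σ : Perm (Fin (l + 1)), ∑ i : Fin (p + 1), (-1 : ℤˣ) ^ (i : ℕ) •
          (fderiv ℝ α y (v (σ (Fin.castLEEmb (show p + 1 ≤ l + 1 by omega) i)))
            (fun j => v (σ (Fin.castLEEmb (show p + 1 ≤ l + 1 by omega) (i.succAbove j)))) *
          ∏ i, (b y (B (fun j => (v ∘ σ) j.succ) i) : ℂ)) = 0 := by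
        intro σ
        simp only [← smul_mul_assoc]
        rw [← Finset.sum_mul, ← extDeriv_apply_eq_sum α y fun i => v (σ (Fin.castLEEmb _ i)), hdα]
        simp
      simp only [h2, smul_zero, Finset.sum_const_zero] at h1
      rw [nsmul_eq_mul, mul_eq_zero] at h1
      rcases h1 with h1 | h1
      · exact absurd h1 (Nat.cast_ne_zero.2 (Nat.succ_ne_zero p))
      · exact h1
    have hz2 : ∀ i : Fin (n - p), ∑ σ : Perm (Fin (l + 1)), Perm.sign σ •
        (α y (A fun j => v (σ j.succ)) *
          ((fderiv ℝ b y (v (σ 0)) (B (fun j => v (σ j.succ)) i) : ℂ) *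
          ∏ j ∈ Finset.univ.erase i, (b y (B (fun j => v (σ j.succ)) j) : ℂ))) = 0 := by
      intro i
      -- The slots of the direction and of the `i`-th pair. The pair sits at `p + 2i + 1` and `p +
      -- 2i + 2`, one further than in `B`, because slot `0` is taken by the direction.
      let e : Fin (2 + 1) ↪ Fin (l + 1) :=
        ⟨fun x => ⟨if (x : ℕ) = 0 then 0 else p + 2 * i + x, by split_ifs <;> omega⟩, by
          intro x x' hx
          have := congrArg Fin.val hx
          simp only at this
          ext
          split_ifs at this <;> omega⟩
      have he1 : ∀ f : Fin (l + 1) → E, (fun j : Fin 2 => f (e j.succ)) =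
          B (fun j => f j.succ) i := by
        intro f
        ext j
        fin_cases j <;> rfl
      have h1 := sum_sign_smul_insert e
        (fun x w (W : Fin (l + 1) → E) => α y (A fun j => W j.succ) *
          ((fderiv ℝ b y x w : ℂ) *
          ∏ j ∈ Finset.univ.erase i, (b y (B (fun j => W j.succ) j) : ℂ)))
        (fun x w W W' hW => by
          have hA' : A (fun j => W j.succ) = A (fun j => W' j.succ) := by
            ext a
            simp only [hA]
            rw [hW]
            rintro ⟨j, hj⟩
            have : (if (j : ℕ) = 0 then 0 else p + 2 * (i : ℕ) + j) = a + 1 := congrArg Fin.val hj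
            split_ifs at this
            omega
          rw [hA']
          congr 2
          refine Finset.prod_congr rfl fun c hc => ?_
          have hne : (c : ℕ) ≠ i := fun h => (Finset.mem_erase.1 hc).1 (Fin.ext h)
          congr 3
          simp only [hB, Fin.succ_mk]
          have hr : ∀ (x : ℕ) (hx : x < l + 1), x = p + 2 * c + 1 ∨ x = p + 2 * c + 2 →
              (⟨x, hx⟩ : Fin (l + 1)) ∉ Set.range e := by
            rintro x hx hxc ⟨j, hj⟩
            have : (if (j : ℕ) = 0 then 0 else p + 2 * (i : ℕ) + j) = x := congrArg Fin.val hj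
            split_ifs at this <;> omega
          rw [hW _ (hr _ _ (Or.inl rfl)), hW _ (hr _ _ (Or.inr rfl))]) v
      have h2 : ∀ σ : Perm (Fin (l + 1)), ∑ c : Fin (2 + 1), (-1 : ℤˣ) ^ (c : ℕ) •
          (α y (A fun j => (v ∘ σ) j.succ) *
          ((fderiv ℝ b y (v (σ (e c))) (fun j => v (σ (e (c.succAbove j)))) : ℂ) *
          ∏ j ∈ Finset.univ.erase i, (b y (B (fun j => (v ∘ σ) j.succ) j) : ℂ))) = 0 := by
        intro σ
        have hcomm : ∀ (c : ℤˣ) (x y z : ℂ), c • (x * (y * z)) = x * ((c • y) * z) :=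
          fun c x y z => by rw [smul_mul_assoc, mul_smul_comm]
        simp only [hcomm]
        rw [← Finset.mul_sum, ← Finset.sum_mul]
        have h3 := extDeriv_apply_eq_sum b y fun i => v (σ (e i))
        rw [hdb] at h3
        have h4 : ∑ c : Fin (2 + 1), (-1 : ℤˣ) ^ (c : ℕ) •
            ((fderiv ℝ b y (v (σ (e c))) (fun j => v (σ (e (c.succAbove j)))) : ℝ) : ℂ) = 0 := by
          have h5 := congrArg (fun r : ℝ => (r : ℂ)) h3
          rw [show (0 : E [⋀^Fin (2 + 1)]→L[ℝ] ℝ) (fun i => v (σ (e i))) = 0 from rfl] at h5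
          simp only [Complex.ofReal_zero, Complex.ofReal_sum] at h5
          rw [h5]
          refine Finset.sum_congr rfl fun c _ => ?_
          rcases neg_one_pow_eq_or ℤˣ (c : ℕ) with hs | hs <;> simp [hs]
        rw [h4]; simp
      simp only [h2, smul_zero, Finset.sum_const_zero] at h1
      rw [nsmul_eq_mul, mul_eq_zero] at h1
      rcases h1 with h1 | h1
      · exact absurd h1 (Nat.cast_ne_zero.2 (Nat.succ_ne_zero 2))
      · refine (Finset.sum_congr rfl fun σ _ => ?_).trans h1
        rw [← he1 fun x => v (σ x)]
        rfl
    rw [hz1, mul_zero, zero_add]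
    refine Finset.sum_eq_zero fun i _ => ?_
    rw [← Finset.mul_sum, hz2, mul_zero]

end ExteriorCalculus

/-! ### Integration by parts in a vector space -/

section IntegrationByParts

open Equiv Topology MeasureTheory

/-- The pointwise form of `d(γ ∧ η) = dγ ∧ η + (-1)^k γ ∧ dη`, conjugation being hidden in the real
inner product. The weights `1/(k+1)` and `1/(l+1)` compensate for `extDeriv` already summing over
the choice of the direction among its arguments. -/
theorem sum_fderiv_eq_pairing {E : Type*} [NormedAddCommGroup E] [NormedSpace ℝ E] {k l m : ℕ}
    (h : k + 1 + l = m) (h' : k + (l + 1) = m) {γ : E → E [⋀^Fin k]→L[ℝ] ℂ}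
    {η : E → E [⋀^Fin l]→L[ℝ] ℂ} {y : E} (hγ : DifferentiableAt ℝ γ y)
    (hη : DifferentiableAt ℝ η y) (v : Fin m → E) :
    ∑ σ : Perm (Fin m), Perm.sign σ • fderiv ℝ (fun z =>
      inner ℝ (γ z (fun a => v (σ (fstIdx h a.succ)))) (η z (fun j => v (σ (sndIdx h j))))) y
        (v (σ (fstIdx h 0))) =
    (1 / (k + 1 : ℝ)) * pairing h (extDeriv γ y) (η y) v +
      (1 / (l + 1 : ℝ)) * ((-1) ^ k * pairing h' (γ y) (extDeriv η y) v) := by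
  have hD : ∀ (a : Fin k → E) (b : Fin l → E) (x : E),
      fderiv ℝ (fun z => (inner ℝ (γ z a) (η z b) : ℝ)) y x =
        inner ℝ (fderiv ℝ γ y x a) (η y b) + inner ℝ (γ y a) (fderiv ℝ η y x b) := by
    intro a b x
    have h1 : HasFDerivAt (fun z => γ z a)
        ((ContinuousAlternatingMap.apply ℝ E ℂ a).comp (fderiv ℝ γ y)) y :=
      (ContinuousAlternatingMap.apply ℝ E ℂ a).hasFDerivAt.comp y hγ.hasFDerivAt
    have h2 : HasFDerivAt (fun z => η z b)
        ((ContinuousAlternatingMap.apply ℝ E ℂ b).comp (fderiv ℝ η y)) y :=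
      (ContinuousAlternatingMap.apply ℝ E ℂ b).hasFDerivAt.comp y hη.hasFDerivAt
    rw [fderiv_inner_apply ℝ h1.differentiableAt h2.differentiableAt, h1.fderiv, h2.fderiv, add_comm]
    rfl
  simp only [hD, smul_add, Finset.sum_add_distrib]
  have hinj1 : Function.Injective (fstIdx h) := fun i j hij => by
    have := congrArg Fin.val hij; ext; simpa using this
  have hinj2 : Function.Injective (sndIdx h') := fun i j hij => by
    have := congrArg Fin.val hij; ext; simpa using this
  congr 1
  · have h1 := sum_sign_smul_insert ⟨fstIdx h, hinj1⟩
      (fun x w (W : Fin m → E) => (inner ℝ (fderiv ℝ γ y x w) (η y fun j => W (sndIdx h j)) : ℝ))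
      (fun x w W W' hW => by
        congr 2
        ext j
        refine hW _ ?_
        rintro ⟨i, hi⟩
        have : (i : ℕ) = k + 1 + j := congrArg Fin.val hi
        omega) v
    simp only [Function.Embedding.coeFn_mk, Function.comp_apply] at h1
    have h2 : ∀ σ : Perm (Fin m), ∑ i : Fin (k + 1), (-1 : ℤˣ) ^ (i : ℕ) •
        (inner ℝ (fderiv ℝ γ y (v (σ (fstIdx h i))) fun j => v (σ (fstIdx h (i.succAbove j))))
          (η y fun j => v (σ (sndIdx h j))) : ℝ) =
        inner ℝ (extDeriv γ y (v ∘ σ ∘ fstIdx h)) (η y (v ∘ σ ∘ sndIdx h)) := by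
      intro σ
      rw [extDeriv_apply_eq_sum, sum_inner]
      refine Finset.sum_congr rfl fun i _ => ?_
      rcases neg_one_pow_eq_or ℤˣ (i : ℕ) with hs | hs <;>
        simp only [hs, one_smul, Units.neg_smul, inner_neg_left] <;> rfl
    simp only [h2] at h1
    rw [pairing_apply, ← h1, nsmul_eq_mul]
    push_cast
    field_simp
  · have h1 := sum_sign_smul_insert ⟨sndIdx h', hinj2⟩
      (fun x w (W : Fin m → E) => (inner ℝ (γ y fun j => W (fstIdx h' j)) (fderiv ℝ η y x w) : ℝ))
      (fun x w W W' hW => by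
        congr 2
        ext j
        refine hW _ ?_
        rintro ⟨i, hi⟩
        have : k + (i : ℕ) = j := congrArg Fin.val hi
        omega) v
    simp only [Function.Embedding.coeFn_mk, Function.comp_apply] at h1
    have h2 : ∀ σ : Perm (Fin m), ∑ i : Fin (l + 1), (-1 : ℤˣ) ^ (i : ℕ) •
        (inner ℝ (γ y fun j => v (σ (fstIdx h' j)))
          (fderiv ℝ η y (v (σ (sndIdx h' i))) fun j => v (σ (sndIdx h' (i.succAbove j)))) : ℝ) =
        inner ℝ (γ y (v ∘ σ ∘ fstIdx h')) (extDeriv η y (v ∘ σ ∘ sndIdx h')) := by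
      intro σ
      rw [extDeriv_apply_eq_sum, inner_sum]
      refine Finset.sum_congr rfl fun i _ => ?_
      rcases neg_one_pow_eq_or ℤˣ (i : ℕ) with hs | hs <;>
        simp only [hs, one_smul, Units.neg_smul, inner_neg_right] <;> rfl
    simp only [h2] at h1
    obtain ⟨m, rfl⟩ : ∃ m', m = m' + 1 := ⟨k + l, by omega⟩
    -- This cycle moves the direction of differentiation from slot `k`, at the head of the arguments
    -- of `η`, to slot `0`, past the `k` arguments of `γ`; hence the sign `(-1)^k`.
    set c : Perm (Fin (m + 1)) := Fin.cycleRange ⟨k, by omega⟩ with hc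
    have c1 : ∀ a : Fin k, c (fstIdx h' a) = fstIdx h a.succ := by
      intro a
      have ha : fstIdx h' a < (⟨k, by omega⟩ : Fin (m + 1)) := by simp [Fin.lt_def]
      rw [hc, Fin.cycleRange_of_lt ha]
      ext
      rw [Fin.val_add_one_of_lt (lt_of_lt_of_le ha (Fin.le_last _))]
      simp
    have c2 : c (sndIdx h' 0) = fstIdx h 0 := by
      have : sndIdx h' 0 = (⟨k, by omega⟩ : Fin (m + 1)) := by ext; simp
      rw [this, hc, Fin.cycleRange_self]
      ext; simp
    have c3 : ∀ j : Fin l, c (sndIdx h' j.succ) = sndIdx h j := by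
      intro j
      rw [hc, Fin.cycleRange_of_gt (by simp [Fin.lt_def])]
      ext; simp; omega
    have hsc : Perm.sign c = (-1) ^ k := by rw [hc, Fin.sign_cycleRange]
    have h3 : ∑ σ : Perm (Fin (m + 1)), Perm.sign σ •
        (inner ℝ (γ y fun a => v (σ (fstIdx h a.succ)))
          (fderiv ℝ η y (v (σ (fstIdx h 0))) fun j => v (σ (sndIdx h j))) : ℝ) =
        (-1) ^ k * ∑ σ : Perm (Fin (m + 1)), Perm.sign σ •
        (inner ℝ (γ y fun j => v (σ (fstIdx h' j)))
          (fderiv ℝ η y (v (σ (sndIdx h' 0))) fun j => v (σ (sndIdx h' j.succ))) : ℝ) := by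
      rw [Finset.mul_sum]
      refine Fintype.sum_equiv (Equiv.mulRight c) _ _ fun σ => ?_
      simp only [Equiv.coe_mulRight, Perm.mul_apply, c1, c2, c3, Perm.sign_mul, hsc]
      rcases Nat.even_or_odd k with hk | hk <;> simp [hk.neg_one_pow, add_comm]
    rw [h3, pairing_apply, ← h1, nsmul_eq_mul]
    push_cast
    field_simp

variable {E : Type*} [NormedAddCommGroup E] [NormedSpace ℝ E] [FiniteDimensional ℝ E]
  [MeasurableSpace E] [BorelSpace E] (μ : Measure E) [μ.IsAddHaarMeasure]

theorem integral_fderiv_eq_zero {F : E → ℝ} (hF : ContDiff ℝ 1 F) (hc : HasCompactSupport F)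
    (w : E) : ∫ y, fderiv ℝ F y w ∂μ = 0 := by
  have hd : Integrable (fun y => fderiv ℝ F y w) μ :=
    ((hF.continuous_fderiv one_ne_zero).clm_apply continuous_const).integrable_of_hasCompactSupport
      (hc.fderiv_apply (𝕜 := ℝ) w)
  -- Integration by parts against the constant function `1`, whose derivative vanishes.
  have h := integral_bilinear_hasLineDerivAt_right_eq_neg_left_of_integrable (μ := μ)
    (f := fun _ : E => (1 : ℝ)) (f' := fun _ => 0) (g := F) (g' := fun y => fderiv ℝ F y w)
    (v := w) (B := ContinuousLinearMap.mul ℝ ℝ) (by simp) (by simpa using hd)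
    (by simpa using hF.continuous.integrable_of_hasCompactSupport hc)
    (fun x _ => (hasFDerivAt_const (1 : ℝ) x).hasLineDerivAt w)
    (fun x _ => ((hF.differentiable one_ne_zero) x).hasFDerivAt.hasLineDerivAt w)
  simpa using h

/-- Extended by zero, `s * F` is of class `C¹` with compact support, and its derivative on `U` is
`s` times that of `F`. The locally constant `s` makes room for the sign of the volume density in a
chart. -/
theorem integral_mul_fderiv_eq_zero {U K : Set E} (hU : IsOpen U) (hK : IsCompact K) (hKU : K ⊆ U)
    {F s : E → ℝ} (hF : ContDiffOn ℝ 1 F U) (hFK : ∀ y ∈ U, y ∉ K → F y = 0)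
    (hs : ∀ y ∈ U, ∀ᶠ z in 𝓝 y, s z = s y) (w : E) :
    IntegrableOn (fun y => s y * fderiv ℝ F y w) U μ ∧ ∫ y in U, s y * fderiv ℝ F y w ∂μ = 0 := by
  classical
  set G : E → ℝ := U.indicator fun y => s y * F y with hG
  have hin : ∀ y ∈ U, G =ᶠ[𝓝 y] fun z => s y * F z := by
    intro y hy
    filter_upwards [hU.mem_nhds hy, hs y hy] with z hz hsz
    simp [hG, hz, hsz]
  have hz : ∀ y ∉ K, G y = 0 := by
    intro y hy
    by_cases hyU : y ∈ U
    · simp [hG, hyU, hFK y hyU hy]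
    · simp [hG, hyU]
  have hout : ∀ y ∉ K, G =ᶠ[𝓝 y] fun _ => 0 := by
    intro y hy
    filter_upwards [hK.isClosed.isOpen_compl.mem_nhds hy] with z hzK
    exact hz z hzK
  have hGd : ContDiff ℝ 1 G := by
    rw [contDiff_iff_contDiffAt]
    intro y
    by_cases hy : y ∈ K
    · exact ((contDiffAt_const.mul (hF.contDiffAt (hU.mem_nhds (hKU hy)))).congr_of_eventuallyEq
        (hin y (hKU hy)))
    · exact contDiffAt_const.congr_of_eventuallyEq (hout y hy)
  have hGc : HasCompactSupport G := HasCompactSupport.intro hK hz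
  have hGi : Integrable (fun y => fderiv ℝ G y w) μ :=
    ((hGd.continuous_fderiv one_ne_zero).clm_apply continuous_const).integrable_of_hasCompactSupport
      (hGc.fderiv_apply (𝕜 := ℝ) w)
  have heq : (U.indicator fun y => s y * fderiv ℝ F y w) = fun y => fderiv ℝ G y w := by
    ext y
    by_cases hy : y ∈ U
    · rw [Set.indicator_of_mem hy, (hin y hy).fderiv_eq, fderiv_const_mul
        ((hF.contDiffAt (hU.mem_nhds hy)).differentiableAt one_ne_zero)]
      simp
    · rw [Set.indicator_of_notMem hy, (hout y fun h => hy (hKU h)).fderiv_eq]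
      simp
  rw [← integrable_indicator_iff hU.measurableSet, ← integral_indicator hU.measurableSet, heq]
  exact ⟨hGi, integral_fderiv_eq_zero μ hGd hGc w⟩

/-- Integration by parts for forms in an open subset of a vector space. -/
theorem integral_pairing_extDeriv {k l m : ℕ} (h : k + 1 + l = m) (h' : k + (l + 1) = m)
    {U K : Set E} (hU : IsOpen U) (hK : IsCompact K) (hKU : K ⊆ U) {γ : E → E [⋀^Fin k]→L[ℝ] ℂ}
    {η : E → E [⋀^Fin l]→L[ℝ] ℂ} (hγ : ContDiffOn ℝ 1 γ U) (hη : ContDiffOn ℝ 1 η U)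
    (hγK : ∀ y ∈ U, y ∉ K → γ y = 0) {s : E → ℝ} (hs : ∀ y ∈ U, ∀ᶠ z in 𝓝 y, s z = s y)
    (v : Fin m → E) :
    ∫ y in U, s y * ((1 / (k + 1 : ℝ)) * pairing h (extDeriv γ y) (η y) v +
      (1 / (l + 1 : ℝ)) * ((-1) ^ k * pairing h' (γ y) (extDeriv η y) v)) ∂μ = 0 := by
  have happ : ∀ {j : ℕ} {β : E → E [⋀^Fin j]→L[ℝ] ℂ}, ContDiffOn ℝ 1 β U → ∀ w,
      ContDiffOn ℝ 1 (fun y => β y w) U := fun hβ w =>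
    (ContinuousAlternatingMap.apply ℝ E ℂ w).contDiff.comp_contDiffOn hβ
  have hd : ∀ {j : ℕ} {β : E → E [⋀^Fin j]→L[ℝ] ℂ}, ContDiffOn ℝ 1 β U → ∀ y ∈ U,
      DifferentiableAt ℝ β y := fun hβ y hy =>
    (hβ.contDiffAt (hU.mem_nhds hy)).differentiableAt one_ne_zero
  set F : Perm (Fin m) → E → ℝ := fun σ z =>
    inner ℝ (γ z (fun a => v (σ (fstIdx h a.succ)))) (η z (fun j => v (σ (sndIdx h j)))) with hF
  have hFd : ∀ σ, ContDiffOn ℝ 1 (F σ) U := fun σ => (happ hγ _).inner ℝ (happ hη _)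
  have hFK : ∀ σ, ∀ y ∈ U, y ∉ K → F σ y = 0 := fun σ y hy hyK => by
    simp [hF, hγK y hy hyK]
  have h1 := fun σ =>
    integral_mul_fderiv_eq_zero μ hU hK hKU (hFd σ) (hFK σ) hs (v (σ (fstIdx h 0)))
  have h2 : ∀ y ∈ U, s y * ((1 / (k + 1 : ℝ)) * pairing h (extDeriv γ y) (η y) v +
      (1 / (l + 1 : ℝ)) * ((-1) ^ k * pairing h' (γ y) (extDeriv η y) v)) =
      ∑ σ : Perm (Fin m), ((Perm.sign σ : ℤ) : ℝ) *
        (s y * fderiv ℝ (F σ) y (v (σ (fstIdx h 0)))) := by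
    intro y hy
    rw [← sum_fderiv_eq_pairing h h' (hd hγ y hy) (hd hη y hy), Finset.mul_sum]
    refine Finset.sum_congr rfl fun σ _ => ?_
    rw [Units.smul_def, zsmul_eq_mul]
    ring
  rw [setIntegral_congr_fun hU.measurableSet h2, integral_finsetSum _ fun σ _ =>
    (h1 σ).1.const_mul _]
  refine Finset.sum_eq_zero fun σ _ => ?_
  rw [integral_const_mul, (h1 σ).2, mul_zero]

end IntegrationByParts

/-! ### Forms in charts -/

section Charts

open Topology

/-- The coordinate space of a `2n`-manifold. -/
abbrev Coord (n : ℕ) : Type := EuclideanSpace ℝ (Fin (2 * n))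

variable {n : ℕ} {M : Type*} [TopologicalSpace M] [ChartedSpace (Coord n) M]

/-- The derivative of an inverse chart, with the tangent space identified with the coordinate
space. -/
def chartSymmDeriv (x₀ : M) (y : Coord n) : Coord n →L[ℝ] Coord n :=
  mfderiv 𝓘(ℝ, Coord n) (𝓡 (2 * n)) (extChartAt (𝓡 (2 * n)) x₀).symm y

/-- The derivative of a chart, with the tangent space identified with the coordinate space. -/
def chartDeriv (x₀ x : M) : Coord n →L[ℝ] Coord n :=
  mfderiv (𝓡 (2 * n)) 𝓘(ℝ, Coord n) (extChartAt (𝓡 (2 * n)) x₀) x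

/-- A form at a point, with the tangent space identified with the coordinate space. -/
def formAt {F : Type*} [NormedAddCommGroup F] [NormedSpace ℝ F] {k : ℕ} (α : Form n M F k)
    (x : M) : Coord n [⋀^Fin k]→L[ℝ] F := α x

/-- The change of charts. -/
def chartChange (x₀ x₁ : M) (y : Coord n) : Coord n :=
  extChartAt (𝓡 (2 * n)) x₁ ((extChartAt (𝓡 (2 * n)) x₀).symm y)

theorem chartForm_eq {F : Type*} [NormedAddCommGroup F] [NormedSpace ℝ F] {k : ℕ}
    (α : Form n M F k) (x₀ : M) (y : Coord n) : chartForm α x₀ y =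
      (formAt α ((extChartAt (𝓡 (2 * n)) x₀).symm y)).compContinuousLinearMap
        (chartSymmDeriv x₀ y) := rfl

theorem chartChange_mem {x₀ x₁ : M} {y : Coord n}
    (hy1 : (extChartAt (𝓡 (2 * n)) x₀).symm y ∈ (extChartAt (𝓡 (2 * n)) x₁).source) :
    chartChange x₀ x₁ y ∈ (extChartAt (𝓡 (2 * n)) x₁).target :=
  (extChartAt (𝓡 (2 * n)) x₁).map_source hy1

theorem extChartAt_symm_chartChange {x₀ x₁ : M} {y : Coord n}
    (hy1 : (extChartAt (𝓡 (2 * n)) x₀).symm y ∈ (extChartAt (𝓡 (2 * n)) x₁).source) :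
    (extChartAt (𝓡 (2 * n)) x₁).symm (chartChange x₀ x₁ y) =
      (extChartAt (𝓡 (2 * n)) x₀).symm y :=
  (extChartAt (𝓡 (2 * n)) x₁).left_inv hy1

theorem eventually_mem_overlap {x₀ x₁ : M} {y : Coord n}
    (hy : y ∈ (extChartAt (𝓡 (2 * n)) x₀).target)
    (hy1 : (extChartAt (𝓡 (2 * n)) x₀).symm y ∈ (extChartAt (𝓡 (2 * n)) x₁).source) :
    ∀ᶠ z in 𝓝 y, z ∈ (extChartAt (𝓡 (2 * n)) x₀).target ∧
      (extChartAt (𝓡 (2 * n)) x₀).symm z ∈ (extChartAt (𝓡 (2 * n)) x₁).source :=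
  ((isOpen_extChartAt_target x₀).mem_nhds hy |> Filter.eventually_mem_set.2).and
    ((continuousAt_extChartAt_symm'' hy).eventually
      ((isOpen_extChartAt_source x₁).mem_nhds hy1))

theorem IsSmoothForm.contDiffAt {F : Type*} [NormedAddCommGroup F] [NormedSpace ℝ F]
    {k : ℕ} {α : Form n M F k} (hα : IsSmoothForm α) {x₀ : M} {y : Coord n}
    (hy : y ∈ (extChartAt (𝓡 (2 * n)) x₀).target) : ContDiffAt ℝ ∞ (chartForm α x₀) y :=
  (hα x₀).contDiffAt ((isOpen_extChartAt_target x₀).mem_nhds hy)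

variable [IsManifold (𝓡 (2 * n)) ∞ M]

theorem chartDeriv_comp_chartSymmDeriv {x₀ : M} {y : Coord n}
    (hy : y ∈ (extChartAt (𝓡 (2 * n)) x₀).target) :
    (chartDeriv x₀ ((extChartAt (𝓡 (2 * n)) x₀).symm y)) ∘L chartSymmDeriv x₀ y =
      ContinuousLinearMap.id ℝ (Coord n) := by
  have : IsManifold (𝓡 (2 * n)) 1 M := .of_le (n := ∞) (by simp)
  have h := mfderiv_extChartAt_comp_mfderivWithin_extChartAt_symm hy
  rw [ModelWithCorners.range_eq_univ, mfderivWithin_univ] at h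
  exact h

theorem chartDeriv_self (x : M) : chartDeriv x x = ContinuousLinearMap.id ℝ (Coord n) := by
  have : IsManifold (𝓡 (2 * n)) 1 M := .of_le (n := ∞) (by simp)
  exact mfderiv_extChartAt_self (I := 𝓡 (2 * n)) (x := x)

theorem chartSymmDeriv_self (x : M) :
    chartSymmDeriv x (extChartAt (𝓡 (2 * n)) x x) = ContinuousLinearMap.id ℝ (Coord n) := by
  have : IsManifold (𝓡 (2 * n)) 1 M := .of_le (n := ∞) (by simp)
  have h := mfderivWithin_range_extChartAt_symm (I := 𝓡 (2 * n)) (x := x)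
  rw [ModelWithCorners.range_eq_univ, mfderivWithin_univ] at h
  exact h

/-- The derivative of an inverse chart as an equivalence. -/
def chartSymmDerivEquiv {x₀ : M} {y : Coord n} (hy : y ∈ (extChartAt (𝓡 (2 * n)) x₀).target) :
    Coord n ≃ₗ[ℝ] Coord n :=
  LinearEquiv.ofInjectiveEndo (chartSymmDeriv x₀ y : Coord n →ₗ[ℝ] Coord n) fun v w h => by
    have := chartDeriv_comp_chartSymmDeriv hy
    have h' := congrArg (chartDeriv x₀ ((extChartAt (𝓡 (2 * n)) x₀).symm y)) h
    have e := fun v => DFunLike.congr_fun this v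
    simp only [ContinuousLinearMap.comp_apply, ContinuousLinearMap.id_apply] at e
    exact ((e v).symm.trans h').trans (e w)

theorem contDiffAt_chartChange {x₀ x₁ : M} {y : Coord n}
    (hy : y ∈ (extChartAt (𝓡 (2 * n)) x₀).target)
    (hy1 : (extChartAt (𝓡 (2 * n)) x₀).symm y ∈ (extChartAt (𝓡 (2 * n)) x₁).source) :
    ContDiffAt ℝ ∞ (chartChange x₀ x₁) y := by
  have h := contDiffWithinAt_ext_coord_change (I := 𝓡 (2 * n)) (n := ∞) x₁ x₀
    (y := y) (by rw [ext_coord_change_source]; simp_all)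
  rwa [ModelWithCorners.range_eq_univ, contDiffWithinAt_univ] at h

theorem chartSymmDeriv_chartChange {x₀ x₁ : M} {y : Coord n}
    (hy : y ∈ (extChartAt (𝓡 (2 * n)) x₀).target)
    (hy1 : (extChartAt (𝓡 (2 * n)) x₀).symm y ∈ (extChartAt (𝓡 (2 * n)) x₁).source) :
    chartSymmDeriv x₀ y =
      (chartSymmDeriv x₁ (chartChange x₀ x₁ y)) ∘L (fderiv ℝ (chartChange x₀ x₁) y) := by
  have : IsManifold (𝓡 (2 * n)) 1 M := .of_le (n := ∞) (by simp)
  have h1 : (extChartAt (𝓡 (2 * n)) x₀).symm =ᶠ[𝓝 y]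
      (extChartAt (𝓡 (2 * n)) x₁).symm ∘ chartChange x₀ x₁ := by
    filter_upwards [eventually_mem_overlap hy hy1] with z hz
    exact (extChartAt_symm_chartChange hz.2).symm
  have h2 : MDifferentiableAt 𝓘(ℝ, Coord n) (𝓡 (2 * n)) (extChartAt (𝓡 (2 * n)) x₁).symm
      (chartChange x₀ x₁ y) := by
    have := mdifferentiableWithinAt_extChartAt_symm (I := 𝓡 (2 * n)) (chartChange_mem hy1)
    rwa [ModelWithCorners.range_eq_univ, mdifferentiableWithinAt_univ] at this
  have h3 : MDifferentiableAt 𝓘(ℝ, Coord n) 𝓘(ℝ, Coord n) (chartChange x₀ x₁) y :=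
    ((contDiffAt_chartChange hy hy1).differentiableAt (by simp)).mdifferentiableAt
  have h4 := h1.mfderiv_eq (I := 𝓘(ℝ, Coord n)) (I' := 𝓡 (2 * n))
  have h5 := mfderiv_comp y h2 h3
  rw [mfderiv_eq_fderiv] at h5
  exact h4.trans h5

variable {F : Type*} [NormedAddCommGroup F] [NormedSpace ℝ F] {k : ℕ}

theorem chartForm_chartChange (α : Form n M F k) {x₀ x₁ : M} {y : Coord n}
    (hy : y ∈ (extChartAt (𝓡 (2 * n)) x₀).target)
    (hy1 : (extChartAt (𝓡 (2 * n)) x₀).symm y ∈ (extChartAt (𝓡 (2 * n)) x₁).source) :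
    chartForm α x₀ y = (chartForm α x₁ (chartChange x₀ x₁ y)).compContinuousLinearMap
      (fderiv ℝ (chartChange x₀ x₁) y) := by
  rw [chartForm_eq, chartForm_eq, extChartAt_symm_chartChange hy1, chartSymmDeriv_chartChange hy hy1]
  rfl

theorem formAt_extD (α : Form n M F k) (x : M) :
    formAt (extD α) x = extDeriv (chartForm α x) (extChartAt (𝓡 (2 * n)) x x) := by
  have h : formAt (extD α) x = (extDeriv (chartForm α x)
    (extChartAt (𝓡 (2 * n)) x x)).compContinuousLinearMap (chartDeriv x x) := rfl
  rw [h, chartDeriv_self]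
  rfl

theorem chartForm_self (α : Form n M F k) (x : M) :
    chartForm α x (extChartAt (𝓡 (2 * n)) x x) = formAt α x := by
  rw [chartForm_eq, chartSymmDeriv_self, extChartAt_to_inv]
  rfl

/-- `extD` uses at each point the chart centred there. That a single chart may be used throughout
its domain is naturality of the exterior derivative under the change of charts. -/
theorem chartForm_extD {α : Form n M F k} (hα : IsSmoothForm α) {x₀ : M} {y : Coord n}
    (hy : y ∈ (extChartAt (𝓡 (2 * n)) x₀).target) :
    chartForm (extD α) x₀ y = extDeriv (chartForm α x₀) y := by
  set x := (extChartAt (𝓡 (2 * n)) x₀).symm y with hx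
  have hy1 : (extChartAt (𝓡 (2 * n)) x₀).symm y ∈ (extChartAt (𝓡 (2 * n)) x).source :=
    mem_extChartAt_source _
  have hc : extChartAt (𝓡 (2 * n)) x x = chartChange x₀ x y := rfl
  rw [chartForm_chartChange _ hy hy1, ← hc, chartForm_self, formAt_extD, hc,
    ← extDeriv_pullback (r := ∞) ((hα.contDiffAt (chartChange_mem hy1)).differentiableAt (by simp))
      (contDiffAt_chartChange hy hy1)
      (by rw [minSmoothness_of_isRCLikeNormedField]; exact WithTop.coe_le_coe.2 (le_top : (2 : ℕ∞) ≤ ⊤))]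
  refine Filter.EventuallyEq.extDeriv_eq ?_
  filter_upwards [eventually_mem_overlap hy hy1] with z hz
  exact (chartForm_chartChange α hz.1 hz.2).symm

theorem IsSmoothForm.extD {α : Form n M F k} (hα : IsSmoothForm α) :
    IsSmoothForm (extD α) := by
  intro x₀
  have h : ContDiffOn ℝ ∞ (extDeriv (chartForm α x₀)) (extChartAt (𝓡 (2 * n)) x₀).target :=
    (ContinuousAlternatingMap.alternatizeUncurryFinCLM ℝ (Coord n) F).contDiff.comp_contDiffOn
      ((hα x₀).fderiv_of_isOpen (isOpen_extChartAt_target x₀) (by simp))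
  exact h.congr fun y hy => chartForm_extD hα hy

end Charts

/-! ### Smoothness of the Hodge star -/

section Evaluations

variable {E' E F : Type*} [NormedAddCommGroup E'] [NormedSpace ℝ E'] [NormedAddCommGroup E]
  [NormedSpace ℝ E] [NormedAddCommGroup F] [NormedSpace ℝ F]

theorem contDiffOn_eval {l : ℕ} {r : WithTop ℕ∞} {s : Set E'}
    {T : E' → E [⋀^Fin l]→L[ℝ] F} (hT : ContDiffOn ℝ r T s) (v : Fin l → E) :
    ContDiffOn ℝ r (fun y => T y v) s :=
  (ContinuousAlternatingMap.apply ℝ E F v).contDiff.comp_contDiffOn hT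

variable [FiniteDimensional ℝ E]

/-- Evaluation on tuples of basis vectors is an injective linear map, so it has a linear left
inverse, which is continuous in finite dimension. -/
theorem contDiffOn_alternating [FiniteDimensional ℝ F] {l : ℕ} {r : WithTop ℕ∞} {s : Set E'}
    {T : E' → E [⋀^Fin l]→L[ℝ] F} (hT : ∀ v, ContDiffOn ℝ r (fun y => T y v) s) :
    ContDiffOn ℝ r T s := by
  let e := Module.finBasis ℝ E
  let Φ : (E [⋀^Fin l]→L[ℝ] F) →ₗ[ℝ] ((Fin l → Fin (Module.finrank ℝ E)) → F) :=
    { toFun := fun b I => b (e ∘ I), map_add' := fun _ _ => rfl, map_smul' := fun _ _ => rfl }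
  have hΦ : Function.Injective Φ := by
    intro a b hab
    have h := Module.Basis.ext_multilinear (fun _ => e)
      (f := a.toAlternatingMap.toMultilinearMap) (g := b.toAlternatingMap.toMultilinearMap)
      (fun I => congrFun hab I)
    ext v
    exact congrArg (fun f : MultilinearMap ℝ (fun _ : Fin l => E) F => f v) h
  obtain ⟨Ψ, hΨ⟩ := Φ.exists_leftInverse_of_injective (LinearMap.ker_eq_bot.2 hΦ)
  have h : T = fun y => LinearMap.toContinuousLinearMap Ψ (Φ (T y)) := by
    ext1 y
    exact (DFunLike.congr_fun hΨ (T y)).symm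
  rw [h]
  exact (LinearMap.toContinuousLinearMap Ψ).contDiff.comp_contDiffOn
    (contDiffOn_pi.2 fun I => hT _)

theorem contDiffOn_det {m : ℕ} {r : WithTop ℕ∞} {s : Set E'} {A : E' → Matrix (Fin m) (Fin m) ℝ}
    (hA : ∀ i j, ContDiffOn ℝ r (fun y => A y i j) s) : ContDiffOn ℝ r (fun y => (A y).det) s := by
  simp only [Matrix.det_apply, Units.smul_def, zsmul_eq_mul]
  exact ContDiffOn.sum fun σ _ => contDiffOn_const.mul (contDiffOn_prod fun i _ => hA _ _)

theorem contDiffOn_inv_apply {m : ℕ} {r : WithTop ℕ∞} {s : Set E'}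
    {A : E' → Matrix (Fin m) (Fin m) ℝ} (hA : ∀ i j, ContDiffOn ℝ r (fun y => A y i j) s)
    (hdet : ∀ y ∈ s, (A y).det ≠ 0) (i j : Fin m) :
    ContDiffOn ℝ r (fun y => (A y)⁻¹ i j) s := by
  simp only [Matrix.inv_def, Matrix.smul_apply, smul_eq_mul, Ring.inverse_eq_inv',
    Matrix.adjugate_apply]
  refine ((contDiffOn_det hA).inv hdet).mul (contDiffOn_det fun a b => ?_)
  by_cases h : a = j
  · subst h
    simp only [Matrix.updateRow_self]
    exact contDiffOn_const
  · simp only [Matrix.updateRow_ne h]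
    exact hA a b

end Evaluations

/-! ### Metric, volume form and Hodge star in charts. -/

section Metrics

open Topology

variable {n : ℕ} {M : Type*} [TopologicalSpace M] [ChartedSpace (Coord n) M]

theorem IsSmoothForm.of_apply {F : Type*} [NormedAddCommGroup F] [NormedSpace ℝ F]
    [FiniteDimensional ℝ F] {k : ℕ} {α : Form n M F k}
    (h : ∀ x₀ v, ContDiffOn ℝ ∞ (fun y => chartForm α x₀ y v) (extChartAt (𝓡 (2 * n)) x₀).target) :
    IsSmoothForm α := fun x₀ => contDiffOn_alternating (h x₀)

variable [IsManifold (𝓡 (2 * n)) ∞ M] {J : AlmostComplexStructure n M} (g : HermitianMetric J)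

/-- The metric at a point, with the tangent space identified with the coordinate space. -/
def metricAt (x : M) : Coord n →L[ℝ] Coord n →L[ℝ] ℝ := g.inner x

/-- The almost complex structure at a point, with the tangent space identified with the coordinate
space. -/
def structureAt (J : AlmostComplexStructure n M) (x : M) : Coord n →L[ℝ] Coord n := J.toFun x

theorem isHermitian_metricAt (x : M) : IsHermitian (metricAt g x) (structureAt J x) where
  symm := g.symm x
  pos := g.pos x
  isometry := g.isometry x
  sq_eq_neg := J.sq_eq_neg x

theorem formAt_fundamentalForm (x : M) (v w : Coord n) :
    formAt g.fundamentalForm x ![v, w] = metricAt g x (structureAt J x v) w := rfl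

/-- The volume form `ωⁿ / n!`. -/
def volForm : Form n M ℝ (2 * n) := fun x => wedgePowDivFactorial n (g.fundamentalForm x)

theorem formAt_volForm (x : M) :
    formAt (volForm g) x = wedgePowDivFactorial n (formAt g.fundamentalForm x) := rfl

/-- The standard basis of the coordinate space. -/
def stdBasis (n : ℕ) : Module.Basis (Fin (2 * n)) ℝ (Coord n) :=
  (EuclideanSpace.basisFun (Fin (2 * n)) ℝ).toBasis

theorem coe_stdBasis : ⇑(stdBasis n) = fun i => (EuclideanSpace.single i (1 : ℝ) : Coord n) := by
  ext1 i
  simp [stdBasis]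

theorem formAt_star {k l : ℕ} (h : k + l = 2 * n) (β : Form n M ℂ k) (x : M) :
    formAt (g.star h β) x =
      hodgeStar h (metricAt g x) (formAt (volForm g) x) (stdBasis n) (formAt β x) := by
  rw [coe_stdBasis]
  rfl

theorem exists_unitary (x : M) : ∃ u : Fin (2 * n) → Coord n,
    IsUnitaryFrame (metricAt g x) (structureAt J x) u :=
  exists_isUnitaryFrame (isHermitian_metricAt g x) (by simp)

theorem volForm_unitary {x : M} {u : Fin (2 * n) → Coord n}
    (hu : IsUnitaryFrame (metricAt g x) (structureAt J x) u) :
    formAt (volForm g) x u = unitVolume n :=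
  wedgePowDivFactorial_unitary hu (isHermitian_metricAt g x) _ (formAt_fundamentalForm g x)

/-- A top-degree form vanishing on one basis is zero, but the volume form is nonzero on a unitary
frame. -/
theorem volForm_basis_ne_zero (x : M) (e : Module.Basis (Fin (2 * n)) ℝ (Coord n)) :
    formAt (volForm g) x e ≠ 0 := by
  obtain ⟨u, hu⟩ := exists_unitary g x
  have h := volForm_unitary g hu
  intro h0
  have h1 := AlternatingMap.eq_smul_basis_det e (formAt (volForm g) x).toAlternatingMap
  have h2 : formAt (volForm g) x u = (formAt (volForm g) x).toAlternatingMap u := rfl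
  rw [h2, h1] at h
  have h3 : (formAt (volForm g) x).toAlternatingMap e = 0 := h0
  rw [h3] at h
  exact unitVolume_ne_zero n (by simpa using h.symm)

/-- The metric in a chart. -/
def chartMetric (x₀ : M) (y : Coord n) : Coord n →L[ℝ] Coord n →L[ℝ] ℝ :=
  (metricAt g ((extChartAt (𝓡 (2 * n)) x₀).symm y)).bilinearComp (chartSymmDeriv x₀ y)
    (chartSymmDeriv x₀ y)

/-- These are the coordinate vector fields: the tangent map of the inverse chart applied to a
constant field. -/
theorem contMDiffOn_chartSymmDeriv (x₀ : M) (v : Coord n) :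
    ContMDiffOn 𝓘(ℝ, Coord n) ((𝓡 (2 * n)).prod 𝓘(ℝ, Coord n)) ∞
      (fun y => Bundle.TotalSpace.mk' (Coord n) (E := fun x : M => TangentSpace (𝓡 (2 * n)) x)
        ((extChartAt (𝓡 (2 * n)) x₀).symm y) (chartSymmDeriv x₀ y v))
      (extChartAt (𝓡 (2 * n)) x₀).target := by
  have ho := isOpen_extChartAt_target (I := 𝓡 (2 * n)) x₀
  have h1 := (contMDiffOn_extChartAt_symm (I := 𝓡 (2 * n)) (n := ∞) x₀).contMDiffOn_tangentMapWithin
    (m := ∞) (by simp) ho.uniqueMDiffOn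
  have h2 : ContMDiff 𝓘(ℝ, Coord n) (𝓘(ℝ, Coord n).prod 𝓘(ℝ, Coord n)) ∞
      (fun y => Bundle.TotalSpace.mk' (Coord n)
        (E := fun x : Coord n => TangentSpace 𝓘(ℝ, Coord n) x) y v) :=
    contMDiff_vectorSpace_iff_contDiff.2 contDiff_const
  refine (h1.comp h2.contMDiffOn fun y hy => hy).congr fun y hy => ?_
  simp only [Function.comp_apply, tangentMapWithin]
  rw [mfderivWithin_of_isOpen ho hy]
  rfl

theorem contDiffOn_inner {x₀ : M}
    {V W : ∀ y : Coord n, TangentSpace (𝓡 (2 * n)) ((extChartAt (𝓡 (2 * n)) x₀).symm y)}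
    (hV : ContMDiffOn 𝓘(ℝ, Coord n) ((𝓡 (2 * n)).prod 𝓘(ℝ, Coord n)) ∞
      (fun y => Bundle.TotalSpace.mk' (Coord n) (E := fun x : M => TangentSpace (𝓡 (2 * n)) x)
        ((extChartAt (𝓡 (2 * n)) x₀).symm y) (V y)) (extChartAt (𝓡 (2 * n)) x₀).target)
    (hW : ContMDiffOn 𝓘(ℝ, Coord n) ((𝓡 (2 * n)).prod 𝓘(ℝ, Coord n)) ∞
      (fun y => Bundle.TotalSpace.mk' (Coord n) (E := fun x : M => TangentSpace (𝓡 (2 * n)) x)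
        ((extChartAt (𝓡 (2 * n)) x₀).symm y) (W y)) (extChartAt (𝓡 (2 * n)) x₀).target) :
    ContDiffOn ℝ ∞ (fun y => g.inner ((extChartAt (𝓡 (2 * n)) x₀).symm y) (V y) (W y))
      (extChartAt (𝓡 (2 * n)) x₀).target := by
  have hg : ContMDiffOn 𝓘(ℝ, Coord n)
      ((𝓡 (2 * n)).prod 𝓘(ℝ, Coord n →L[ℝ] Coord n →L[ℝ] ℝ)) ∞
      (fun y => Bundle.TotalSpace.mk' (Coord n →L[ℝ] Coord n →L[ℝ] ℝ)
        (E := fun x : M => TangentSpace (𝓡 (2 * n)) x →L[ℝ] TangentSpace (𝓡 (2 * n)) x →L[ℝ]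
          Bundle.Trivial M ℝ x)
        ((extChartAt (𝓡 (2 * n)) x₀).symm y) (g.inner ((extChartAt (𝓡 (2 * n)) x₀).symm y)))
      (extChartAt (𝓡 (2 * n)) x₀).target :=
    g.contMDiff.comp_contMDiffOn (contMDiffOn_extChartAt_symm (I := 𝓡 (2 * n)) (n := ∞) x₀)
  have h := ContMDiffOn.clm_bundle_apply₂ (E₁ := fun x : M => TangentSpace (𝓡 (2 * n)) x)
    (E₂ := fun x : M => TangentSpace (𝓡 (2 * n)) x) (E₃ := Bundle.Trivial M ℝ) (F₃ := ℝ)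
    (F₁ := Coord n) (F₂ := Coord n) hg hV hW
  exact fun y hy => contMDiffWithinAt_iff_contDiffWithinAt.1
    (Bundle.contMDiffWithinAt_totalSpace.1 (h y hy)).2

theorem contDiffOn_chartMetric (x₀ : M) (v w : Coord n) :
    ContDiffOn ℝ ∞ (fun y => chartMetric g x₀ y v w) (extChartAt (𝓡 (2 * n)) x₀).target :=
  contDiffOn_inner g (contMDiffOn_chartSymmDeriv x₀ v) (contMDiffOn_chartSymmDeriv x₀ w)

theorem isSmoothForm_fundamentalForm : IsSmoothForm g.fundamentalForm := by
  refine IsSmoothForm.of_apply fun x₀ v => ?_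
  have hJ : ContMDiffOn 𝓘(ℝ, Coord n) ((𝓡 (2 * n)).prod 𝓘(ℝ, Coord n →L[ℝ] Coord n)) ∞
      (fun y => Bundle.TotalSpace.mk' (Coord n →L[ℝ] Coord n)
        (E := fun x : M => TangentSpace (𝓡 (2 * n)) x →L[ℝ] TangentSpace (𝓡 (2 * n)) x)
        ((extChartAt (𝓡 (2 * n)) x₀).symm y) (J.toFun ((extChartAt (𝓡 (2 * n)) x₀).symm y)))
      (extChartAt (𝓡 (2 * n)) x₀).target :=
    J.smooth.comp_contMDiffOn (contMDiffOn_extChartAt_symm (I := 𝓡 (2 * n)) (n := ∞) x₀)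
  have h := ContMDiffOn.clm_bundle_apply (E₁ := fun x : M => TangentSpace (𝓡 (2 * n)) x)
    (E₂ := fun x : M => TangentSpace (𝓡 (2 * n)) x) (F₁ := Coord n) (F₂ := Coord n) hJ
    (contMDiffOn_chartSymmDeriv x₀ (v 0))
  exact contDiffOn_inner g h (contMDiffOn_chartSymmDeriv x₀ (v 1))

theorem isSmoothForm_volForm : IsSmoothForm (volForm g) := by
  refine IsSmoothForm.of_apply fun x₀ v => ?_
  have h : ∀ y, chartForm (volForm g) x₀ y v = (1 / ((2 : ℝ) ^ n * (n.factorial : ℝ))) *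
      ∑ σ : Equiv.Perm (Fin (2 * n)), ((Equiv.Perm.sign σ : ℤ) : ℝ) * ∏ i : Fin n,
        chartForm g.fundamentalForm x₀ y ![v (σ ⟨2 * i, by omega⟩), v (σ ⟨2 * i + 1, by omega⟩)] := by
    intro y
    rw [chartForm_eq, formAt_volForm, ContinuousAlternatingMap.compContinuousLinearMap_apply,
      wedgePowDivFactorial_apply]
    simp only [pfaffianTerm, Units.smul_def, zsmul_eq_mul]
    refine congrArg _ (Finset.sum_congr rfl fun σ _ => congrArg _ (Finset.prod_congr rfl fun i _ => ?_))
    rw [chartForm_eq, ContinuousAlternatingMap.compContinuousLinearMap_apply]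
    congr 1
    ext1 a
    fin_cases a <;> rfl
  simp only [h]
  exact contDiffOn_const.mul (ContDiffOn.sum fun σ _ => contDiffOn_const.mul
    (contDiffOn_prod fun i _ => contDiffOn_eval (isSmoothForm_fundamentalForm g x₀) _))

/-- Pulling back evaluates everything on the images of the standard basis under the derivative of
the inverse chart. These form another basis of the tangent space, and the star does not depend on
the basis. -/
theorem chartForm_star {k l : ℕ} (h : k + l = 2 * n) (β : Form n M ℂ k) {x₀ : M} {y : Coord n}
    (hy : y ∈ (extChartAt (𝓡 (2 * n)) x₀).target) :
    chartForm (g.star h β) x₀ y = hodgeStar h (chartMetric g x₀ y) (chartForm (volForm g) x₀ y)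
      (stdBasis n) (chartForm β x₀ y) := by
  obtain ⟨u, hu⟩ := exists_unitary g ((extChartAt (𝓡 (2 * n)) x₀).symm y)
  rw [chartForm_eq, formAt_star, hodgeStar_basis h hu.orthonormal _ _
    ((stdBasis n).map (chartSymmDerivEquiv hy))]
  ext v
  rw [ContinuousAlternatingMap.compContinuousLinearMap_apply]
  simp only [hodgeStar, ContinuousAlternatingMap.smul_apply, ContinuousAlternatingMap.sum_apply]
  have happ : ∀ j : Fin k → Fin (2 * n),
      (fun a => Fin.append ((chartSymmDeriv x₀ y ∘ stdBasis n) ∘ j) (chartSymmDeriv x₀ y ∘ v)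
        (Fin.cast h.symm a)) =
      chartSymmDeriv x₀ y ∘ fun a => Fin.append (stdBasis n ∘ j) v (Fin.cast h.symm a) := by
    intro j
    ext1 a
    simp only [Function.comp_apply]
    refine Fin.addCases (fun b => ?_) (fun b => ?_) (Fin.cast h.symm a) <;> simp
  have he : ⇑((stdBasis n).map (chartSymmDerivEquiv hy)) = chartSymmDeriv x₀ y ∘ stdBasis n := by
    ext1 i
    rw [Module.Basis.map_apply]
    rfl
  rw [he]
  refine congrArg _ (Finset.sum_congr rfl fun i _ => Finset.sum_congr rfl fun j _ => ?_)
  refine congrArg₂ _ rfl ?_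
  change formAt (volForm g) _ (fun a => Fin.append ((chartSymmDeriv x₀ y ∘ stdBasis n) ∘ j)
    (chartSymmDeriv x₀ y ∘ v) (Fin.cast h.symm a)) • formAt β _ _ = _
  rw [happ]
  rfl

theorem exists_frame_chart {x₀ : M} {y : Coord n}
    (hy : y ∈ (extChartAt (𝓡 (2 * n)) x₀).target) : ∃ u : Fin (2 * n) → Coord n,
    IsOrthonormalFrame (chartMetric g x₀ y) u ∧ chartForm (volForm g) x₀ y u = unitVolume n := by
  obtain ⟨u, hu⟩ := exists_unitary g ((extChartAt (𝓡 (2 * n)) x₀).symm y)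
  have hs : ∀ v, chartSymmDeriv x₀ y ((chartSymmDerivEquiv hy).symm v) = v :=
    (chartSymmDerivEquiv hy).apply_symm_apply
  refine ⟨fun i => (chartSymmDerivEquiv hy).symm (u i), fun a b => ?_, ?_⟩
  · rw [← hu.orthonormal a b]
    simp only [chartMetric, ContinuousLinearMap.bilinearComp_apply, hs]
  · rw [← volForm_unitary g hu, chartForm_eq,
      ContinuousAlternatingMap.compContinuousLinearMap_apply]
    congr 1
    ext1 i
    exact hs _

theorem IsSmoothForm.star {k l : ℕ} (h : k + l = 2 * n) {β : Form n M ℂ k}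
    (hβ : IsSmoothForm β) : IsSmoothForm (g.star h β) := by
  refine IsSmoothForm.of_apply fun x₀ v => ?_
  have hs := fun y hy => congrArg (fun T => T v) (chartForm_star g h β (x₀ := x₀) (y := y) hy)
  refine ContDiffOn.congr ?_ hs
  simp only [hodgeStar, ContinuousAlternatingMap.smul_apply, ContinuousAlternatingMap.sum_apply]
  refine ContDiffOn.const_smul _ (ContDiffOn.sum fun i _ => ContDiffOn.sum fun j _ =>
    ContDiffOn.fun_smul (f := fun y => ∏ a, _) (contDiffOn_prod fun a _ => ?_)
      (ContDiffOn.fun_smul (contDiffOn_eval (isSmoothForm_volForm g x₀) _)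
        (contDiffOn_eval (hβ x₀) _)))
  refine contDiffOn_inv_apply (fun s t => contDiffOn_chartMetric g x₀ _ _) (fun y hy => ?_) _ _
  obtain ⟨u, hu, -⟩ := exists_frame_chart g hy
  exact gram_det_ne_zero hu _

end Metrics

/-! ### Closed `(p, 0)`-forms of almost Kähler metrics are harmonic -/

section ClosedForms

open Topology

variable {n : ℕ} {M : Type*} [TopologicalSpace M] [ChartedSpace (Coord n) M]
  [IsManifold (𝓡 (2 * n)) ∞ M] {J : AlmostComplexStructure n M} (g : HermitianMetric J)

theorem star_zero {k l : ℕ} (h : k + l = 2 * n) : g.star h (0 : Form n M ℂ k) = 0 :=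
  funext fun x => (formAt_star g h 0 x).trans (hodgeStar_zero h _ _ _)

theorem extD_zero {F : Type*} [NormedAddCommGroup F] [NormedSpace ℝ F] {k : ℕ} :
    extD (0 : Form n M F k) = 0 := by
  funext x
  refine (formAt_extD 0 x).trans ?_
  -- The zero form is written as `0 • 0` so that homogeneity of `extDeriv` applies.
  have : chartForm (0 : Form n M F k) x = 0 := rfl
  rw [this, ← zero_smul ℝ (0 : Coord n → Coord n [⋀^Fin k]→L[ℝ] F), extDeriv_smul, zero_smul]
  rfl

theorem codiff_zero {k : ℕ} : g.codiff (0 : Form n M ℂ (k + 1)) = 0 := by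
  unfold HermitianMetric.codiff
  split_ifs
  · rw [star_zero, extD_zero, star_zero, neg_zero]
  · rfl

theorem extDeriv_chartForm_eq_zero {F : Type*} [NormedAddCommGroup F] [NormedSpace ℝ F] {k : ℕ}
    {α : Form n M F k} (h : extD α = 0) (x : M) :
    extDeriv (chartForm α x) (extChartAt (𝓡 (2 * n)) x x) = 0 := by
  rw [← formAt_extD, h]
  rfl

/-- In a chart `⋆α` is a constant multiple of `α ∧ ω^(n-p)`, a product of closed forms. The almost
Kähler condition enters the argument here. -/
theorem extD_star_eq_zero (hg : g.IsAlmostKahler) {p l : ℕ} (hp : p ≤ n) (hl : p + l = 2 * n)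
    {α : Form n M ℂ p} (hα : IsSmoothForm α) (hJ : ∀ x, α x ∈ typeForms (J.toFun x) p 0)
    (hd : extD α = 0) : extD (g.star hl α) = 0 := by
  funext x
  refine (formAt_extD _ x).trans ?_
  have hx : extChartAt (𝓡 (2 * n)) x x ∈ (extChartAt (𝓡 (2 * n)) x).target :=
    mem_extChartAt_target x
  refine extDeriv_wedgePairs_eq_zero (C := starConst n p hp) hp hl
    ((hα.contDiffAt hx).differentiableAt (by simp))
    (((isSmoothForm_fundamentalForm g).contDiffAt hx).differentiableAt (by simp))
    (((hα.star g hl).contDiffAt hx).differentiableAt (by simp))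
    (extDeriv_chartForm_eq_zero hd x) (extDeriv_chartForm_eq_zero hg x)
    (Filter.Eventually.of_forall fun y v => ?_)
  have h := hodgeStar_of_mem_typeForms (by simp)
    (isHermitian_metricAt g ((extChartAt (𝓡 (2 * n)) x).symm y)) hp hl _
    (formAt_fundamentalForm g _) (stdBasis n) (formAt α _) (hJ _) (chartSymmDeriv x y ∘ v)
  rw [chartForm_eq, ContinuousAlternatingMap.compContinuousLinearMap_apply, formAt_star]
  refine h.trans ?_
  simp only [wedgePairs]
  refine congrArg _ (Finset.sum_congr rfl fun τ _ => congrArg _ ?_)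
  refine congrArg₂ _ rfl (Finset.prod_congr rfl fun i _ => ?_)
  rw [chartForm_eq, ContinuousAlternatingMap.compContinuousLinearMap_apply]
  refine congrArg (fun w => ((formAt g.fundamentalForm _ w : ℝ) : ℂ)) ?_
  ext1 a
  fin_cases a <;> rfl

theorem laplacian_eq_zero (hg : g.IsAlmostKahler) {p : ℕ} (hp : p ≤ n)
    {α : Form n M ℂ p} (hα : IsSmoothForm α) (hJ : ∀ x, α x ∈ typeForms (J.toFun x) p 0)
    (hd : extD α = 0) : g.laplacian α = 0 := by
  cases p with
  | zero =>
    change g.codiff (extD α) = 0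
    rw [hd, codiff_zero]
  | succ p =>
    change extD (g.codiff α) + g.codiff (extD α) = 0
    have hc : g.codiff α = 0 := by
      unfold HermitianMetric.codiff
      split_ifs with h
      · rw [extD_star_eq_zero g hg hp _ hα hJ hd, star_zero, neg_zero]
      · rfl
    rw [hd, codiff_zero, hc, extD_zero, add_zero]

end ClosedForms

/-! ### Integration on a compact manifold -/

section Integration

open Topology MeasureTheory

theorem map_comp_eq_det_mul {V : Type*} [AddCommGroup V] [Module ℝ V] {m : ℕ}
    (e : Module.Basis (Fin m) ℝ V) (τ : V [⋀^Fin m]→ₗ[ℝ] ℝ) (A : V →ₗ[ℝ] V) (v : Fin m → V) :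
    τ (A ∘ v) = LinearMap.det A * τ v := by
  rw [AlternatingMap.eq_smul_basis_det e τ]
  simp only [AlternatingMap.smul_apply, smul_eq_mul, Module.Basis.det_comp]
  ring

variable {n : ℕ} {M : Type*} [TopologicalSpace M] [ChartedSpace (Coord n) M]

theorem isOpen_overlap (x₀ x₁ : M) : IsOpen ((extChartAt (𝓡 (2 * n)) x₀).target ∩
    (extChartAt (𝓡 (2 * n)) x₀).symm ⁻¹' (extChartAt (𝓡 (2 * n)) x₁).source) :=
  (continuousOn_extChartAt_symm x₀).isOpen_inter_preimage (isOpen_extChartAt_target x₀)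
    (isOpen_extChartAt_source x₁)

theorem injOn_chartChange (x₀ x₁ : M) : Set.InjOn (chartChange x₀ x₁)
    ((extChartAt (𝓡 (2 * n)) x₀).target ∩
      (extChartAt (𝓡 (2 * n)) x₀).symm ⁻¹' (extChartAt (𝓡 (2 * n)) x₁).source) := by
  intro y hy z hz h
  exact (extChartAt (𝓡 (2 * n)) x₀).symm.injOn hy.1 hz.1
    ((extChartAt (𝓡 (2 * n)) x₁).injOn hy.2 hz.2 h)

theorem image_chartChange (x₀ x₁ : M) : chartChange x₀ x₁ ''
    ((extChartAt (𝓡 (2 * n)) x₀).target ∩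
      (extChartAt (𝓡 (2 * n)) x₀).symm ⁻¹' (extChartAt (𝓡 (2 * n)) x₁).source) =
    (extChartAt (𝓡 (2 * n)) x₁).target ∩
      (extChartAt (𝓡 (2 * n)) x₁).symm ⁻¹' (extChartAt (𝓡 (2 * n)) x₀).source := by
  ext z
  constructor
  · rintro ⟨y, ⟨hy, hy1⟩, rfl⟩
    refine ⟨chartChange_mem hy1, ?_⟩
    rw [Set.mem_preimage, extChartAt_symm_chartChange hy1]
    exact (extChartAt (𝓡 (2 * n)) x₀).map_target hy
  · rintro ⟨hz, hz0⟩
    have h := extChartAt_symm_chartChange (x₀ := x₁) (x₁ := x₀) hz0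
    refine ⟨chartChange x₁ x₀ z, ⟨chartChange_mem hz0, ?_⟩, ?_⟩
    · rw [Set.mem_preimage, h]
      exact (extChartAt (𝓡 (2 * n)) x₁).map_target hz
    · unfold chartChange at h ⊢
      rw [h]
      exact (extChartAt (𝓡 (2 * n)) x₁).right_inv hz

/-- The image of a compact subset of a chart domain in the chart. -/
theorem isCompact_image_chart {x₀ : M} {K : Set M} (hK : IsCompact K)
    (hKs : K ⊆ (extChartAt (𝓡 (2 * n)) x₀).source) : IsCompact (extChartAt (𝓡 (2 * n)) x₀ '' K) :=
  hK.image_of_continuousOn ((continuousOn_extChartAt x₀).mono hKs)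

theorem notMem_of_notMem_image {x₀ : M} {K : Set M} {y : Coord n}
    (hy : y ∈ (extChartAt (𝓡 (2 * n)) x₀).target) (hyK : y ∉ extChartAt (𝓡 (2 * n)) x₀ '' K) :
    (extChartAt (𝓡 (2 * n)) x₀).symm y ∉ K :=
  fun h => hyK ⟨_, h, (extChartAt (𝓡 (2 * n)) x₀).right_inv hy⟩

theorem mul_eq_zero_of_notMem_tsupport {ι : Type*} (ρ : SmoothPartitionOfUnity ι (𝓡 (2 * n)) M)
    (i : ι) (f : M → ℝ) (m : M) (hm : m ∉ tsupport (ρ i)) : ρ i m * f m = 0 := by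
  rw [image_eq_zero_of_notMem_tsupport hm, zero_mul]

theorem sum_partition {ι : Type*} [Fintype ι] (ρ : SmoothPartitionOfUnity ι (𝓡 (2 * n)) M)
    (m : M) : ∑ i, ρ i m = 1 := by
  rw [← finsum_eq_sum_of_fintype]
  exact ρ.sum_eq_one (Set.mem_univ m)

variable [IsManifold (𝓡 (2 * n)) ∞ M] {J : AlmostComplexStructure n M} (g : HermitianMetric J)

/-- The density of the volume form in a chart. -/
def volDensity (x₀ : M) (y : Coord n) : ℝ := chartForm (volForm g) x₀ y (stdBasis n)

theorem volDensity_ne_zero {x₀ : M} {y : Coord n}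
    (hy : y ∈ (extChartAt (𝓡 (2 * n)) x₀).target) : volDensity g x₀ y ≠ 0 := by
  have h := volForm_basis_ne_zero g ((extChartAt (𝓡 (2 * n)) x₀).symm y)
    ((stdBasis n).map (chartSymmDerivEquiv hy))
  have he : ⇑((stdBasis n).map (chartSymmDerivEquiv hy)) = chartSymmDeriv x₀ y ∘ stdBasis n := by
    ext1 i
    rw [Module.Basis.map_apply]
    rfl
  rw [he] at h
  exact h

theorem continuousOn_volDensity (x₀ : M) :
    ContinuousOn (volDensity g x₀) (extChartAt (𝓡 (2 * n)) x₀).target :=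
  (contDiffOn_eval (isSmoothForm_volForm g x₀) _).continuousOn

theorem volDensity_chartChange {x₀ x₁ : M} {y : Coord n}
    (hy : y ∈ (extChartAt (𝓡 (2 * n)) x₀).target)
    (hy1 : (extChartAt (𝓡 (2 * n)) x₀).symm y ∈ (extChartAt (𝓡 (2 * n)) x₁).source) :
    volDensity g x₀ y = (fderiv ℝ (chartChange x₀ x₁) y).det *
      volDensity g x₁ (chartChange x₀ x₁ y) := by
  unfold volDensity
  rw [chartForm_chartChange _ hy hy1]
  exact map_comp_eq_det_mul (stdBasis n) (chartForm (volForm g) x₁ _).toAlternatingMap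
    (fderiv ℝ (chartChange x₀ x₁) y : Coord n →ₗ[ℝ] Coord n) _

/-- The integral of a function over a chart domain against the volume density. -/
def chartIntegral (x₀ : M) (f : M → ℝ) : ℝ :=
  ∫ y in (extChartAt (𝓡 (2 * n)) x₀).target,
    f ((extChartAt (𝓡 (2 * n)) x₀).symm y) * |volDensity g x₀ y|

theorem chartIntegral_eq_setIntegral_overlap (x₀ x₁ : M) (f : M → ℝ)
    (hf : ∀ m, m ∉ (extChartAt (𝓡 (2 * n)) x₁).source → f m = 0) :
    chartIntegral g x₀ f = ∫ y in (extChartAt (𝓡 (2 * n)) x₀).target ∩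
      (extChartAt (𝓡 (2 * n)) x₀).symm ⁻¹' (extChartAt (𝓡 (2 * n)) x₁).source,
      f ((extChartAt (𝓡 (2 * n)) x₀).symm y) * |volDensity g x₀ y| := by
  refine setIntegral_eq_of_subset_of_forall_sdiff_eq_zero
    (isOpen_extChartAt_target x₀).measurableSet Set.inter_subset_left fun y hy => ?_
  rw [hf _ fun h => hy.2 ⟨hy.1, h⟩, zero_mul]

/-- Change of variables: the absolute Jacobian of the transition map is the ratio of the absolute
volume densities, so no compatibility of orientations is required. -/
theorem chartIntegral_congr_chart (x₀ x₁ : M) (f : M → ℝ)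
    (hf0 : ∀ m, m ∉ (extChartAt (𝓡 (2 * n)) x₀).source → f m = 0)
    (hf1 : ∀ m, m ∉ (extChartAt (𝓡 (2 * n)) x₁).source → f m = 0) :
    chartIntegral g x₀ f = chartIntegral g x₁ f := by
  rw [chartIntegral_eq_setIntegral_overlap g x₀ x₁ f hf1,
    chartIntegral_eq_setIntegral_overlap g x₁ x₀ f hf0, ← image_chartChange x₀ x₁,
    integral_image_eq_integral_abs_det_fderiv_smul volume (isOpen_overlap x₀ x₁).measurableSet
      (f' := fderiv ℝ (chartChange x₀ x₁))
      (fun y hy => ((contDiffAt_chartChange hy.1 hy.2).differentiableAt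
        (by simp)).hasFDerivAt.hasFDerivWithinAt) (injOn_chartChange x₀ x₁)]
  refine setIntegral_congr_fun (isOpen_overlap x₀ x₁).measurableSet fun y hy => ?_
  simp only [smul_eq_mul]
  rw [volDensity_chartChange g hy.1 hy.2, abs_mul, extChartAt_symm_chartChange hy.2]
  ring

theorem integrableOn_chart {x₀ : M} {K : Set M} (hK : IsCompact K)
    (hKs : K ⊆ (extChartAt (𝓡 (2 * n)) x₀).source) {f : M → ℝ} (hf : Continuous f)
    (hfK : ∀ m ∉ K, f m = 0) :
    IntegrableOn (fun y => f ((extChartAt (𝓡 (2 * n)) x₀).symm y) * |volDensity g x₀ y|)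
      (extChartAt (𝓡 (2 * n)) x₀).target := by
  have hc : ContinuousOn (fun y => f ((extChartAt (𝓡 (2 * n)) x₀).symm y) * |volDensity g x₀ y|)
      (extChartAt (𝓡 (2 * n)) x₀).target :=
    (hf.comp_continuousOn (continuousOn_extChartAt_symm x₀)).mul
      (continuousOn_volDensity g x₀).abs
  have hsub : extChartAt (𝓡 (2 * n)) x₀ '' K ⊆ (extChartAt (𝓡 (2 * n)) x₀).target :=
    Set.image_subset_iff.2 fun m hm => (extChartAt (𝓡 (2 * n)) x₀).map_source (hKs hm)
  refine IntegrableOn.of_forall_sdiff_eq_zero ((hc.mono hsub).integrableOn_compact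
    (isCompact_image_chart hK hKs)) (isOpen_extChartAt_target x₀).measurableSet fun y hy => ?_
  rw [hfK _ (notMem_of_notMem_image hy.1 hy.2), zero_mul]

theorem integrableOn_partition [CompactSpace M] {ι : Type*}
    {ρ : SmoothPartitionOfUnity ι (𝓡 (2 * n)) M} {c : ι → M}
    (hρ : ∀ i, tsupport (ρ i) ⊆ (extChartAt (𝓡 (2 * n)) (c i)).source) (i : ι) {f : M → ℝ} (hf : Continuous f) :
    IntegrableOn (fun y => (ρ i ((extChartAt (𝓡 (2 * n)) (c i)).symm y) *
      f ((extChartAt (𝓡 (2 * n)) (c i)).symm y)) * |volDensity g (c i) y|)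
      (extChartAt (𝓡 (2 * n)) (c i)).target :=
  integrableOn_chart g (f := fun m => ρ i m * f m) (isClosed_tsupport (ρ i)).isCompact (hρ i)
    ((ρ i).contMDiff.continuous.mul hf) (mul_eq_zero_of_notMem_tsupport ρ i f)

variable {ι : Type*} [Fintype ι] (ρ : SmoothPartitionOfUnity ι (𝓡 (2 * n)) M) (c : ι → M)

/-- The integral of a function over a manifold, through a partition of unity subordinate to chart
domains. -/
def manifoldIntegral (f : M → ℝ) : ℝ := ∑ i, chartIntegral g (c i) fun m => ρ i m * f m

variable {ρ c}

theorem manifoldIntegral_const_mul (r : ℝ) (f : M → ℝ) :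
    manifoldIntegral g ρ c (fun m => r * f m) = r * manifoldIntegral g ρ c f := by
  simp only [manifoldIntegral, chartIntegral, Finset.mul_sum, ← integral_const_mul]
  refine Finset.sum_congr rfl fun i _ => ?_
  congr 1
  ext1 y
  ring

theorem manifoldIntegral_nonneg {f : M → ℝ} (hf : ∀ m, 0 ≤ f m) :
    0 ≤ manifoldIntegral g ρ c f :=
  Finset.sum_nonneg fun i _ => setIntegral_nonneg (isOpen_extChartAt_target _).measurableSet
    fun _ _ => mul_nonneg (mul_nonneg (ρ.nonneg i _) (hf _)) (abs_nonneg _)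

variable (hρ : ∀ i, tsupport (ρ i) ⊆ (extChartAt (𝓡 (2 * n)) (c i)).source)

include hρ in
theorem manifoldIntegral_eq_chartIntegral {x₀ : M} {K : Set M} (hK : IsCompact K)
    (hKs : K ⊆ (extChartAt (𝓡 (2 * n)) x₀).source) {f : M → ℝ} (hf : Continuous f)
    (hfK : ∀ m ∉ K, f m = 0) : manifoldIntegral g ρ c f = chartIntegral g x₀ f := by
  have h1 : ∀ i, chartIntegral g (c i) (fun m => ρ i m * f m) =
      chartIntegral g x₀ fun m => ρ i m * f m := fun i =>
    chartIntegral_congr_chart g _ _ _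
      (fun m hm => mul_eq_zero_of_notMem_tsupport ρ i f m fun h => hm (hρ i h))
      (fun m hm => by rw [hfK m fun h => hm (hKs h), mul_zero])
  rw [manifoldIntegral, Finset.sum_congr rfl fun i _ => h1 i]
  simp only [chartIntegral]
  rw [← integral_finsetSum _ fun i _ => integrableOn_chart g (f := fun m => ρ i m * f m) hK hKs
    ((ρ i).contMDiff.continuous.mul hf) fun m hm => by rw [hfK m hm, mul_zero]]
  congr 1
  ext1 y
  rw [← Finset.sum_mul, ← Finset.sum_mul, sum_partition, one_mul]

variable [CompactSpace M]

include hρ in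
theorem manifoldIntegral_add {f f' : M → ℝ} (hf : Continuous f) (hf' : Continuous f') :
    manifoldIntegral g ρ c (fun m => f m + f' m) =
      manifoldIntegral g ρ c f + manifoldIntegral g ρ c f' := by
  simp only [manifoldIntegral, chartIntegral, ← Finset.sum_add_distrib]
  refine Finset.sum_congr rfl fun i _ => ?_
  rw [← integral_add (integrableOn_partition g hρ i hf) (integrableOn_partition g hρ i hf')]
  simp only [mul_add, add_mul]

include hρ in
theorem manifoldIntegral_sum {κ : Type*} (s : Finset κ) {f : κ → M → ℝ}
    (hf : ∀ j, Continuous (f j)) : manifoldIntegral g ρ c (fun m => ∑ j ∈ s, f j m) =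
      ∑ j ∈ s, manifoldIntegral g ρ c (f j) := by
  classical
  induction s using Finset.induction_on with
  | empty => simp [manifoldIntegral, chartIntegral]
  | insert j s hj ih =>
    simp only [Finset.sum_insert hj]
    rw [manifoldIntegral_add g hρ (hf j) (continuous_finsetSum _ fun j _ => hf j), ih]

include hρ in
-- Some `ρ i` is nonzero at `m`. In that chart a nonnegative continuous integrand has zero integral,
-- hence vanishes almost everywhere and then everywhere on the open chart image; its other two
-- factors are nonzero at `m`.
theorem eq_zero_of_manifoldIntegral_eq_zero {f : M → ℝ} (hf : Continuous f) (h0 : ∀ m, 0 ≤ f m)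
    (h : manifoldIntegral g ρ c f = 0) (m : M) : f m = 0 := by
  have hnn : ∀ i y, 0 ≤ (ρ i ((extChartAt (𝓡 (2 * n)) (c i)).symm y) *
      f ((extChartAt (𝓡 (2 * n)) (c i)).symm y)) * |volDensity g (c i) y| := fun i y =>
    mul_nonneg (mul_nonneg (ρ.nonneg i _) (h0 _)) (abs_nonneg _)
  have h1 := (Finset.sum_eq_zero_iff_of_nonneg fun i _ => setIntegral_nonneg
    (isOpen_extChartAt_target _).measurableSet fun y _ => hnn i y).1 h
  obtain ⟨i, hi⟩ : ∃ i, ρ i m ≠ 0 := by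
    by_contra! hc
    have := sum_partition ρ m
    simp [hc] at this
  have hm : m ∈ (extChartAt (𝓡 (2 * n)) (c i)).source := hρ i (subset_tsupport _ hi)
  have h2 := (setIntegral_eq_zero_iff_of_nonneg_ae (Filter.Eventually.of_forall (hnn i))
    (integrableOn_partition g hρ i hf)).1 (h1 i (Finset.mem_univ i))
  have hc : ContinuousOn (fun y => (ρ i ((extChartAt (𝓡 (2 * n)) (c i)).symm y) *
      f ((extChartAt (𝓡 (2 * n)) (c i)).symm y)) * |volDensity g (c i) y|)
      (extChartAt (𝓡 (2 * n)) (c i)).target :=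
    (((ρ i).contMDiff.continuous.mul hf).comp_continuousOn
      (continuousOn_extChartAt_symm (c i))).mul (continuousOn_volDensity g (c i)).abs
  have h3 := Measure.eqOn_open_of_ae_eq h2 (isOpen_extChartAt_target _) hc continuousOn_const
  have hy := (extChartAt (𝓡 (2 * n)) (c i)).map_source hm
  have h4 := h3 hy
  simp only [Pi.zero_apply, mul_eq_zero, abs_eq_zero] at h4
  rw [(extChartAt (𝓡 (2 * n)) (c i)).left_inv hm] at h4
  rcases h4 with (h4 | h4) | h4
  · exact absurd h4 hi
  · exact h4
  · exact absurd h4 (volDensity_ne_zero g hy)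

end Integration

/-! ### The theorem of Stokes and the adjoint of the exterior derivative -/

section Adjoint

open Topology MeasureTheory

variable {n : ℕ} {M : Type*} [TopologicalSpace M] [ChartedSpace (Coord n) M]

/-- The product of a function and a form. -/
def smulForm {k : ℕ} (r : M → ℝ) (α : Form n M ℂ k) : Form n M ℂ k := fun m => r m • α m

theorem chartForm_smulForm {k : ℕ} (r : M → ℝ) (α : Form n M ℂ k) (x₀ : M) (y : Coord n) :
    chartForm (smulForm r α) x₀ y = r ((extChartAt (𝓡 (2 * n)) x₀).symm y) • chartForm α x₀ y := rfl

theorem formAt_smulForm {k : ℕ} (r : M → ℝ) (α : Form n M ℂ k) (m : M) :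
    formAt (smulForm r α) m = r m • formAt α m := rfl

theorem continuous_of_continuousOn_chart {f : M → ℝ}
    (h : ∀ x₀, ContinuousOn (fun y => f ((extChartAt (𝓡 (2 * n)) x₀).symm y))
      (extChartAt (𝓡 (2 * n)) x₀).target) : Continuous f := by
  rw [continuous_iff_continuousAt]
  intro x
  have h1 : ContinuousAt (fun m => f ((extChartAt (𝓡 (2 * n)) x).symm
      (extChartAt (𝓡 (2 * n)) x m))) x :=
    ContinuousAt.comp (g := fun y => f ((extChartAt (𝓡 (2 * n)) x).symm y))
      ((h x).continuousAt (extChartAt_target_mem_nhds x)) (continuousAt_extChartAt x)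
  refine h1.congr ?_
  filter_upwards [extChartAt_source_mem_nhds (I := 𝓡 (2 * n)) x] with m hm
  rw [(extChartAt (𝓡 (2 * n)) x).left_inv hm]

theorem pairing_sum_left {V : Type*} [AddCommGroup V] [Module ℝ V] [TopologicalSpace V]
    {k l m : ℕ} (h : k + l = m) {ι : Type*} (s : Finset ι) (a : ι → V [⋀^Fin k]→L[ℝ] ℂ)
    (b : V [⋀^Fin l]→L[ℝ] ℂ) (v : Fin m → V) :
    pairing h (∑ i ∈ s, a i) b v = ∑ i ∈ s, pairing h (a i) b v := by
  simp only [pairing_apply, ContinuousAlternatingMap.sum_apply, sum_inner, Finset.smul_sum]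
  exact Finset.sum_comm

variable [IsManifold (𝓡 (2 * n)) ∞ M] {J : AlmostComplexStructure n M} (g : HermitianMetric J)

theorem IsSmoothForm.smulForm {k : ℕ} {r : M → ℝ} (hr : ContMDiff (𝓡 (2 * n)) 𝓘(ℝ, ℝ) ∞ r)
    {α : Form n M ℂ k} (hα : IsSmoothForm α) : IsSmoothForm (smulForm r α) := fun x₀ =>
  (contMDiffOn_iff_contDiffOn.1 (hr.comp_contMDiffOn
    (contMDiffOn_extChartAt_symm (I := 𝓡 (2 * n)) (n := ∞) x₀))).smul (hα x₀)

theorem extD_eq_zero_of_eventuallyEq {k : ℕ} {α : Form n M ℂ k} {m : M}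
    (h : ∀ᶠ x in 𝓝 m, α x = 0) : extD α m = 0 := by
  refine (formAt_extD α m).trans ?_
  have hc : ContinuousAt (extChartAt (𝓡 (2 * n)) m).symm (extChartAt (𝓡 (2 * n)) m m) :=
    continuousAt_extChartAt_symm m
  have h1 : chartForm α m =ᶠ[𝓝 (extChartAt (𝓡 (2 * n)) m m)] fun _ => 0 := by
    have h' := hc.eventually (by rwa [extChartAt_to_inv])
    filter_upwards [h'] with y hy
    have hy' : formAt α ((extChartAt (𝓡 (2 * n)) m).symm y) = 0 := hy
    rw [chartForm_eq, hy']
    rfl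
  rw [h1.extDeriv_eq, extDeriv, fderiv_const_apply]
  exact map_zero (ContinuousAlternatingMap.alternatizeUncurryFinCLM ℝ (Coord n) ℂ)

theorem formAt_extD_eq_sum {ι : Type*} [Fintype ι] (ρ : SmoothPartitionOfUnity ι (𝓡 (2 * n)) M)
    {k : ℕ} {α : Form n M ℂ k} (hα : IsSmoothForm α) (m : M) :
    formAt (extD α) m = ∑ i, formAt (extD (smulForm (ρ i) α)) m := by
  simp only [formAt_extD]
  have h1 : chartForm α m = fun y => ∑ i, chartForm (smulForm (ρ i) α) m y := by
    ext1 y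
    simp only [chartForm_smulForm, ← Finset.sum_smul]
    rw [sum_partition, one_smul]
  have hd : ∀ i, DifferentiableAt ℝ (chartForm (smulForm (ρ i) α) m)
      (extChartAt (𝓡 (2 * n)) m m) := fun i =>
    ((hα.smulForm (ρ i).contMDiff).contDiffAt (mem_extChartAt_target m)).differentiableAt (by simp)
  rw [h1, extDeriv, fderiv_fun_sum fun i _ => hd i]
  exact map_sum (ContinuousAlternatingMap.alternatizeUncurryFinCLM ℝ (Coord n) ℂ) _ _

/-- The pairing of two forms of complementary degrees, divided by the volume form. -/
def pairingDensity {k l : ℕ} (h : k + l = 2 * n) (α : Form n M ℂ k) (β : Form n M ℂ l) (m : M) :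
    ℝ :=
  pairing h (formAt α m) (formAt β m) (stdBasis n) / formAt (volForm g) m (stdBasis n)

/-- The quotient of two top-degree forms does not depend on the tuple used to form it, so the
density may be evaluated on unitary frames and on coordinate frames alike. -/
theorem pairingDensity_mul {k l : ℕ} (h : k + l = 2 * n) (α : Form n M ℂ k) (β : Form n M ℂ l)
    (m : M) (v : Fin (2 * n) → Coord n) :
    pairingDensity g h α β m * formAt (volForm g) m v = pairing h (formAt α m) (formAt β m) v := by
  obtain ⟨u, hu⟩ := exists_unitary g m
  have h1 := pairing_mul_comm h (formAt α m) (formAt β m) hu.orthonormal (by simp)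
    (formAt (volForm g) m)
  have hu0 : formAt (volForm g) m u ≠ 0 := by
    rw [volForm_unitary g hu]
    exact unitVolume_ne_zero n
  have he := volForm_basis_ne_zero g m (stdBasis n)
  rw [pairingDensity, div_mul_eq_mul_div, div_eq_iff he]
  refine mul_right_cancel₀ hu0 ?_
  linear_combination (formAt (volForm g) m v) * h1 (stdBasis n) -
    (formAt (volForm g) m (stdBasis n)) * h1 v

theorem pairingDensity_chart {k l : ℕ} (h : k + l = 2 * n) (α : Form n M ℂ k) (β : Form n M ℂ l)
    (x₀ : M) (y : Coord n) :
    pairingDensity g h α β ((extChartAt (𝓡 (2 * n)) x₀).symm y) * volDensity g x₀ y =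
      pairing h (chartForm α x₀ y) (chartForm β x₀ y) (stdBasis n) := by
  have h1 := pairingDensity_mul g h α β ((extChartAt (𝓡 (2 * n)) x₀).symm y)
    (chartSymmDeriv x₀ y ∘ stdBasis n)
  refine Eq.trans h1 ?_
  rw [pairing_apply, pairing_apply]
  rfl

theorem continuous_pairingDensity {k l : ℕ} (h : k + l = 2 * n) {α : Form n M ℂ k}
    {β : Form n M ℂ l} (hα : IsSmoothForm α) (hβ : IsSmoothForm β) :
    Continuous (pairingDensity g h α β) := by
  refine continuous_of_continuousOn_chart (n := n) fun x₀ => ?_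
  have h1 : ContinuousOn (fun y => pairing h (chartForm α x₀ y) (chartForm β x₀ y) (stdBasis n) /
      volDensity g x₀ y) (extChartAt (𝓡 (2 * n)) x₀).target := by
    refine ContinuousOn.div ?_ (continuousOn_volDensity g x₀) fun y hy => volDensity_ne_zero g hy
    simp only [pairing_apply]
    exact continuousOn_finsetSum _ fun σ _ => ((contDiffOn_eval (hα x₀) _).continuousOn.inner
      (contDiffOn_eval (hβ x₀) _).continuousOn).const_smul _
  refine h1.congr fun y hy => ?_
  simp only [← pairingDensity_chart g h]
  rw [mul_div_cancel_right₀ _ (volDensity_ne_zero g hy)]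

theorem pairingDensity_zero_left {k l : ℕ} (h : k + l = 2 * n) {α : Form n M ℂ k}
    (β : Form n M ℂ l) {m : M} (hα : α m = 0) : pairingDensity g h α β m = 0 := by
  have : formAt α m = 0 := hα
  rw [pairingDensity, this, pairing_apply]
  simp

/-- The density of `d(α ∧ β)`. -/
def stokesDensity {k l : ℕ} (h : k + 1 + l = 2 * n) (h' : k + (l + 1) = 2 * n)
    (α : Form n M ℂ k) (β : Form n M ℂ l) (m : M) : ℝ :=
  (1 / (k + 1 : ℝ)) * pairingDensity g h (extD α) β m +
    ((1 / (l + 1 : ℝ)) * (-1) ^ k) * pairingDensity g h' α (extD β) m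

theorem continuous_stokesDensity {k l : ℕ} (h : k + 1 + l = 2 * n) (h' : k + (l + 1) = 2 * n)
    {α : Form n M ℂ k} {β : Form n M ℂ l} (hα : IsSmoothForm α) (hβ : IsSmoothForm β) :
    Continuous (stokesDensity g h h' α β) :=
  (continuous_const.mul (continuous_pairingDensity g h hα.extD hβ)).add
    (continuous_const.mul (continuous_pairingDensity g h' hα hβ.extD))

theorem stokesDensity_eq_zero {k l : ℕ} (h : k + 1 + l = 2 * n) (h' : k + (l + 1) = 2 * n)
    {α : Form n M ℂ k} {β : Form n M ℂ l} {K : Set M} (hK : IsClosed K)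
    (hαK : ∀ m ∉ K, α m = 0) (m : M) (hm : m ∉ K) : stokesDensity g h h' α β m = 0 := by
  rw [stokesDensity, pairingDensity_zero_left g h' _ (hαK m hm),
    pairingDensity_zero_left g h _ (extD_eq_zero_of_eventuallyEq
      ((hK.isOpen_compl.mem_nhds hm |> Filter.eventually_mem_set.2).mono hαK))]
  simp

/-- With `|density| = sign · density`, the integrand becomes the coordinate expression of
`integral_pairing_extDeriv` times a sign. The sign is locally constant because the density is
continuous and has no zeros. -/
theorem chartIntegral_stokesDensity {k l : ℕ} (h : k + 1 + l = 2 * n) (h' : k + (l + 1) = 2 * n)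
    {α : Form n M ℂ k} {β : Form n M ℂ l} (hα : IsSmoothForm α) (hβ : IsSmoothForm β) {x₀ : M}
    {K : Set M} (hK : IsCompact K) (hKs : K ⊆ (extChartAt (𝓡 (2 * n)) x₀).source)
    (hαK : ∀ m ∉ K, α m = 0) : chartIntegral g x₀ (stokesDensity g h h' α β) = 0 := by
  have hs : ∀ y ∈ (extChartAt (𝓡 (2 * n)) x₀).target, ∀ᶠ z in 𝓝 y,
      (SignType.sign (volDensity g x₀ z) : ℝ) = SignType.sign (volDensity g x₀ y) := by
    intro y hy
    have hc := (continuousOn_volDensity g x₀).continuousAt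
      ((isOpen_extChartAt_target x₀).mem_nhds hy)
    rcases lt_or_gt_of_ne (volDensity_ne_zero g hy) with h0 | h0
    · filter_upwards [hc.eventually_lt_const h0] with z hz
      rw [sign_neg h0, sign_neg hz]
    · filter_upwards [hc.eventually_const_lt h0] with z hz
      rw [sign_pos h0, sign_pos hz]
  have hsub : extChartAt (𝓡 (2 * n)) x₀ '' K ⊆ (extChartAt (𝓡 (2 * n)) x₀).target :=
    Set.image_subset_iff.2 fun m hm => (extChartAt (𝓡 (2 * n)) x₀).map_source (hKs hm)
  have h1 := integral_pairing_extDeriv volume h h' (isOpen_extChartAt_target x₀)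
    (isCompact_image_chart hK hKs) hsub ((hα x₀).of_le (by simp)) ((hβ x₀).of_le (by simp))
    (fun y hy hyK => by
      have : formAt α ((extChartAt (𝓡 (2 * n)) x₀).symm y) = 0 :=
        hαK _ (notMem_of_notMem_image hy hyK)
      rw [chartForm_eq, this]
      rfl) hs (stdBasis n)
  rw [chartIntegral, ← h1]
  refine setIntegral_congr_fun (isOpen_extChartAt_target x₀).measurableSet fun y hy => ?_
  rw [← chartForm_extD hα hy, ← chartForm_extD hβ hy, ← pairingDensity_chart g h (extD α) β x₀ y,
    ← pairingDensity_chart g h' α (extD β) x₀ y, stokesDensity,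
    ← sign_mul_self (volDensity g x₀ y)]
  ring

variable [CompactSpace M] {ι : Type*} [Fintype ι] {ρ : SmoothPartitionOfUnity ι (𝓡 (2 * n)) M}
  {c : ι → M} (hρ : ∀ i, tsupport (ρ i) ⊆ (extChartAt (𝓡 (2 * n)) (c i)).source)

include hρ in
-- Splitting `α` as the sum of the `ρ i • α` reduces to forms supported in one chart; the
-- derivatives of the `ρ i` never appear because `extD` is additive.
theorem manifoldIntegral_stokesDensity {k l : ℕ} (h : k + 1 + l = 2 * n)
    (h' : k + (l + 1) = 2 * n) {α : Form n M ℂ k} {β : Form n M ℂ l} (hα : IsSmoothForm α)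
    (hβ : IsSmoothForm β) : manifoldIntegral g ρ c (stokesDensity g h h' α β) = 0 := by
  have hαi : ∀ i, IsSmoothForm (smulForm (ρ i) α) := fun i => hα.smulForm (ρ i).contMDiff
  have h1 : stokesDensity g h h' α β =
      fun m => ∑ i, stokesDensity g h h' (smulForm (ρ i) α) β m := by
    ext1 m
    have h2 : formAt α m = ∑ i, formAt (smulForm (ρ i) α) m := by
      simp only [formAt_smulForm, ← Finset.sum_smul]
      rw [sum_partition, one_smul]
    simp only [stokesDensity, pairingDensity]
    conv_lhs => rw [formAt_extD_eq_sum ρ hα m, h2]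
    simp only [pairing_sum_left, Finset.sum_div, Finset.mul_sum, ← Finset.sum_add_distrib]
  rw [h1, manifoldIntegral_sum g hρ _ fun i => continuous_stokesDensity g h h' (hαi i) hβ]
  refine Finset.sum_eq_zero fun i _ => ?_
  have hz : ∀ m ∉ tsupport (ρ i), smulForm (ρ i) α m = 0 := fun m hm => by
    rw [smulForm, image_eq_zero_of_notMem_tsupport hm, zero_smul]
  rw [manifoldIntegral_eq_chartIntegral g hρ (isClosed_tsupport (ρ i)).isCompact (hρ i)
    (continuous_stokesDensity g h h' (hαi i) hβ)
    (stokesDensity_eq_zero g h h' (isClosed_tsupport _) hz)]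
  exact chartIntegral_stokesDensity g h h' (hαi i) hβ (isClosed_tsupport (ρ i)).isCompact (hρ i) hz

end Adjoint

/-! ### Harmonic forms of Hermitian metrics are closed -/

section HarmonicForms

open Equiv

theorem exists_perm_comp_fstIdx {k l m : ℕ} (h : k + l = m) {v : Fin k → Fin m}
    (hv : Function.Injective v) : ∃ σ : Perm (Fin m), σ ∘ fstIdx h = v := by
  have hinj : Function.Injective (fstIdx h) := fun i j hij => by
    have := congrArg Fin.val hij
    ext
    simpa using this
  classical
  let e : {x // x ∈ Set.range (fstIdx h)} ≃ {x // x ∈ Set.range v} :=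
    (Equiv.ofInjective _ hinj).symm.trans (Equiv.ofInjective v hv)
  refine ⟨e.extendSubtype, funext fun i => ?_⟩
  rw [Function.comp_apply, e.extendSubtype_apply_of_mem _ ⟨i, rfl⟩]
  have h1 : (Equiv.ofInjective _ hinj).symm ⟨fstIdx h i, ⟨i, rfl⟩⟩ = i :=
    (Equiv.ofInjective _ hinj).symm_apply_apply i
  simp only [e, Equiv.trans_apply, h1]
  rfl

variable {n : ℕ} {M : Type*} [TopologicalSpace M] [ChartedSpace (Coord n) M]

theorem Form.eq_zero_of_lt {k : ℕ} (α : Form n M ℂ k) (hk : 2 * n < k) : α = 0 := by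
  funext m
  have h : (formAt α m).toAlternatingMap = 0 := by
    refine Module.Basis.ext_alternating (stdBasis n) fun v hv => ?_
    have := Fintype.card_le_of_injective v hv
    simp only [Fintype.card_fin] at this
    omega
  exact ContinuousAlternatingMap.toAlternatingMap_injective h

theorem IsSmoothForm.neg {k : ℕ} {α : Form n M ℂ k} (hα : IsSmoothForm α) : IsSmoothForm (-α) :=
  fun x₀ => (hα x₀).neg

variable [IsManifold (𝓡 (2 * n)) ∞ M] {J : AlmostComplexStructure n M} (g : HermitianMetric J)

/-- Dividing by the volume form cancels the volume of the frame, sign included. This density is a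
positive multiple of the pointwise real inner product. -/
theorem pairingDensity_star {k l : ℕ} (h : k + l = 2 * n) (α β : Form n M ℂ k) {m : M}
    {u : Fin (2 * n) → Coord n} (hu : IsUnitaryFrame (metricAt g m) (structureAt J m) u) :
    pairingDensity g h α (g.star h β) m = ∑ σ : Perm (Fin (2 * n)),
      inner ℝ (formAt α m (u ∘ σ ∘ fstIdx h)) (formAt β m (u ∘ σ ∘ fstIdx h)) := by
  have h1 := pairingDensity_mul g h α (g.star h β) m u
  rw [formAt_star, pairing_hodgeStar h _ _ hu.orthonormal, mul_comm] at h1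
  refine mul_left_cancel₀ ?_ h1
  rw [volForm_unitary g hu]
  exact unitVolume_ne_zero n

theorem pairingDensity_star_comm {k l : ℕ} (h : k + l = 2 * n) (α β : Form n M ℂ k) (m : M) :
    pairingDensity g h α (g.star h β) m = pairingDensity g h β (g.star h α) m := by
  obtain ⟨u, hu⟩ := exists_unitary g m
  rw [pairingDensity_star g h α β hu, pairingDensity_star g h β α hu]
  exact Finset.sum_congr rfl fun σ _ => real_inner_comm _ _

theorem pairingDensity_star_self_nonneg {k l : ℕ} (h : k + l = 2 * n) (α : Form n M ℂ k) (m : M) :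
    0 ≤ pairingDensity g h α (g.star h α) m := by
  obtain ⟨u, hu⟩ := exists_unitary g m
  rw [pairingDensity_star g h α α hu]
  exact Finset.sum_nonneg fun σ _ => real_inner_self_nonneg

theorem eq_zero_of_pairingDensity_star_self {k l : ℕ} (h : k + l = 2 * n) {α : Form n M ℂ k}
    {m : M} (h0 : pairingDensity g h α (g.star h α) m = 0) : α m = 0 := by
  obtain ⟨u, hu⟩ := exists_unitary g m
  rw [pairingDensity_star g h α α hu,
    Finset.sum_eq_zero_iff_of_nonneg fun σ _ => real_inner_self_nonneg] at h0
  have hz : (formAt α m).toAlternatingMap = 0 := by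
    -- An alternating form is determined by its values on injective tuples of basis vectors, and
    -- every such tuple is the beginning of a permutation of the frame.
    refine Module.Basis.ext_alternating (hu.orthonormal.basis (by simp)) fun v hv => ?_
    obtain ⟨σ, rfl⟩ := exists_perm_comp_fstIdx h hv
    have := inner_self_eq_zero.1 (h0 σ (Finset.mem_univ σ))
    rw [hu.orthonormal.coe_basis]
    exact this
  exact ContinuousAlternatingMap.toAlternatingMap_injective hz

theorem pairingDensity_star_star {k l : ℕ} (h : k + l = 2 * n) (h' : l + k = 2 * n)
    (α : Form n M ℂ k) (ζ : Form n M ℂ l) (m : M) :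
    pairingDensity g h α (g.star h (g.star h' ζ)) m =
      unitVolume n ^ 2 * (-1) ^ (k * l) * pairingDensity g h α ζ m := by
  obtain ⟨u, hu⟩ := exists_unitary g m
  have h1 := pairingDensity_mul g h α (g.star h (g.star h' ζ)) m u
  rw [formAt_star, formAt_star, pairing_hodgeStar_hodgeStar h h' _ _ hu.orthonormal,
    sign_rotateIdx, ← pairingDensity_mul g h α ζ m u, volForm_unitary g hu] at h1
  refine mul_right_cancel₀ (unitVolume_ne_zero n) (h1.trans ?_)
  push_cast
  ring

theorem pairingDensity_add_left {k l : ℕ} (h : k + l = 2 * n) (α α' : Form n M ℂ k)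
    (β : Form n M ℂ l) (m : M) : pairingDensity g h (α + α') β m =
      pairingDensity g h α β m + pairingDensity g h α' β m := by
  have h1 : formAt (α + α') m = formAt α m + formAt α' m := rfl
  simp only [pairingDensity, h1, pairing_apply, ContinuousAlternatingMap.add_apply, inner_add_left,
    smul_add, Finset.sum_add_distrib, add_div]

theorem pairingDensity_neg_left {k l : ℕ} (h : k + l = 2 * n) (α : Form n M ℂ k)
    (β : Form n M ℂ l) (m : M) : pairingDensity g h (-α) β m = -pairingDensity g h α β m := by
  have h1 := pairingDensity_add_left g h α (-α) β m
  rw [add_neg_cancel, pairingDensity_zero_left g h β rfl] at h1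
  linarith

theorem codiff_eq {k l : ℕ} (h : k + 1 + l = 2 * n) (h' : l + 1 + k = 2 * n)
    (β : Form n M ℂ (k + 1)) : g.codiff β = -g.star h' (extD (g.star h β)) := by
  obtain rfl : l = 2 * n - (k + 1) := by omega
  unfold HermitianMetric.codiff
  rw [dif_pos (by omega)]

theorem IsSmoothForm.codiff {k : ℕ} {β : Form n M ℂ (k + 1)} (hβ : IsSmoothForm β)
    (hk : k + 1 ≤ 2 * n) : IsSmoothForm (g.codiff β) := by
  rw [codiff_eq g (l := 2 * n - (k + 1)) (by omega) (by omega)]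
  exact ((hβ.star g _).extD.star g _).neg

/-- Inserting `⋆⋆` in front of `d⋆β` turns it into `d*β`, up to the square of `unitVolume` and a
sign. -/
theorem stokesDensity_star {k l : ℕ} (h : k + 1 + l = 2 * n) (h' : k + (l + 1) = 2 * n)
    (α : Form n M ℂ k) (β : Form n M ℂ (k + 1)) (m : M) :
    stokesDensity g h h' α (g.star h β) m =
      (1 / (k + 1 : ℝ)) * pairingDensity g h (extD α) (g.star h β) m +
        (-(1 / (l + 1 : ℝ)) / unitVolume n ^ 2) *
          pairingDensity g h' α (g.star h' (g.codiff β)) m := by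
  have h'' : l + 1 + k = 2 * n := by omega
  -- As `k + (l + 1)` is even, the sign of `⋆⋆` equals the sign `(-1)^k` from Stokes. They cancel,
  -- and the coefficient of the second term is negative in every degree.
  have hpar : (-1 : ℝ) ^ (k * (l + 1)) = (-1) ^ k := by
    rcases Nat.even_or_odd k with hk | hk
    · rw [hk.neg_one_pow, (hk.mul_right _).neg_one_pow]
    · have hl : Odd (l + 1) := by
        obtain ⟨j, hj⟩ := hk
        exact ⟨n - j - 1, by omega⟩
      rw [hk.neg_one_pow, (hk.mul hl).neg_one_pow]
  rw [pairingDensity_star_comm g h', codiff_eq g h h'', pairingDensity_neg_left,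
    pairingDensity_star_comm g h', pairingDensity_star_star g h' h'', hpar, stokesDensity]
  have := unitVolume_ne_zero n
  field_simp

variable [CompactSpace M] {ι : Type*} [Fintype ι] {ρ : SmoothPartitionOfUnity ι (𝓡 (2 * n)) M}
  {c : ι → M} (hρ : ∀ i, tsupport (ρ i) ⊆ (extChartAt (𝓡 (2 * n)) (c i)).source)

include hρ in
-- `d*` is the adjoint of `d` up to a positive factor, which comes from the unnormalized pairings
-- and from `unitVolume`. The factor depends on neither form, and its positivity is all that is
-- used.
theorem exists_integral_extD_eq {k l : ℕ} (h : k + 1 + l = 2 * n) (h' : k + (l + 1) = 2 * n) :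
    ∃ A : ℝ, 0 < A ∧ ∀ (α : Form n M ℂ k) (β : Form n M ℂ (k + 1)), IsSmoothForm α →
      IsSmoothForm β →
      manifoldIntegral g ρ c (pairingDensity g h (extD α) (g.star h β)) =
        A * manifoldIntegral g ρ c (pairingDensity g h' α (g.star h' (g.codiff β))) := by
  have hu := unitVolume_ne_zero n
  refine ⟨(k + 1 : ℝ) / ((l + 1) * unitVolume n ^ 2), by positivity, fun α β hα hβ => ?_⟩
  have h1 := manifoldIntegral_stokesDensity g hρ h h' hα (hβ.star g h)
  have hc1 := continuous_pairingDensity g h hα.extD (hβ.star g h)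
  have hc2 := continuous_pairingDensity g h' hα ((hβ.codiff g (by omega)).star g h')
  rw [funext (stokesDensity_star g h h' α β), manifoldIntegral_add g hρ
    (hc1.const_mul (1 / (k + 1 : ℝ)))
    (hc2.const_mul (-(1 / (l + 1 : ℝ)) / unitVolume n ^ 2)), manifoldIntegral_const_mul,
    manifoldIntegral_const_mul] at h1
  field_simp at h1 ⊢
  linarith

include hρ in
theorem eq_zero_of_integral_star_self {k l : ℕ} (h : k + l = 2 * n) {α : Form n M ℂ k}
    (hα : IsSmoothForm α)
    (h0 : manifoldIntegral g ρ c (pairingDensity g h α (g.star h α)) = 0) : α = 0 :=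
  funext fun m => eq_zero_of_pairingDensity_star_self g h
    (eq_zero_of_manifoldIntegral_eq_zero g hρ (continuous_pairingDensity g h hα (hα.star g h))
      (pairingDensity_star_self_nonneg g h α) h0 m)

include hρ in
theorem extD_eq_zero_of_codiff_extD {k l : ℕ} (h : k + 1 + l = 2 * n) (h' : k + (l + 1) = 2 * n)
    {α : Form n M ℂ k} (hα : IsSmoothForm α)
    (h0 : manifoldIntegral g ρ c (pairingDensity g h' α (g.star h' (g.codiff (extD α)))) = 0) :
    extD α = 0 := by
  obtain ⟨A, -, hA⟩ := exists_integral_extD_eq g hρ h h'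
  refine eq_zero_of_integral_star_self g hρ h hα.extD ?_
  rw [hA α _ hα hα.extD, h0, mul_zero]

theorem exists_subordinate_partition [T2Space M] :
    ∃ (t : Finset M) (ρ : SmoothPartitionOfUnity t (𝓡 (2 * n)) M),
      ∀ i, tsupport (ρ i) ⊆ (extChartAt (𝓡 (2 * n)) (i : M)).source := by
  obtain ⟨t, ht⟩ := CompactSpace.elim_nhds_subcover
    (fun x : M => (extChartAt (𝓡 (2 * n)) x).source) fun x => extChartAt_source_mem_nhds x
  obtain ⟨ρ, hρ⟩ := SmoothPartitionOfUnity.exists_isSubordinate (𝓡 (2 * n)) isClosed_univ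
    (fun i : t => (extChartAt (𝓡 (2 * n)) (i : M)).source) (fun i => isOpen_extChartAt_source _)
    (fun x _ => by
      have hx : x ∈ ⋃ x ∈ t, (extChartAt (𝓡 (2 * n)) x).source := ht ▸ Set.mem_univ x
      simp only [Set.mem_iUnion] at hx ⊢
      obtain ⟨i, hi, hx⟩ := hx
      exact ⟨⟨i, hi⟩, hx⟩)
  exact ⟨t, ρ, hρ⟩

/-- Pairing `Δ_d α = 0` with `α` gives `A ‖d*α‖² + ⟨d*dα, α⟩ = 0`, while `‖dα‖² = B ⟨α, d*dα⟩` with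
`A, B > 0`. Both terms of the sum are nonnegative, so `⟨α, d*dα⟩ = 0` and `dα = 0`. -/
theorem extD_eq_zero_of_laplacian_eq_zero [T2Space M] {k : ℕ} {α : Form n M ℂ k}
    (hα : IsSmoothForm α) (h0 : g.laplacian α = 0) : extD α = 0 := by
  -- From top degree on, `dα` vanishes for reasons of degree; below it, the complementary degree `l`
  -- exists and `codiff` is given by its star formula.
  by_cases hk : 2 * n < k + 1
  · exact Form.eq_zero_of_lt _ hk
  obtain ⟨t, ρ, hρ⟩ := exists_subordinate_partition (n := n) (M := M)
  obtain ⟨l, h⟩ : ∃ l, k + 1 + l = 2 * n := ⟨2 * n - (k + 1), by omega⟩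
  have h' : k + (l + 1) = 2 * n := by omega
  refine extD_eq_zero_of_codiff_extD g hρ h h' hα ?_
  have hzero : ∀ β : Form n M ℂ k, β = 0 →
      manifoldIntegral g ρ (fun i : t => (i : M)) (pairingDensity g h' β (g.star h' α)) = 0 := by
    rintro β rfl
    rw [funext fun m => pairingDensity_zero_left g h' (α := 0) (g.star h' α) (m := m) rfl]
    simp [manifoldIntegral, chartIntegral]
  rw [funext (pairingDensity_star_comm g h' α (g.codiff (extD α)))]
  cases k with
  -- On functions the Laplacian is `d*d` alone, so the pairing vanishes at once.
  | zero => exact hzero _ h0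
  | succ k =>
    change extD (g.codiff α) + g.codiff (extD α) = 0 at h0
    have hδ := hα.codiff g (by omega)
    have h'' : k + (l + 1 + 1) = 2 * n := by omega
    have h1 := hzero _ h0
    obtain ⟨A, hA0, hA⟩ := exists_integral_extD_eq g hρ h' h''
    obtain ⟨B, hB0, hB⟩ := exists_integral_extD_eq g hρ h h'
    rw [funext (pairingDensity_add_left g h' _ _ _), manifoldIntegral_add g hρ
      (continuous_pairingDensity g h' hδ.extD (hα.star g h'))
      (continuous_pairingDensity g h' (hα.extD.codiff g (by omega)) (hα.star g h')),
      hA _ _ hδ hα] at h1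
    have h2 := hB α _ hα hα.extD
    rw [funext (pairingDensity_star_comm g h' α (g.codiff (extD α)))] at h2
    have h3 := manifoldIntegral_nonneg g (ρ := ρ) (c := fun i : t => (i : M))
      (pairingDensity_star_self_nonneg g h (extD α))
    have h4 := manifoldIntegral_nonneg g (ρ := ρ) (c := fun i : t => (i : M))
      (pairingDensity_star_self_nonneg g h'' (g.codiff α))
    have h5 : 0 ≤ manifoldIntegral g ρ (fun i : t => (i : M))
        (pairingDensity g h' (g.codiff (extD α)) (g.star h' α)) := by
      rw [h2] at h3
      exact nonneg_of_mul_nonneg_right h3 hB0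
    have h6 := mul_nonneg hA0.le h4
    linarith

end HarmonicForms

/-! ### Comparison of harmonic and closed forms. -/

section Main

variable {n : ℕ} {M : Type*} [TopologicalSpace M] [ChartedSpace (Coord n) M]
  [IsManifold (𝓡 (2 * n)) ∞ M] [T2Space M] [CompactSpace M] {J : AlmostComplexStructure n M}

theorem harmonicForms_subset_closedForms (g : HermitianMetric J) (p q : ℕ) :
    harmonicForms g p q ⊆ closedForms J p q :=
  fun _ hα => ⟨hα.1, extD_eq_zero_of_laplacian_eq_zero g hα.1.1 hα.2⟩

theorem harmonicForms_eq_closedForms {g : HermitianMetric J} (hg : g.IsAlmostKahler) {p : ℕ}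
    (hp : p ≤ n) : harmonicForms g p 0 = closedForms J p 0 :=
  (harmonicForms_subset_closedForms g p 0).antisymm fun _ hα =>
    ⟨hα.1, laplacian_eq_zero g hg hp hα.1.1 hα.1.2 hα.2⟩

end Main

end AlmostHermitian

end

theorem mainTheorem2 {n : ℕ} {M : Type*} [TopologicalSpace M]
    [ChartedSpace (EuclideanSpace ℝ (Fin (2 * n))) M]
    [IsManifold (𝓡 (2 * n)) ∞ M]
    [T2Space M] [CompactSpace M]
    (J : AlmostHermitian.AlmostComplexStructure n M) (p : ℕ) (hp : p ≤ n)
    (g : AlmostHermitian.HermitianMetric J) (hg : g.IsAlmostKahler) :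
    AlmostHermitian.harmonicForms g p 0 = AlmostHermitian.closedForms J p 0 ∧
    (∀ g' : AlmostHermitian.HermitianMetric J, g'.IsAlmostKahler →
      AlmostHermitian.harmonicForms g' p 0 = AlmostHermitian.harmonicForms g p 0) ∧
    IsGreatest (Set.range fun g' : AlmostHermitian.HermitianMetric J =>
      AlmostHermitian.hodgeNumber g' p 0) (AlmostHermitian.hodgeNumber g p 0) := by
  have h := AlmostHermitian.harmonicForms_eq_closedForms hg hp
  refine ⟨h, fun g' hg' => (AlmostHermitian.harmonicForms_eq_closedForms hg' hp).trans h.symm,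
    ⟨g, rfl⟩, ?_⟩
  rintro _ ⟨g', rfl⟩
  -- The rank is a cardinal and monotone under inclusion, so no finiteness of the spaces of harmonic
  -- forms is needed.
  refine Submodule.rank_mono (Submodule.span_mono ?_)
  rw [h]
  exact AlmostHermitian.harmonicForms_subset_closedForms g' p 0
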